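/- Let $\varphi=\frac{1+\sqrt5}{2}$. A kite is the quadrilateral with interior angles $\frac{2\pi}5,\frac{2\pi}5,\frac{4\pi}5,\frac{2\pi}5$ and a dart is the quadrilateral with interior angles $\frac{2\pi}5,\frac{\pi}5,\frac{6\pi}5,\frac{\pi}5$ (in cyclic order, starting at the apex, where the two long edges meet); both have two long edges of length $\varphi$ and two short edges of length $1$. In a kite the apex and the opposite vertex are black and the other two vertices white; in a dart the apex and the opposite vertex are white and the other two vertices black. A P2 tiling is an edge-to-edge tiling of the plane by kites and darts such that on each edge shared by two tiles the colors of the end points agree. Its P2-graph is the graph whose vertices are the tiles, two tiles being adjacent if they share an edge. An induced subtree of a graph $G$ is *fully leafed* if it is finite and has the maximal number of leaves (vertices of degree one) among all induced subtrees of $G$ of the same order. For a tree $T$, let $T'$ be the graph obtained by deleting its leaves. A *prime caterpillar* is a fully leafed induced subtree of a P2-graph with exactly $8$ internal (that is, non-leaf) tiles, all of degree $3$. If $I_1,I_2$ are fully leafed induced subtrees, $t$ is a leaf of both, $I_1\cap I_2=\{t\}$, and $I_1\cup I_2$ is a fully leafed induced subtree, then $I_1\cup I_2$ is called a grafting $I_1\diamond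 I_2$. A *bi-infinite fully leafed caterpillar* is an induced subtree $\mathcal C=\bigcup_{j\in\mathbb Z}C_j$ of a P2-graph whose derived graph $\mathcal C'$ is a bi-infinite chain, where every $C_j$ is a prime caterpillar and, for all $i\le j$, $(C_i\cup\dots\cup C_j)\diamond C_{j+1}$ is a grafting. A *star* is a set of five darts of the tiling with a common apex, called its center; it is adjacent to $C_j$ if one of its tiles shares an edge with a tile of $C_j$. For three consecutive prime caterpillars $C_{j-1},C_j,C_{j+1}$ let $a,v,b$ be the centers of the stars adjacent to $C_{j-1},C_j,C_{j+1}$, respectively. The *angle* of $C_j$ is the angle in $(0,2\pi)$ between the edges $va$ and $vb$, measured on the side on which $C_j$ lies, that is, the angle of that sector at $v$, bounded by the rays from $v$ through $a$ and through $b$, which contains the internal tiles of $C_j''$. **Lemma 2.** In no P2-graph is there a bi-infinite fully leafed caterpillar $\mathcal C=\bigcup_{j\in\mathbb Z}C_j$ with two consecutive prime caterpillars $C_j$, $C_{j+1}$ whose angles are both equal to $\frac{4\pi}5$. -/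

import Mathlib

noncomputable section

namespace PenroseP2

/-! ### Leaves, derived graphs, fully leafed induced subtrees

Induced subgraphs of a graph are represented by their vertex sets. -/

section Graph

variable {V : Type*} (G : SimpleGraph V)

/-- The degree of `v` in the subgraph induced by `S`. -/
def degIn (S : Set V) (v : V) : ℕ∞ := (G.neighborSet v ∩ S).encard

/-- The leaves (vertices of degree one) of the subgraph induced by `S`. -/
def leaves (S : Set V) : Set V := {v | v ∈ S ∧ degIn G S v = 1}

/-- The derived graph: the leaves are removed. -/
def derived (S : Set V) : Set V := S \ leaves G S

/-- `S` induces a (nonempty) tree. -/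
def IsInducedSubtree (S : Set V) : Prop := (G.induce S).IsTree

/-- `S` is a finite induced subtree with the largest number of leaves among all induced subtrees
of the same order. -/
def IsFullyLeafed (S : Set V) : Prop :=
  S.Finite ∧ IsInducedSubtree G S ∧
    ∀ T : Set V, IsInducedSubtree G T → T.encard = S.encard →
      (leaves G T).encard ≤ (leaves G S).encard

/-- A prime caterpillar: a fully leafed induced subtree with eight internal vertices, all of them
of degree three. -/
def IsPrimeCaterpillar (S : Set V) : Prop :=
  IsFullyLeafed G S ∧ (derived G S).encard = 8 ∧ ∀ v ∈ derived G S, degIn G S v = 3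

/-- `I₁ ∪ I₂` is a grafting of `I₁` and `I₂` at `t`. -/
def IsGrafting (I₁ I₂ : Set V) (t : V) : Prop :=
  IsFullyLeafed G I₁ ∧ IsFullyLeafed G I₂ ∧ t ∈ leaves G I₁ ∧ t ∈ leaves G I₂ ∧
    IsFullyLeafed G (I₁ ∪ I₂) ∧ I₁ ∩ I₂ = {t}

/-- `S` induces a chain that is infinite in both directions. -/
def IsBiInfiniteChain (S : Set V) : Prop :=
  Nonempty (G.induce S ≃g SimpleGraph.hasse ℤ)

/-- `… ◇ C (-1) ◇ C 0 ◇ C 1 ◇ …` is a bi-infinite fully leafed caterpillar: every `C j` is a prime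
caterpillar, the finite unions of consecutive `C j` are obtained by successive graftings (so they
are fully leafed), and the union of all `C j` is an induced tree whose derived graph is a
bi-infinite chain. -/
structure IsBiInfiniteFullyLeafedCaterpillar (C : ℤ → Set V) : Prop where
  prime : ∀ j, IsPrimeCaterpillar G (C j)
  graft : ∀ i j, i ≤ j → ∃ t, IsGrafting G (⋃ k ∈ Set.Icc i j, C k) (C (j + 1)) t
  tree : IsInducedSubtree G (⋃ j, C j)
  chain : IsBiInfiniteChain G (derived G (⋃ j, C j))

end Graph

/-! ### Kites, darts, and P2 tilings -/

/-- The two prototiles. -/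
inductive Kind : Type
  | kite
  | dart

/-- A placed tile. Since both prototiles are mirror symmetric, a tile is determined by its kind,
its apex (the vertex of angle `2π/5` between the two long edges) and the unit vector pointing from
the apex along the symmetry axis. The short edges have length `1`, the long ones length `φ`. -/
structure Tile : Type where
  kind : Kind
  apex : ℂ
  dir : Circle

namespace Tile

/-- The vertex on the symmetry axis where the two short edges meet: interior angle `4π/5` for a
kite, `6π/5` for a dart. -/
def tail (s : Tile) : ℂ :=
  match s.kind with
  | .kite => s.apex + (Real.goldenRatio : ℂ) * s.dir
  | .dart => s.apex + s.dir

/-- The common end of a long and a short edge, on the left of the symmetry axis. -/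
def left (s : Tile) : ℂ :=
  s.apex + (Real.goldenRatio : ℂ) * s.dir * Complex.exp ((Real.pi / 5 : ℝ) * Complex.I)

/-- The common end of a long and a short edge, on the right of the symmetry axis. -/
def right (s : Tile) : ℂ :=
  s.apex + (Real.goldenRatio : ℂ) * s.dir * Complex.exp ((-(Real.pi / 5) : ℝ) * Complex.I)

/-- The closed region of a tile, as the union of its two mirror-image halves. -/
def body (s : Tile) : Set ℂ :=
  convexHull ℝ {s.apex, s.left, s.tail} ∪ convexHull ℝ {s.apex, s.right, s.tail}

/-- The four edges of a tile, each written as (black end, white end). The black vertices are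
`apex` and `tail` for a kite, and `left` and `right` for a dart. -/
def edges (s : Tile) : Set (ℂ × ℂ) :=
  match s.kind with
  | .kite => {(s.apex, s.left), (s.apex, s.right), (s.tail, s.left), (s.tail, s.right)}
  | .dart => {(s.left, s.apex), (s.right, s.apex), (s.left, s.tail), (s.right, s.tail)}

end Tile

/-- A Penrose P2 tiling: the tiles cover the plane, have disjoint interiors, and whenever edges of
two different tiles have more than one point in common, these edges coincide together with the
colors of their ends. -/
structure IsP2Tiling (𝒯 : Set Tile) : Prop where
  cover : ⋃ s ∈ 𝒯, s.body = Set.univ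
  disjoint : ∀ s ∈ 𝒯, ∀ t ∈ 𝒯, s ≠ t → Disjoint (interior s.body) (interior t.body)
  matching : ∀ s ∈ 𝒯, ∀ t ∈ 𝒯, s ≠ t → ∀ e ∈ s.edges, ∀ f ∈ t.edges,
    (segment ℝ e.1 e.2 ∩ segment ℝ f.1 f.2).Subsingleton ∨ e = f

/-- The P2-graph of a tiling: two tiles are adjacent when they share an edge. -/
def P2Graph (𝒯 : Set Tile) : SimpleGraph 𝒯 where
  Adj s t := s ≠ t ∧ ∃ e, e ∈ s.1.edges ∧ e ∈ t.1.edges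
  symm := ⟨fun _ _ h => ⟨h.1.symm, h.2.imp fun _ he => he.symm⟩⟩
  loopless := ⟨fun _ h => h.1 rfl⟩

/-! ### Stars and angles -/

/-- The darts of the tiling with apex `v`. -/
def dartsAt (𝒯 : Set Tile) (v : ℂ) : Set 𝒯 := {s | s.1.kind = Kind.dart ∧ s.1.apex = v}

/-- `v` is the center of a star of the tiling: five darts have their apices at `v`. -/
def IsStarCenter (𝒯 : Set Tile) (v : ℂ) : Prop := (dartsAt 𝒯 v).encard = 5

/-- `v` is the center of a star adjacent to `C`: some tile of the star shares an edge with some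
tile of `C`. -/
def IsAdjacentStar (𝒯 : Set Tile) (C : Set 𝒯) (v : ℂ) : Prop :=
  IsStarCenter 𝒯 v ∧ ∃ s ∈ dartsAt 𝒯 v, ∃ c ∈ C, (P2Graph 𝒯).Adj s c

/-- The closed angular sector with vertex `v` swept by the ray from `v` in direction `u` when it
turns counterclockwise by the angle `α`. -/
def sector (v u : ℂ) (α : ℝ) : Set ℂ :=
  {z | ∃ r : ℝ, 0 ≤ r ∧ ∃ θ ∈ Set.Icc 0 α, z = v + r * u * Complex.exp (θ * Complex.I)}

/-- The edges from `v` to `a` and from `v` to `b` bound a sector of angle `α`, swept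
counterclockwise from `a` to `b`, that contains the set `X`. -/
def SectorContains (v a b : ℂ) (α : ℝ) (X : Set ℂ) : Prop :=
  a ≠ v ∧ (∃ r : ℝ, 0 < r ∧ b - v = r * (a - v) * Complex.exp (α * Complex.I)) ∧
    X ⊆ sector v (a - v) α

/-- The region covered by the internal tiles of the second derived graph of `C`. -/
def core (𝒯 : Set Tile) (C : Set 𝒯) : Set ℂ :=
  ⋃ s ∈ derived (P2Graph 𝒯) (derived (P2Graph 𝒯) (derived (P2Graph 𝒯) C)), s.1.body

/-- In `C₁ ◇ C₂ ◇ C₃`, the prime caterpillar `C₂` has angle `α`. The centers `a`, `v`, `b` of the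
stars adjacent to `C₁`, `C₂`, `C₃` are joined by the edges `va` and `vb`, and `α` is the angle
between these two edges, measured on the side on which `C₂` lies. -/
def HasAngle (𝒯 : Set Tile) (C₁ C₂ C₃ : Set 𝒯) (α : ℝ) : Prop :=
  0 < α ∧ α < 2 * Real.pi ∧
    ∃ a v b : ℂ, IsAdjacentStar 𝒯 C₁ a ∧ IsAdjacentStar 𝒯 C₂ v ∧ IsAdjacentStar 𝒯 C₃ b ∧
      (SectorContains v a b α (core 𝒯 C₂) ∨ SectorContains v b a α (core 𝒯 C₂))

end PenroseP2

end

/-! The proof reduces the claim to a finite case analysis of the tiles near two consecutive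
caterpillars. This analysis is done by a Boolean program whose soundness is proved and whose value
is computed by the kernel.

Shape of a prime caterpillar. Every tile has exactly four neighbors (`encard_neighborSet`), so an
inner tile of degree three misses exactly one of them (`Internal`). A neighbor that would close a
cycle with tiles already found must be the missing one. Together with the matching rules this leaves
few possibilities. Of the chain `p 0, …, p 7` of inner tiles, the six middle ones turn out to be
consecutive kites among the ten that surround a star (`Spine.exists_ring`), and no other star is
adjacent to the caterpillar (`Ring.apex_eq`). Hence the points in the definition of the angle are
the centers of these stars.

The angle. In a frame centered at the star, the apexes of `p 2` and `p 5` lie at distance `φ ^ 2`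
from the center in the directions `η ^ 2` and `η ^ 6`, so they subtend the angle `4π/5`. Both belong
to the core. A sector of angle `4π/5` that contains them has them on its boundary
(`sector_boundary`), so the centers belonging to the neighboring caterpillars lie on the two lines
from the center through these apexes (`Ring.rays`). If two consecutive angles equal `4π/5`, each of
the two centers lies on such a line of the other. Following the first caterpillar through the common
leaf into the second, the search finds no tiling with this property (`Ring.not_consecutive`).

Why the search is sound. Positions are exact elements of `ℤ[η]` with `η` a primitive tenth root of
unity; both choices `exp (±iπ/5)` are allowed, so mirror images need no separate treatment. Overlaps
are detected by the wedges of angle `π/5` at the vertices: two tiles of the tiling with a common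
wedge coincide (`Frame.eq_of_mem_wedges`). The invariant `Frame.Known` says that the recorded wedges
are compatible with every tile of the tiling. Each step of the program preserves it along the branch
that describes the actual tiling, so this branch is never discarded. That there is a tile across
each edge follows from covering, local finiteness and matching (`IsP2Tiling.exists_neighbor`). -/

set_option autoImplicit false

namespace PenroseP2

open Real Topology
open scoped goldenRatio ComplexConjugate

/-! ### Rotations by `π / 5` -/

/-- A rotation by `π / 5`, in either direction. -/
def IsTurn (η : Circle) : Prop := η = Circle.exp (π / 5) ∨ η = Circle.exp (-(π / 5))

theorem IsTurn.inv {η : Circle} (h : IsTurn η) : IsTurn η⁻¹ := by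
  rcases h with rfl | rfl
  · right; rw [Circle.exp_neg]
  · left; rw [Circle.exp_neg, inv_inv]

theorem isTurn_exp : IsTurn (Circle.exp (π / 5)) := Or.inl rfl

theorem cos_pi_div_five_eq : Real.cos (π / 5) = φ / 2 := by
  rw [Real.cos_pi_div_five, Real.goldenRatio]; ring

theorem sin_pi_div_five_pos : 0 < Real.sin (π / 5) :=
  Real.sin_pos_of_pos_of_lt_pi (by positivity) (by linarith [Real.pi_pos])

theorem sin_pi_div_five_sq : Real.sin (π / 5) ^ 2 = (3 - φ) / 4 := by
  rw [Real.sin_sq, cos_pi_div_five_eq, div_pow, Real.goldenRatio_sq]; ring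

theorem IsTurn.re {η : Circle} (h : IsTurn η) : (η : ℂ).re = φ / 2 := by
  rcases h with rfl | rfl <;>
    rw [Circle.coe_exp, Complex.exp_ofReal_mul_I_re, ← cos_pi_div_five_eq]
  rw [Real.cos_neg]

theorem IsTurn.im {η : Circle} (h : IsTurn η) :
    (η : ℂ).im = Real.sin (π / 5) ∨ (η : ℂ).im = -Real.sin (π / 5) := by
  rcases h with rfl | rfl <;> rw [Circle.coe_exp, Complex.exp_ofReal_mul_I_im]
  · left; rfl
  · right; rw [Real.sin_neg]

theorem coe_inv_add_coe {η : Circle} (h : IsTurn η) : (η : ℂ) + ((η⁻¹ : Circle) : ℂ) = φ := by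
  rw [Circle.coe_inv_eq_conj, Complex.add_conj, h.re]; push_cast; ring

theorem IsTurn.sq {η : Circle} (h : IsTurn η) : (η : ℂ) ^ 2 = φ * η - 1 := by
  have h1 : (η : ℂ) * ((η⁻¹ : Circle) : ℂ) = 1 := by
    rw [← Circle.coe_mul, mul_inv_cancel, Circle.coe_one]
  linear_combination (η : ℂ) * coe_inv_add_coe h - h1

theorem coe_goldenRatio_sq : ((φ : ℝ) : ℂ) ^ 2 = φ + 1 := by
  exact_mod_cast congrArg (fun x : ℝ => (x : ℂ)) Real.goldenRatio_sq

theorem IsTurn.coe_inv {η : Circle} (h : IsTurn η) : ((η⁻¹ : Circle) : ℂ) = φ - η := by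
  rw [← coe_inv_add_coe h]; ring

theorem IsTurn.cube {η : Circle} (h : IsTurn η) : (η : ℂ) ^ 3 = φ * η - φ := by
  linear_combination (η + φ : ℂ) * h.sq + (η : ℂ) * coe_goldenRatio_sq

theorem IsTurn.pow_four' {η : Circle} (h : IsTurn η) : (η : ℂ) ^ 4 = η - φ := by
  linear_combination (η : ℂ) * h.cube + φ * h.sq + (η : ℂ) * coe_goldenRatio_sq

/-- This is the tenth cyclotomic polynomial; it makes `1, η, η ^ 2, η ^ 3` a basis in which
multiplication by `η` has integer entries. -/
theorem IsTurn.pow_four {η : Circle} (h : IsTurn η) :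
    (η : ℂ) ^ 4 = η ^ 3 - η ^ 2 + η - 1 := by
  linear_combination h.pow_four' - h.cube + h.sq

theorem IsTurn.pow_five {η : Circle} (h : IsTurn η) : (η : ℂ) ^ 5 = -1 := by
  linear_combination (η : ℂ) * h.pow_four' + h.sq

theorem IsTurn.pow_ten {η : Circle} (h : IsTurn η) : η ^ 10 = 1 := by
  ext
  push_cast
  linear_combination ((η : ℂ) ^ 5 - 1) * h.pow_five

/-! ### Coordinates adapted to a tile -/

namespace Tile

/-- The end of a long and a short edge on the side of the axis determined by the turn `η`. -/
noncomputable def side (s : Tile) (η : Circle) : ℂ := s.apex + φ * s.dir * η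

theorem left_eq_side (s : Tile) : s.left = s.side (Circle.exp (π / 5)) := by
  rw [left, side, Circle.coe_exp]

theorem right_eq_side (s : Tile) : s.right = s.side (Circle.exp (-(π / 5))) := by
  rw [right, side, Circle.coe_exp]

theorem edges_kite (A : ℂ) (w : Circle) {η : Circle} (h : IsTurn η) :
    edges ⟨.kite, A, w⟩ = {(A, A + φ * w * η), (A, A + φ * w * (η⁻¹ : Circle)),
      (A + φ * w, A + φ * w * η), (A + φ * w, A + φ * w * (η⁻¹ : Circle))} := by
  simp only [edges, left_eq_side, right_eq_side, side, tail]
  rcases h with rfl | rfl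
  · rw [Circle.exp_neg]
  · rw [Circle.exp_neg, inv_inv, Set.insert_comm]
    congr 2
    rw [Set.pair_comm]

theorem edges_dart (A : ℂ) (w : Circle) {η : Circle} (h : IsTurn η) :
    edges ⟨.dart, A, w⟩ = {(A + φ * w * η, A), (A + φ * w * (η⁻¹ : Circle), A),
      (A + φ * w * η, A + w), (A + φ * w * (η⁻¹ : Circle), A + w)} := by
  simp only [edges, left_eq_side, right_eq_side, side, tail]
  rcases h with rfl | rfl
  · rw [Circle.exp_neg]
  · rw [Circle.exp_neg, inv_inv, Set.insert_comm]
    congr 2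
    rw [Set.pair_comm]

/-- Twice the coordinate along the symmetry axis. -/
noncomputable def ax (s : Tile) (z : ℂ) : ℝ := 2 * ((z - s.apex) * conj (s.dir : ℂ)).re

/-- The distance from the symmetry axis, in units of `sin (π / 5)`. -/
noncomputable def off (s : Tile) (z : ℂ) : ℝ := |((z - s.apex) * conj (s.dir : ℂ)).im| / Real.sin (π / 5)

/-- This is nonnegative on the side of the long edges on which the tile lies. -/
noncomputable def longGap (s : Tile) (z : ℂ) : ℝ := s.ax z - φ * s.off z

/-- This is nonnegative on the side of the short edges on which the tile lies. -/
noncomputable def shortGap (s : Tile) (z : ℂ) : ℝ :=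
  match s.kind with
  | .kite => 2 * φ - s.ax z - (2 - φ) * s.off z
  | .dart => 2 - s.ax z + (2 - φ) * s.off z

theorem local_coord (s : Tile) (q : ℂ) :
    (s.apex + s.dir * q - s.apex) * conj (s.dir : ℂ) = q := by
  have : (s.dir : ℂ) * conj (s.dir : ℂ) = 1 := by
    rw [← Circle.coe_inv_eq_conj, ← Circle.coe_mul, mul_inv_cancel, Circle.coe_one]
  linear_combination q * this

theorem ax_local (s : Tile) (q : ℂ) : s.ax (s.apex + s.dir * q) = 2 * q.re := by
  rw [ax, local_coord]

theorem off_local (s : Tile) (q : ℂ) :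
    s.off (s.apex + s.dir * q) = |q.im| / Real.sin (π / 5) := by
  rw [off, local_coord]

theorem exists_local (s : Tile) (z : ℂ) : ∃ q, z = s.apex + s.dir * q :=
  ⟨(z - s.apex) * conj (s.dir : ℂ), by
    have : (s.dir : ℂ) * conj (s.dir : ℂ) = 1 := by
      rw [← Circle.coe_inv_eq_conj, ← Circle.coe_mul, mul_inv_cancel, Circle.coe_one]
    linear_combination (s.apex - z) * this⟩

theorem off_nonneg (s : Tile) (z : ℂ) : 0 ≤ s.off z :=
  div_nonneg (abs_nonneg _) sin_pi_div_five_pos.le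

theorem continuous_ax (s : Tile) : Continuous s.ax := by
  unfold ax; fun_prop

theorem continuous_off (s : Tile) : Continuous s.off := by
  unfold off
  exact (by fun_prop : Continuous fun z : ℂ =>
    |((z - s.apex) * conj (s.dir : ℂ)).im|).div_const _

theorem continuous_longGap (s : Tile) : Continuous s.longGap :=
  s.continuous_ax.sub (continuous_const.mul s.continuous_off)

theorem continuous_shortGap (s : Tile) : Continuous s.shortGap := by
  have h1 := s.continuous_ax
  have h2 := s.continuous_off
  rcases s with ⟨_ | _, A, w⟩
  · exact (continuous_const.sub h1).sub (continuous_const.mul h2)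
  · exact (continuous_const.sub h1).add (continuous_const.mul h2)

end Tile

theorem goldenRatio_bounds : 1.618 < φ ∧ φ < 1.6181 := by
  have h := Real.goldenRatio_sq
  have h0 := Real.goldenRatio_pos
  constructor <;> nlinarith

/-! ### Barycentric coordinates in the two halves of a tile -/

namespace Tile

theorem mem_convexHull_triple {x y w z : ℂ} : z ∈ convexHull ℝ {x, y, w} ↔
    ∃ a b c : ℝ, 0 ≤ a ∧ 0 ≤ b ∧ 0 ≤ c ∧ a + b + c = 1 ∧ a * x + b * y + c * w = z := by
  rw [convexHull_insert (Set.insert_nonempty _ _), convexHull_pair, mem_convexJoin]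
  constructor
  · rintro ⟨_, rfl, p, ⟨a, b, ha, hb, hab, rfl⟩, c, d, hc, hd, hcd, rfl⟩
    refine ⟨c, d * a, d * b, hc, by positivity, by positivity, ?_, ?_⟩
    · rw [add_assoc, ← mul_add, hab, mul_one, hcd]
    · simp only [Complex.real_smul]; push_cast; ring
  · rintro ⟨a, b, c, ha, hb, hc, h, rfl⟩
    refine ⟨x, rfl, ?_⟩
    rcases eq_or_lt_of_le (add_nonneg hb hc) with h0 | h0
    · obtain rfl : b = 0 := by linarith
      obtain rfl : c = 0 := by linarith
      obtain rfl : a = 1 := by linarith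
      exact ⟨y, left_mem_segment _ _ _, by simpa using left_mem_segment ℝ x y⟩
    · refine ⟨_, ⟨b / (b + c), c / (b + c), by positivity, by positivity, by field_simp, rfl⟩,
        a, b + c, ha, h0.le, by linarith, ?_⟩
      have : (b + c : ℂ) ≠ 0 := by exact_mod_cast h0.ne'
      simp only [Complex.real_smul]; push_cast; field_simp; ring

/-- The length of the part of the symmetry axis inside the tile. -/
noncomputable def axisLen (s : Tile) : ℝ :=
  match s.kind with
  | .kite => φ
  | .dart => 1

theorem axisLen_pos (s : Tile) : 0 < s.axisLen := by
  rcases s with ⟨_ | _, A, w⟩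
  · exact Real.goldenRatio_pos
  · exact one_pos

theorem tail_eq (s : Tile) : s.tail = s.apex + s.dir * s.axisLen := by
  rcases s with ⟨_ | _, A, w⟩ <;> simp [tail, axisLen, mul_comm]

/-- After division by `2 * axisLen` the two gaps and `off / φ` sum to one: they are the barycentric
coordinates in a half tile, with weights at the tail, the apex and the side vertex. -/
theorem gap_add_gap (s : Tile) (z : ℂ) :
    s.longGap z + s.shortGap z = 2 * s.axisLen * (1 - s.off z / φ) := by
  have h := Real.goldenRatio_sq
  have h0 := Real.goldenRatio_pos.ne'
  rcases s with ⟨_ | _, A, w⟩ <;> simp only [longGap, shortGap, axisLen] <;>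
    generalize φ = p at * <;> field_simp
  · ring
  · linear_combination (-2 * off ⟨.dart, A, w⟩ z) * h

theorem comb_gaps (s : Tile) {η : Circle} (h : IsTurn η) {a b c : ℝ} (hb : 0 ≤ b)
    (habc : a + b + c = 1) :
    s.longGap (a * s.apex + b * s.side η + c * s.tail) = 2 * c * s.axisLen ∧
    s.shortGap (a * s.apex + b * s.side η + c * s.tail) = 2 * a * s.axisLen ∧
    ((a * s.apex + b * s.side η + c * s.tail - s.apex) * conj (s.dir : ℂ)).im =
      b * φ * (η : ℂ).im := by
  have hσ := sin_pi_div_five_pos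
  have hφ := Real.goldenRatio_pos
  have him : |(η : ℂ).im| = Real.sin (π / 5) := by
    rcases h.im with h | h <;> rw [h]
    · exact abs_of_pos hσ
    · rw [abs_neg, abs_of_pos hσ]
  have hz : (a * s.apex + b * s.side η + c * s.tail : ℂ) =
      s.apex + s.dir * (b * φ * η + c * s.axisLen) := by
    have : (a : ℂ) = 1 - b - c := by
      rw [← Complex.ofReal_one, ← habc]; push_cast; ring
    rw [side, tail_eq, this]; ring
  have hre : ((b * φ * η + c * s.axisLen : ℂ)).re = b * φ * (φ / 2) + c * s.axisLen := by
    rw [← h.re]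
    simp [← Complex.ofReal_mul]
  have him' : ((b * φ * η + c * s.axisLen : ℂ)).im = b * φ * (η : ℂ).im := by
    simp [← Complex.ofReal_mul]
  have hoff : s.off (a * s.apex + b * s.side η + c * s.tail) = b * φ := by
    rw [hz, off_local, him', abs_mul, him, abs_of_nonneg (by positivity),
      mul_div_cancel_right₀ _ hσ.ne']
  have hlong : s.longGap (a * s.apex + b * s.side η + c * s.tail) = 2 * c * s.axisLen := by
    rw [longGap, hoff, hz, ax_local, hre]; ring
  have hsum := s.gap_add_gap (a * s.apex + b * s.side η + c * s.tail)
  rw [hoff, hlong, mul_div_cancel_right₀ _ hφ.ne'] at hsum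
  refine ⟨hlong, ?_, ?_⟩
  · linear_combination hsum - 2 * s.axisLen * habc
  · rw [hz, local_coord, him']

/-- Converse of `comb_gaps`. The sign condition puts `z` on the side of the axis given by `η`, so
that the unsigned distance `off` determines the signed one. -/
theorem eq_comb (s : Tile) {η : Circle} (h : IsTurn η) {z : ℂ}
    (h3 : 0 ≤ ((z - s.apex) * conj (s.dir : ℂ)).im * (η : ℂ).im) :
    s.shortGap z / (2 * s.axisLen) + s.off z / φ + s.longGap z / (2 * s.axisLen) = 1 ∧
    ((s.shortGap z / (2 * s.axisLen) : ℝ) : ℂ) * s.apex + (s.off z / φ : ℝ) * s.side η +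
      (s.longGap z / (2 * s.axisLen) : ℝ) * s.tail = z := by
  have hσ := sin_pi_div_five_pos
  have hφ := Real.goldenRatio_pos
  have ht := s.axisLen_pos
  obtain ⟨q, rfl⟩ := s.exists_local z
  rw [local_coord] at h3
  have hsum := s.gap_add_gap (s.apex + s.dir * q)
  have hoff : s.off (s.apex + s.dir * q) * (η : ℂ).im = q.im := by
    rw [off_local]
    rcases h.im with h | h <;> rw [h] at h3 ⊢
    · rw [abs_of_nonneg (nonneg_of_mul_nonneg_left h3 hσ), div_mul_cancel₀ _ hσ.ne']
    · rw [abs_of_nonpos (by nlinarith)]; field_simp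
  have hre : 2 * q.re = s.longGap (s.apex + s.dir * q) + φ * s.off (s.apex + s.dir * q) := by
    rw [longGap, ax_local]; ring
  generalize s.off (s.apex + s.dir * q) = o at *
  generalize s.longGap (s.apex + s.dir * q) = g at *
  generalize s.shortGap (s.apex + s.dir * q) = g' at *
  have h1 : (g' / (2 * s.axisLen) : ℝ) = 1 - o / φ - g / (2 * s.axisLen) := by
    field_simp at hsum ⊢
    linear_combination hsum
  refine ⟨by rw [h1]; ring, ?_⟩
  have hq : q = o / φ * (φ * η) + g / (2 * s.axisLen) * s.axisLen := by
    have : (o / φ * (φ * η) + g / (2 * s.axisLen) * s.axisLen : ℂ) =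
        (o : ℝ) * η + ((g / 2 : ℝ) : ℂ) := by
      have e1 : (φ : ℂ) ≠ 0 := by exact_mod_cast hφ.ne'
      have e2 : (s.axisLen : ℂ) ≠ 0 := by exact_mod_cast ht.ne'
      generalize φ = p at *
      push_cast; field_simp
    rw [this]
    apply Complex.ext
    · rw [Complex.add_re, Complex.re_ofReal_mul, Complex.ofReal_re, h.re]
      linarith
    · rw [Complex.add_im, Complex.im_ofReal_mul, Complex.ofReal_im, add_zero, hoff]
  rw [side, tail_eq, h1]
  conv_rhs => rw [hq]
  generalize φ = p at *
  push_cast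
  ring

theorem mem_half (s : Tile) {η : Circle} (h : IsTurn η) (z : ℂ) :
    z ∈ convexHull ℝ {s.apex, s.side η, s.tail} ↔
      0 ≤ s.longGap z ∧ 0 ≤ s.shortGap z ∧
        0 ≤ ((z - s.apex) * conj (s.dir : ℂ)).im * (η : ℂ).im := by
  have hφ := Real.goldenRatio_pos
  have ht := s.axisLen_pos
  rw [mem_convexHull_triple]
  constructor
  · rintro ⟨a, b, c, ha, hb, hc, habc, rfl⟩
    obtain ⟨h1, h2, h3⟩ := s.comb_gaps h hb habc
    rw [h1, h2, h3, mul_assoc (b * φ)]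
    exact ⟨by positivity, by positivity, mul_nonneg (by positivity) (mul_self_nonneg _)⟩
  · rintro ⟨h1, h2, h3⟩
    obtain ⟨h4, h5⟩ := s.eq_comb h h3
    exact ⟨_, _, _, by positivity, div_nonneg (s.off_nonneg _) hφ.le, by positivity, h4, h5⟩

theorem exists_turn (s : Tile) (z : ℂ) :
    ∃ η, IsTurn η ∧ 0 ≤ ((z - s.apex) * conj (s.dir : ℂ)).im * (η : ℂ).im := by
  have hσ := sin_pi_div_five_pos
  rcases le_total 0 ((z - s.apex) * conj (s.dir : ℂ)).im with h | h
  · refine ⟨_, isTurn_exp, ?_⟩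
    rw [Circle.coe_exp, Complex.exp_ofReal_mul_I_im]
    exact mul_nonneg h hσ.le
  · refine ⟨_, isTurn_exp.inv, ?_⟩
    rw [Circle.coe_inv_eq_conj, Complex.conj_im, Circle.coe_exp, Complex.exp_ofReal_mul_I_im]
    exact mul_nonneg_of_nonpos_of_nonpos h (neg_nonpos.2 hσ.le)

/-- The gaps ignore the sign of the distance from the axis, and each point is on the side of one of
the halves. The same two inequalities thus serve the kite and the nonconvex dart. -/
theorem mem_body (s : Tile) (z : ℂ) : z ∈ s.body ↔ 0 ≤ s.longGap z ∧ 0 ≤ s.shortGap z := by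
  rw [body, left_eq_side, right_eq_side, Set.mem_union, s.mem_half isTurn_exp,
    s.mem_half (Or.inr rfl)]
  have h1 : ((Circle.exp (π / 5) : Circle) : ℂ).im = Real.sin (π / 5) := by
    rw [Circle.coe_exp, Complex.exp_ofReal_mul_I_im]
  have h2 : ((Circle.exp (-(π / 5)) : Circle) : ℂ).im = -Real.sin (π / 5) := by
    rw [Circle.coe_exp, Complex.exp_ofReal_mul_I_im, Real.sin_neg]
  rw [h1, h2]
  have h3 := sin_pi_div_five_pos
  rcases le_total 0 ((z - s.apex) * conj (s.dir : ℂ)).im with h | h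
  · have := mul_nonneg h h3.le
    tauto
  · have := mul_nonneg_of_nonpos_of_nonpos h (neg_nonpos.2 h3.le)
    tauto

end Tile

/-! ### Interior and edges of a tile -/

namespace Tile

/-- The tile without its edges. -/
def Strict (s : Tile) (z : ℂ) : Prop := 0 < s.longGap z ∧ 0 < s.shortGap z

theorem Strict.mem_interior {s : Tile} {z : ℂ} (h : s.Strict z) : z ∈ interior s.body := by
  refine _root_.mem_interior.2 ⟨{z | s.Strict z}, fun w hw => (s.mem_body w).2 ⟨hw.1.le, hw.2.le⟩, ?_, h⟩
  exact (isOpen_lt continuous_const s.continuous_longGap).inter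
    (isOpen_lt continuous_const s.continuous_shortGap)

theorem isClosed_body (s : Tile) : IsClosed s.body := by
  have : s.body = {z | 0 ≤ s.longGap z} ∩ {z | 0 ≤ s.shortGap z} := by
    ext z; exact s.mem_body z
  rw [this]
  exact (isClosed_le continuous_const s.continuous_longGap).inter
    (isClosed_le continuous_const s.continuous_shortGap)

/-- An interior point with respect to which the tile is star-shaped. -/
noncomputable def mid (s : Tile) : ℂ := s.apex + s.dir * (1 / 2 : ℝ)

/-- Since `mid` is on the axis, `off` is multiplied by `1 - t`, so the gap is affine in `t`.
Negative `t` is allowed and serves to step out of the tile in `not_mem_away`. -/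
theorem longGap_toward (s : Tile) (z : ℂ) {t : ℝ} (ht : t ≤ 1) :
    s.longGap (z + t * (s.mid - z)) = (1 - t) * s.longGap z + t := by
  obtain ⟨q, rfl⟩ := s.exists_local z
  have e : s.apex + s.dir * q + t * (s.mid - (s.apex + s.dir * q)) =
      s.apex + s.dir * ((1 - t : ℝ) * q + (t / 2 : ℝ)) := by
    rw [mid]; push_cast; ring
  rw [e, longGap, longGap, ax_local, ax_local, off_local, off_local, Complex.add_re,
    Complex.add_im, Complex.re_ofReal_mul, Complex.im_ofReal_mul, Complex.ofReal_re,
    Complex.ofReal_im, add_zero, abs_mul, abs_of_nonneg (sub_nonneg.2 ht)]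
  ring

theorem shortGap_toward (s : Tile) (z : ℂ) {t : ℝ} (ht : t ≤ 1) :
    s.shortGap (z + t * (s.mid - z)) = (1 - t) * s.shortGap z + t * (2 * s.axisLen - 1) := by
  obtain ⟨q, rfl⟩ := s.exists_local z
  have e : s.apex + s.dir * q + t * (s.mid - (s.apex + s.dir * q)) =
      s.apex + s.dir * ((1 - t : ℝ) * q + (t / 2 : ℝ)) := by
    rw [mid]; push_cast; ring
  have h1 : s.ax (s.apex + s.dir * q + t * (s.mid - (s.apex + s.dir * q))) =
      (1 - t) * s.ax (s.apex + s.dir * q) + t := by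
    rw [e, ax_local, ax_local, Complex.add_re, Complex.re_ofReal_mul, Complex.ofReal_re]; ring
  have h2 : s.off (s.apex + s.dir * q + t * (s.mid - (s.apex + s.dir * q))) =
      (1 - t) * s.off (s.apex + s.dir * q) := by
    rw [e, off_local, off_local, Complex.add_im, Complex.im_ofReal_mul, Complex.ofReal_im,
      add_zero, abs_mul, abs_of_nonneg (sub_nonneg.2 ht)]
    ring
  generalize s.apex + s.dir * q = z at *
  rcases s with ⟨_ | _, A, w⟩ <;> simp only [shortGap, axisLen, h1, h2] <;> ring

theorem axisLen_ge (s : Tile) : 1 ≤ s.axisLen := by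
  rcases s with ⟨_ | _, A, w⟩
  · exact Real.one_lt_goldenRatio.le
  · exact le_rfl

theorem strict_toward (s : Tile) {z : ℂ} (hz : z ∈ s.body) {t : ℝ} (h0 : 0 < t) (h1 : t ≤ 1) :
    s.Strict (z + t * (s.mid - z)) := by
  obtain ⟨h2, h3⟩ := (s.mem_body z).1 hz
  have := s.axisLen_ge
  refine ⟨?_, ?_⟩
  · rw [s.longGap_toward z h1]
    nlinarith
  · rw [s.shortGap_toward z h1]
    have : 0 < t * (2 * s.axisLen - 1) := by apply mul_pos h0; linarith
    nlinarith

theorem not_mem_away (s : Tile) {z : ℂ} (hz : s.longGap z = 0 ∨ s.shortGap z = 0) {t : ℝ}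
    (h0 : 0 < t) : z - t * (s.mid - z) ∉ s.body := by
  rw [mem_body, not_and_or, not_le, not_le]
  have := s.axisLen_ge
  have e : z - t * (s.mid - z) = z + (-t : ℝ) * (s.mid - z) := by push_cast; ring
  rw [e, s.longGap_toward z (by linarith), s.shortGap_toward z (by linarith)]
  rcases hz with h | h
  · left; rw [h]; linarith
  · right; rw [h]; nlinarith

theorem tendsto_toward (z c : ℂ) :
    Filter.Tendsto (fun t : ℝ => z + t * (c - z)) (𝓝[>] 0) (𝓝 z) := by
  have : Filter.Tendsto (fun t : ℝ => z + t * (c - z)) (𝓝 0) (𝓝 (z + (0 : ℝ) * (c - z))) := by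
    apply Continuous.tendsto; fun_prop
  rw [Complex.ofReal_zero, zero_mul, add_zero] at this
  exact this.mono_left nhdsWithin_le_nhds

theorem exists_strict_mem (s : Tile) {z : ℂ} (hz : z ∈ s.body) {U : Set ℂ} (hU : U ∈ 𝓝 z) :
    ∃ y ∈ U, s.Strict y := by
  have h1 := (tendsto_toward z s.mid).eventually hU
  have h2 : ∀ᶠ t : ℝ in 𝓝[>] 0, t ∈ Set.Ioc (0 : ℝ) 1 := Ioc_mem_nhdsGT one_pos
  obtain ⟨t, h3, h4⟩ := (h1.and h2).exists
  exact ⟨_, h3, s.strict_toward hz h4.1 h4.2⟩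

theorem exists_edge_of_mem_body (s : Tile) {z : ℂ} (hz : z ∈ s.body) (h : ¬ s.Strict z) :
    ∃ e ∈ s.edges, z ∈ segment ℝ e.1 e.2 := by
  obtain ⟨h1, h2⟩ := (s.mem_body z).1 hz
  obtain ⟨η, hη, h3⟩ := s.exists_turn z
  obtain ⟨h4, h5⟩ := s.eq_comb hη h3
  have ht := s.axisLen_pos
  have ho : 0 ≤ s.off z / φ := div_nonneg (s.off_nonneg z) Real.goldenRatio_pos.le
  rw [Strict, not_and_or, not_lt, not_lt] at h
  have key : z ∈ segment ℝ s.apex (s.side η) ∨ z ∈ segment ℝ s.tail (s.side η) := by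
    rcases h with h | h
    · left
      have h0 : s.longGap z = 0 := le_antisymm h h1
      rw [h0] at h4 h5
      simp only [zero_div, Complex.ofReal_zero, zero_mul, add_zero] at h4 h5
      exact ⟨_, _, by positivity, ho, h4, h5⟩
    · right
      have h0 : s.shortGap z = 0 := le_antisymm h h2
      rw [h0] at h4 h5
      refine ⟨s.longGap z / (2 * s.axisLen), _, by positivity, ho, by simp only [zero_div] at h4; linarith, ?_⟩
      simp only [zero_div, Complex.ofReal_zero, zero_mul, zero_add] at h5
      rw [Complex.real_smul, Complex.real_smul, add_comm]
      exact h5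
  rcases s with ⟨_ | _, A, w⟩
  · rw [edges_kite A w hη]
    rcases key with h | h
    · exact ⟨_, Or.inl rfl, h⟩
    · exact ⟨_, Or.inr (Or.inr (Or.inl rfl)), h⟩
  · rw [edges_dart A w hη]
    rcases key with h | h
    · exact ⟨_, Or.inl rfl, by rw [segment_symm]; exact h⟩
    · exact ⟨_, Or.inr (Or.inr (Or.inl rfl)), by rw [segment_symm]; exact h⟩

theorem edge_cases (s : Tile) {e : ℂ × ℂ} (he : e ∈ s.edges) :
    ∃ η, IsTurn η ∧ (segment ℝ e.1 e.2 = segment ℝ s.apex (s.side η) ∨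
      segment ℝ e.1 e.2 = segment ℝ s.tail (s.side η)) := by
  rcases s with ⟨_ | _, A, w⟩
  · rw [edges_kite A w isTurn_exp] at he
    rcases he with rfl | rfl | rfl | rfl
    · exact ⟨_, isTurn_exp, Or.inl rfl⟩
    · exact ⟨_, isTurn_exp.inv, Or.inl rfl⟩
    · exact ⟨_, isTurn_exp, Or.inr rfl⟩
    · exact ⟨_, isTurn_exp.inv, Or.inr rfl⟩
  · rw [edges_dart A w isTurn_exp] at he
    rcases he with rfl | rfl | rfl | rfl
    · exact ⟨_, isTurn_exp, Or.inl (segment_symm _ _ _)⟩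
    · exact ⟨_, isTurn_exp.inv, Or.inl (segment_symm _ _ _)⟩
    · exact ⟨_, isTurn_exp, Or.inr (segment_symm _ _ _)⟩
    · exact ⟨_, isTurn_exp.inv, Or.inr (segment_symm _ _ _)⟩

theorem mem_body_of_mem_edge (s : Tile) {e : ℂ × ℂ} (he : e ∈ s.edges) {z : ℂ}
    (hz : z ∈ segment ℝ e.1 e.2) :
    z ∈ s.body ∧ (s.longGap z = 0 ∨ s.shortGap z = 0) := by
  obtain ⟨η, hη, h⟩ := s.edge_cases he
  have ht := s.axisLen_pos
  rw [mem_body]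
  rcases h with h | h <;> rw [h] at hz <;> obtain ⟨a, b, ha, hb, hab, rfl⟩ := hz
  · obtain ⟨h1, h2, -⟩ := s.comb_gaps hη (a := a) (c := 0) hb (by linarith)
    simp only [Complex.ofReal_zero, zero_mul, add_zero, mul_zero] at h1 h2
    rw [Complex.real_smul, Complex.real_smul, h1, h2]
    exact ⟨⟨le_rfl, by positivity⟩, Or.inl rfl⟩
  · obtain ⟨h1, h2, -⟩ := s.comb_gaps hη (a := 0) (c := a) hb (by linarith)
    simp only [Complex.ofReal_zero, zero_mul, zero_add, mul_zero] at h1 h2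
    rw [Complex.real_smul, Complex.real_smul, add_comm, h1, h2]
    exact ⟨⟨by positivity, le_rfl⟩, Or.inr rfl⟩

theorem infinite_segment {x y : ℂ} (h : x ≠ y) : (segment ℝ x y).Infinite := by
  rw [segment_eq_image_lineMap]
  exact (Set.Icc_infinite one_pos).image (AffineMap.lineMap_injective ℝ h).injOn

theorem infinite_edge (s : Tile) {e : ℂ × ℂ} (he : e ∈ s.edges) :
    (segment ℝ e.1 e.2).Infinite := by
  obtain ⟨η, hη, h⟩ := s.edge_cases he
  have hσ := sin_pi_div_five_pos
  have him : (η : ℂ).im ≠ 0 := by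
    rcases hη.im with h | h <;> rw [h]
    · exact hσ.ne'
    · exact (neg_neg_of_pos hσ).ne
  have key : ∀ r : ℝ, s.apex + s.dir * r ≠ s.side η := by
    intro r hr
    have h1 : (s.dir : ℂ) * (r - φ * η) = 0 := by
      rw [side] at hr; linear_combination hr
    have h2 : (r - φ * η : ℂ) = 0 := (mul_eq_zero.1 h1).resolve_left s.dir.coe_ne_zero
    have h3 := congrArg Complex.im h2
    rw [Complex.sub_im, Complex.ofReal_im, Complex.im_ofReal_mul, zero_sub, Complex.zero_im,
      neg_eq_zero] at h3
    exact (mul_ne_zero Real.goldenRatio_pos.ne' him) h3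
  rcases h with h | h <;> rw [h] <;> apply infinite_segment
  · simpa using key 0
  · rw [tail_eq]; exact key _

/-- A ball of the same radius in every tile is what makes a tiling locally finite. -/
theorem mid_strict (s : Tile) {z : ℂ} (h : ‖z - s.mid‖ < 1 / 10) : s.Strict z := by
  obtain ⟨q, rfl⟩ := s.exists_local z
  have hσ := sin_pi_div_five_pos
  have hsq := sin_pi_div_five_sq
  have hφ := goldenRatio_bounds
  have h1 : ‖q - (1 / 2 : ℝ)‖ < 1 / 10 := by
    have : s.apex + s.dir * q - s.mid = s.dir * (q - (1 / 2 : ℝ)) := by rw [mid]; ring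
    rwa [this, norm_mul, Circle.norm_coe, one_mul] at h
  have h2 := (Complex.abs_re_le_norm _).trans_lt h1
  have h3 := (Complex.abs_im_le_norm _).trans_lt h1
  rw [Complex.sub_re, Complex.ofReal_re, abs_lt] at h2
  rw [Complex.sub_im, Complex.ofReal_im, sub_zero] at h3
  have hσ2 : 1 / 2 < Real.sin (π / 5) := by nlinarith
  have h4 : s.off (s.apex + s.dir * q) < 1 / 5 := by
    rw [off_local, div_lt_iff₀ hσ]; linarith
  have h5 := s.off_nonneg (s.apex + s.dir * q)
  have h6 := s.ax_local q
  generalize s.apex + s.dir * q = z at *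
  refine ⟨?_, ?_⟩
  · rw [longGap]; nlinarith
  · rcases s with ⟨_ | _, A, w⟩ <;> simp only [shortGap] <;> nlinarith

end Tile

namespace IsP2Tiling

variable {𝒯 : Set Tile} (h𝒯 : IsP2Tiling 𝒯)
include h𝒯

theorem eq_of_strict {s t : Tile} (hs : s ∈ 𝒯) (ht : t ∈ 𝒯) {z : ℂ} (h1 : s.Strict z)
    (h2 : t.Strict z) : s = t := by
  by_contra h
  exact Set.disjoint_left.1 (h𝒯.disjoint s hs t ht h) h1.mem_interior h2.mem_interior

theorem not_strict_of_mem {s t : Tile} (hs : s ∈ 𝒯) (ht : t ∈ 𝒯) (h : s ≠ t) {z : ℂ}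
    (h1 : z ∈ s.body) : ¬ t.Strict z := by
  intro h2
  obtain ⟨y, hy, hy'⟩ := s.exists_strict_mem h1 (isOpen_interior.mem_nhds h2.mem_interior)
  exact Set.disjoint_left.1 (h𝒯.disjoint s hs t ht h) hy'.mem_interior hy

end IsP2Tiling

/-! ### Exact coordinates -/

/-- Coefficients with respect to `1, η, η ^ 2, η ^ 3`; positions become integer data with decidable
equality. -/
structure V4 where
  a : Int
  b : Int
  c : Int
  d : Int
deriving DecidableEq

namespace V4
def zero : V4 := ⟨0, 0, 0, 0⟩
def add (x y : V4) : V4 := ⟨x.a + y.a, x.b + y.b, x.c + y.c, x.d + y.d⟩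
def rot (x : V4) : V4 := ⟨-x.d, x.a + x.d, x.b - x.d, x.c + x.d⟩
def pw : Nat → V4
  | 0 => ⟨1, 0, 0, 0⟩
  | k + 1 => rot (pw k)
def rotn (x : V4) : Nat → V4
  | 0 => x
  | k + 1 => rot (rotn x k)
-- This is `φ * η ^ k`, because `η + η⁻¹ = φ` and `η⁻¹ = η ^ 9`.
def ph (k : Nat) : V4 := add (pw (k + 1)) (pw (k + 9))
-- Displacements with entries in `[-8, 8)` become four digits to base 128 with offset 8. The zero
-- displacement is 16909320, the number subtracted in `shift`.
def enc (x : V4) : Nat :=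
  (x.a + 8).toNat + (x.b + 8).toNat * 128 + (x.c + 8).toNat * 16384 + (x.d + 8).toNat * 2097152
end V4
open V4

/-- kind 0 = kite, 1 = dart -/
structure RCode where
  kind : Nat
  pos : V4
  dir : Nat
deriving DecidableEq

def vertRel : Nat → List V4
  | 0 => [zero, ph 1, ph 0, ph 9]
  | _ => [zero, ph 1, pw 0, ph 9]

/-- Each pair is the direction of a wedge and a label. The ten wedges of the kite carry the labels 1
to 10, those of the dart 11 to 20, so the label found in a slot identifies the tile that occupies
the wedge. -/
def wedgeRel : Nat → List (List (Nat × Nat))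
  | 0 => [[(9, 1), (0, 2)], [(6, 3), (7, 4)], [(3, 5), (4, 6), (5, 7), (6, 8)], [(2, 9), (3, 10)]]
  | _ => [[(9, 11), (0, 12)], [(6, 13)], [(2, 14), (3, 15), (4, 16), (5, 17), (6, 18), (7, 19)],
      [(3, 20)]]

/-- The edges are ordered as in `edgeRel`. Four placed tiles have a given colored edge; those on the
near side overlap the given tile, and the kite and the dart on the far side remain. -/
def optRel : Nat → List (List RCode)
  | 0 => [[⟨0, zero, 2⟩, ⟨1, ph 1, 5⟩], [⟨0, add (ph 0) (ph 1), 6⟩, ⟨1, add (ph 1) (pw 1), 6⟩],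
      [⟨0, add (ph 0) (ph 9), 4⟩, ⟨1, add (ph 9) (pw 9), 4⟩], [⟨0, zero, 8⟩, ⟨1, ph 9, 5⟩]]
  | _ => [[⟨0, ph 1, 5⟩, ⟨1, zero, 2⟩], [⟨0, add (ph 1) (ph 9), 4⟩, ⟨1, add (pw 0) (pw 9), 4⟩],
      [⟨0, add (ph 9) (ph 1), 6⟩, ⟨1, add (pw 0) (pw 1), 6⟩], [⟨0, ph 9, 5⟩, ⟨1, zero, 8⟩]]

namespace V4

/-- The complex number with coordinates `x` in the basis `1, η, η ^ 2, η ^ 3`. -/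
noncomputable def val (η : Circle) (x : V4) : ℂ := x.a + x.b * η + x.c * η ^ 2 + x.d * η ^ 3

theorem val_zero (η : Circle) : val η zero = 0 := by simp [val, zero]

theorem val_add (η : Circle) (x y : V4) : val η (add x y) = val η x + val η y := by
  simp only [val, add]; push_cast; ring

theorem val_rot {η : Circle} (h : IsTurn η) (x : V4) : val η (rot x) = η * val η x := by
  simp only [val, rot]; push_cast; linear_combination (-x.d : ℂ) * h.pow_four

theorem val_rotn {η : Circle} (h : IsTurn η) (x : V4) (k : ℕ) :
    val η (rotn x k) = η ^ k * val η x := by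
  induction k with
  | zero => simp [rotn]
  | succ k ih => rw [rotn, val_rot h, ih]; ring

theorem val_pw {η : Circle} (h : IsTurn η) (k : ℕ) : val η (pw k) = η ^ k := by
  induction k with
  | zero => simp [pw, val]
  | succ k ih => rw [pw, val_rot h, ih]; ring

theorem val_ph {η : Circle} (h : IsTurn η) (k : ℕ) : val η (ph k) = φ * η ^ k := by
  rw [ph, val_add, val_pw h, val_pw h]
  linear_combination (η : ℂ) ^ k * ((η : ℂ) ^ 4 * h.pow_five - h.pow_four')

theorem re_val {η : Circle} (h : IsTurn η) (x : V4) :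
    2 * (val η x).re = 2 * x.a + x.b * φ + (x.c - x.d) * (φ - 1) := by
  have h1 : val η x = ((x.a - x.c : ℤ) - φ * x.d : ℝ) + ((x.b : ℝ) + φ * (x.c + x.d) : ℝ) * η := by
    rw [val, h.cube, h.sq]; push_cast; ring
  rw [h1, Complex.add_re, Complex.ofReal_re, Complex.re_ofReal_mul, h.re]
  have := Real.goldenRatio_sq
  generalize φ = p at *
  push_cast
  linear_combination (x.c + x.d : ℝ) * this

theorem im_val {η : Circle} (h : IsTurn η) (x : V4) :
    (val η x).im = ((x.b : ℝ) + φ * (x.c + x.d)) * (η : ℂ).im := by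
  have h1 : val η x = ((x.a - x.c : ℤ) - φ * x.d : ℝ) + ((x.b : ℝ) + φ * (x.c + x.d) : ℝ) * η := by
    rw [val, h.cube, h.sq]; push_cast; ring
  rw [h1, Complex.add_im, Complex.ofReal_im, Complex.im_ofReal_mul, zero_add]

theorem eq_zero_of_add_mul_goldenRatio {m n : ℤ} (h : (m : ℝ) + n * φ = 0) : m = 0 ∧ n = 0 := by
  by_cases hn : n = 0
  · subst hn; simp at h; exact ⟨h, rfl⟩
  · exfalso
    have h1 : φ = ((-m / n : ℚ) : ℝ) := by
      generalize φ = p at *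
      have : (n : ℝ) ≠ 0 := Int.cast_ne_zero.2 hn
      push_cast
      field_simp
      linarith
    exact Real.goldenRatio_irrational ⟨_, h1.symm⟩

theorem im_ne_zero {η : Circle} (h : IsTurn η) : (η : ℂ).im ≠ 0 := by
  have := sin_pi_div_five_pos
  rcases h.im with h | h <;> rw [h]
  · exact this.ne'
  · exact (neg_neg_of_pos this).ne

/-- Twice the real part, and the imaginary part divided by that of `η`, have the form `m + n φ` with
integers. Irrationality of `φ` turns equality into four integer equations. -/
theorem val_injective {η : Circle} (h : IsTurn η) {x y : V4} (hxy : val η x = val η y) : x = y := by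
  have h1 := re_val h x
  have h2 := re_val h y
  have h3 := im_val h x
  have h4 := im_val h y
  rw [hxy] at h1 h3
  have h5 := mul_right_cancel₀ (im_ne_zero h) (h3.symm.trans h4)
  have h6 := h1.symm.trans h2
  have h7 := eq_zero_of_add_mul_goldenRatio (m := x.b - y.b) (n := x.c + x.d - y.c - y.d)
    (by generalize φ = p at *; push_cast; linear_combination h5)
  have h8 := eq_zero_of_add_mul_goldenRatio
    (m := 2 * x.a - 2 * y.a - (x.c - x.d) + (y.c - y.d)) (n := x.b - y.b + (x.c - x.d) - (y.c - y.d))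
    (by generalize φ = p at *; push_cast; linear_combination h6)
  rcases x with ⟨a, b, c, d⟩
  rcases y with ⟨a', b', c', d'⟩
  simp only [mk.injEq] at *
  omega

end V4

/-! ### Frames, placed tiles and the overlap test -/

/-- A coordinate system of the plane, left or right handed. -/
structure Frame where
  o : ℂ
  u : Circle
  η : Circle
  turn : IsTurn η

def kindOf : ℕ → Kind
  | 0 => .kite
  | _ => .dart

/-- The black and the white ends of the edges. -/
def edgeRel : ℕ → List (V4 × V4)
  | 0 => [(zero, ph 1), (ph 0, ph 1), (ph 0, ph 9), (zero, ph 9)]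
  | _ => [(ph 1, zero), (ph 1, pw 0), (ph 9, pw 0), (ph 9, zero)]

/-- The vertices and the indices of the wedges of angle `π / 5` that form the tile there. -/
def wedgeList (k : ℕ) : List (V4 × ℕ) :=
  ((vertRel k).zip (wedgeRel k)).flatMap fun x => x.2.map fun w => (x.1, w.1)

namespace Frame

variable (F : Frame)

noncomputable def pt (x : V4) : ℂ := F.o + F.u * val F.η x

noncomputable def tile (c : RCode) : Tile := ⟨kindOf c.kind, F.pt c.pos, F.u * F.η ^ c.dir⟩

noncomputable def sub (c : RCode) : Frame := ⟨F.pt c.pos, F.u * F.η ^ c.dir, F.η, F.turn⟩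

/-- A point on the bisector of the wedge at `x` between the directions `k` and `k + 1`, so near to
`x` that it is interior to every tile that has this wedge. -/
noncomputable def testPt (x : V4) (k : ℕ) : ℂ :=
  F.pt x + F.u * F.η ^ k * ((1 / 10 : ℝ) * (1 + F.η))

theorem dir_mod (k : ℕ) : F.η ^ (k % 10) = F.η ^ k := by
  conv_rhs => rw [← Nat.mod_add_div k 10, pow_add, pow_mul, F.turn.pow_ten, one_pow, mul_one]

theorem sub_pt (c : RCode) (x : V4) : (F.sub c).pt x = F.pt (add c.pos (rotn x c.dir)) := by
  simp only [pt, sub, val_add, val_rotn F.turn]; push_cast; ring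

theorem sub_tile (c r : RCode) :
    (F.sub c).tile r = F.tile ⟨r.kind, add c.pos (rotn r.pos c.dir), (r.dir + c.dir) % 10⟩ := by
  simp only [tile, sub_pt, dir_mod]
  simp only [sub, pow_add]
  congr 1
  rw [mul_assoc, mul_comm (F.η ^ c.dir)]

theorem sub_testPt (c : RCode) (x : V4) (k : ℕ) :
    (F.sub c).testPt x k = F.testPt (add c.pos (rotn x c.dir)) ((k + c.dir) % 10) := by
  simp only [testPt, sub_pt, ← Circle.coe_pow, dir_mod]
  simp only [sub, pow_add]
  push_cast
  ring

theorem tile_mod (c : RCode) : F.tile ⟨c.kind, c.pos, c.dir % 10⟩ = F.tile c := by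
  simp only [tile, dir_mod]

theorem pt_injective {x y : V4} (h : F.pt x = F.pt y) : x = y :=
  val_injective F.turn (mul_left_cancel₀ F.u.coe_ne_zero (add_left_cancel h))

theorem sub_self_tile (c : RCode) : (F.sub c).tile ⟨c.kind, zero, 0⟩ = F.tile c := by
  simp [tile, sub, pt, val_zero]

theorem edges_tile {k : ℕ} (hk : k < 2) (e : ℂ × ℂ) :
    e ∈ (F.tile ⟨k, zero, 0⟩).edges ↔ ∃ p ∈ edgeRel k, e = (F.pt p.1, F.pt p.2) := by
  obtain ⟨o, u, η, h⟩ := F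
  have h9 : (η : ℂ) ^ 9 = φ - η := by
    linear_combination (η : ℂ) ^ 4 * h.pow_five - h.pow_four'
  interval_cases k
  · simp only [tile, kindOf, Tile.edges_kite _ _ h, edgeRel, List.mem_cons, List.not_mem_nil, or_false,
      exists_eq_or_imp, exists_eq_left, Set.mem_insert_iff, Set.mem_singleton_iff, pt, val_zero,
      val_ph h, h.coe_inv, pow_zero, mul_one, mul_zero, add_zero, pow_one, h9]
    simp only [mul_left_comm (u : ℂ) (φ : ℂ), mul_assoc, mul_comm (u : ℂ) (φ : ℂ)]
    tauto
  · simp only [tile, kindOf, Tile.edges_dart _ _ h, edgeRel, List.mem_cons, List.not_mem_nil, or_false,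
      exists_eq_or_imp, exists_eq_left, Set.mem_insert_iff, Set.mem_singleton_iff, pt, val_zero,
      val_ph h, val_pw h, h.coe_inv, pow_zero, mul_one, mul_zero, add_zero,
      pow_one, h9]
    simp only [mul_left_comm (u : ℂ) (φ : ℂ), mul_assoc]
    tauto

end Frame

/-- A sufficient test for the positivity of `m + n φ`. -/
def posTest (m n : ℤ) : Bool := 0 < 10000 * m + 16180 * n && 0 < 10000 * m + 16181 * n

theorem posTest_sound {m n : ℤ} (h : posTest m n = true) : 0 < (m : ℝ) + n * φ := by
  rw [posTest, Bool.and_eq_true, decide_eq_true_iff, decide_eq_true_iff] at h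
  have hφ := goldenRatio_bounds
  have h1 : (0 : ℝ) < 10000 * m + 16180 * n := by exact_mod_cast h.1
  have h2 : (0 : ℝ) < 10000 * m + 16181 * n := by exact_mod_cast h.2
  rcases le_total (0 : ℝ) n with hn | hn <;> nlinarith

/-- A sufficient test for `x / 10` to lie in the interior of a tile in standard position. -/
def strictTest (k : ℕ) (x : V4) : Bool :=
  let X := (2 * x.a - x.c + x.d, x.b + x.c - x.d)
  let m := x.b
  let n := x.c + x.d
  posTest (X.1 - n) (X.2 - m - n) && posTest (X.1 + n) (X.2 + m + n) &&
  match k with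
  -- The distance from the axis enters with a negative sign for the kite, so both signs of it must
  -- pass; for the dart the sign is positive and one suffices.
  | 0 => posTest (-X.1 - 2 * m + n) (20 - X.2 - n + m) && posTest (-X.1 + 2 * m - n) (20 - X.2 + n - m)
  | _ => posTest (20 - X.1 - 2 * m + n) (-X.2 - n + m) || posTest (20 - X.1 + 2 * m - n) (-X.2 + n - m)

theorem strictTest_sound (F : Frame) {k : ℕ} (x : V4) (h : strictTest k x = true) :
    (F.tile ⟨k, zero, 0⟩).Strict (F.o + F.u * ((1 / 10 : ℝ) * val F.η x)) := by
  obtain ⟨o, u, η, hη⟩ := F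
  have e : (⟨o, u, η, hη⟩ : Frame).tile ⟨k, zero, 0⟩ = ⟨kindOf k, o, u⟩ := by
    simp [Frame.tile, Frame.pt, val_zero]
  rw [e]
  have h1 := Tile.ax_local ⟨kindOf k, o, u⟩ ((1 / 10 : ℝ) * val η x)
  have h2 := Tile.off_local ⟨kindOf k, o, u⟩ ((1 / 10 : ℝ) * val η x)
  rw [Complex.re_ofReal_mul] at h1
  rw [Complex.im_ofReal_mul, im_val hη] at h2
  have h3 := re_val hη x
  have h4 : |1 / 10 * (((x.b : ℝ) + φ * (x.c + x.d)) * (η : ℂ).im)| / Real.sin (π / 5) =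
      |(x.b : ℝ) + φ * (x.c + x.d)| / 10 := by
    have h5 : |(η : ℂ).im| = Real.sin (π / 5) := by
      have := sin_pi_div_five_pos
      rcases hη.im with h | h <;> rw [h]
      · exact abs_of_pos this
      · rw [abs_neg, abs_of_pos this]
    rw [abs_mul, abs_mul, h5, abs_of_pos (by norm_num : (0 : ℝ) < 1 / 10)]
    have := sin_pi_div_five_pos.ne'
    field_simp
  rw [h4] at h2
  simp only at h1 h2
  rw [Tile.Strict, Tile.longGap]
  simp only [Tile.shortGap]
  rw [h1, h2]
  have hφ := goldenRatio_bounds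
  have hsq := Real.goldenRatio_sq
  have pos : ∀ {m n : ℤ}, posTest m n = true → 0 < (m : ℝ) + n * φ := posTest_sound
  generalize (val η x).re = r at *
  generalize φ = p at *
  simp only [strictTest, Bool.and_eq_true] at h
  obtain ⟨⟨t1, t2⟩, t3⟩ := h
  generalize hy : (x.b : ℝ) + p * (x.c + x.d) = y at *
  have e1 : p * y = (x.c + x.d) + (x.b + x.c + x.d) * p := by
    rw [← hy]; linear_combination (x.c + x.d : ℝ) * hsq
  refine ⟨?_, ?_⟩
  · replace t1 := pos t1
    replace t2 := pos t2
    push_cast at t1 t2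
    rcases abs_cases y with ⟨hy, -⟩ | ⟨hy, -⟩ <;> rw [hy] <;> linarith
  · rcases k with _ | k <;> simp only [kindOf, Bool.and_eq_true, Bool.or_eq_true] at t3 ⊢
    · obtain ⟨t4, t5⟩ := t3
      replace t4 := pos t4
      replace t5 := pos t5
      push_cast at t4 t5
      rcases abs_cases y with ⟨hy, -⟩ | ⟨hy, -⟩ <;> rw [hy] <;> linarith
    · have h5 := le_abs_self y
      have h6 := neg_le_abs y
      rcases t3 with t4 | t4 <;> replace t4 := pos t4 <;> push_cast at t4 <;> nlinarith

/-- The tested vector is ten times the test point, which has integer coordinates; the repeated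
additions form `10 * w.1`. -/
theorem wedgeList_test : ∀ k < 2, ∀ w ∈ wedgeList k,
    strictTest k (add (add (pw w.2) (pw (w.2 + 1))) (add (add w.1 (add w.1 (add w.1 (add w.1 w.1))))
      (add w.1 (add w.1 (add w.1 (add w.1 w.1)))))) = true := by decide +kernel

namespace Frame

variable (F : Frame)

theorem strict_testPt {k : ℕ} (hk : k < 2) {w : V4 × ℕ} (hw : w ∈ wedgeList k) :
    (F.tile ⟨k, zero, 0⟩).Strict (F.testPt w.1 w.2) := by
  convert strictTest_sound F _ (wedgeList_test k hk w hw) using 1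
  simp only [testPt, pt, val_add, val_pw F.turn]
  push_cast
  ring

/-- The wedges of a tile in the coordinates of the frame. -/
def _root_.PenroseP2.RCode.wedges (c : RCode) : List (V4 × ℕ) :=
  (wedgeList c.kind).map fun w => (add c.pos (rotn w.1 c.dir), (w.2 + c.dir) % 10)

theorem strict_of_mem_wedges {c : RCode} (hc : c.kind < 2) {w : V4 × ℕ} (hw : w ∈ c.wedges) :
    (F.tile c).Strict (F.testPt w.1 w.2) := by
  obtain ⟨x, hx, rfl⟩ := List.mem_map.1 hw
  have := (F.sub c).strict_testPt hc hx
  rwa [sub_self_tile, sub_testPt] at this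

/-- The test point of the common wedge is interior to both tiles, and different tiles have disjoint
interiors. -/
theorem eq_of_mem_wedges {𝒯 : Set Tile} (h𝒯 : IsP2Tiling 𝒯) {c c' : RCode} (hc : c.kind < 2)
    (hc' : c'.kind < 2) (h : F.tile c ∈ 𝒯) (h' : F.tile c' ∈ 𝒯) {w : V4 × ℕ} (hw : w ∈ c.wedges)
    (hw' : w ∈ c'.wedges) : F.tile c = F.tile c' :=
  h𝒯.eq_of_strict h h' (F.strict_of_mem_wedges hc hw) (F.strict_of_mem_wedges hc' hw')

theorem pow_injective {i j : ℕ} (hi : i < 10) (hj : j < 10) (h : F.η ^ i = F.η ^ j) : i = j := by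
  have h1 : val F.η (pw i) = val F.η (pw j) := by
    rw [val_pw F.turn, val_pw F.turn, ← Circle.coe_pow, ← Circle.coe_pow, h]
  have h2 := val_injective F.turn h1
  have h3 : ∀ i < 10, ∀ j < 10, pw i = pw j → i = j := by decide +kernel
  exact h3 i hi j hj h2

theorem tile_injective {c c' : RCode} (hc : c.kind < 2) (hc' : c'.kind < 2) (hd : c.dir < 10)
    (hd' : c'.dir < 10) (h : F.tile c = F.tile c') : c = c' := by
  rcases c with ⟨k, p, d⟩
  rcases c' with ⟨k', p', d'⟩
  simp only [tile, Tile.mk.injEq] at h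
  obtain ⟨h1, h2, h3⟩ := h
  simp only at hc hc' hd hd'
  have h4 := F.pt_injective h2
  have h5 := F.pow_injective hd hd' (mul_left_cancel h3)
  subst h4 h5
  have : k = k' := by interval_cases k <;> interval_cases k' <;> simp_all [kindOf]
  rw [this]

/-- The four placed tiles with a given edge in standard position. -/
def _root_.PenroseP2.edgeTiles : Bool → List RCode
  | true => [⟨0, zero, 1⟩, ⟨0, zero, 9⟩, ⟨1, ph 0, 4⟩, ⟨1, ph 0, 6⟩]
  | false => [⟨0, ph 8, 3⟩, ⟨0, ph 2, 7⟩, ⟨1, add (pw 0) (pw 8), 3⟩, ⟨1, add (pw 0) (pw 2), 7⟩]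

/-- The value `true` stands for a long edge and `false` for a short one; the black end is at the
origin. -/
def _root_.PenroseP2.edgeEnd : Bool → V4
  | true => ph 0
  | false => pw 0

/-- The colors fix the order of the ends, so only the kind of the tile and the side of the edge on
which it lies remain free. -/
theorem mem_edgeTiles {t : Tile} {b : Bool} (h : (F.pt zero, F.pt (edgeEnd b)) ∈ t.edges) :
    ∃ c ∈ edgeTiles b, t = F.tile c := by
  obtain ⟨o, u, η, hη⟩ := F
  have h10 : (η : ℂ) ^ 10 = 1 := by rw [← Circle.coe_pow, hη.pow_ten, Circle.coe_one]
  have hφ : (φ : ℂ) ≠ 0 := Complex.ofReal_ne_zero.2 Real.goldenRatio_ne_zero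
  have hsq := coe_goldenRatio_sq
  -- A long edge never equals a short one; this eliminates half of the cases below.
  have contra : ∀ v w : Circle, (φ : ℂ) * v ≠ w := by
    intro v w h
    have := congrArg norm h
    rw [norm_mul, Circle.norm_coe, Circle.norm_coe, mul_one, Complex.norm_real,
      Real.norm_of_nonneg Real.goldenRatio_pos.le] at this
    exact Real.one_lt_goldenRatio.ne' this
  have fin : ∀ {k : Kind} {A : ℂ} {w : Circle} {c : RCode} {l : List RCode} (i j : ℕ),
      i + j = 10 → (u : ℂ) = w * η ^ i → c ∈ l → k = kindOf c.kind → c.dir = j →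
      ((w : ℂ) = u * η ^ j → A = o + u * val η c.pos) →
      ∃ c ∈ l, (⟨k, A, w⟩ : Tile) = Frame.tile ⟨o, u, η, hη⟩ c := by
    intro k A w c l i j hij h0 hc h1 h2 h3
    have h4 : (w : ℂ) = u * η ^ j := by rw [h0, mul_assoc, ← pow_add, hij, h10, mul_one]
    refine ⟨c, hc, ?_⟩
    rw [tile, pt, Tile.mk.injEq]
    refine ⟨h1, h3 h4, Circle.coe_injective ?_⟩
    rw [Circle.coe_mul, Circle.coe_pow, h2]
    exact h4
  have h2 := hη.sq
  have h3 := hη.cube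
  have h4 := hη.pow_four'
  have h5 := hη.pow_five
  have hinv := hη.coe_inv
  have hph := val_ph hη
  obtain ⟨p, hp⟩ : ∃ p : ℂ, (φ : ℂ) = p := ⟨_, rfl⟩
  simp only [hp] at hφ hsq contra h2 h3 h4 hinv hph
  have k1 : p * (p - η) - p = η ^ 7 := by linear_combination hsq + h2 - η ^ 2 * h5
  have k4 : p - η = η ^ 9 := by linear_combination h4 - η ^ 4 * h5
  rcases t with ⟨_ | _, A, w⟩
  · rw [Tile.edges_kite A w hη] at h
    simp only [Set.mem_insert_iff, Set.mem_singleton_iff, Prod.mk.injEq, pt, val_zero, 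
      hinv, hp] at h
    cases b <;> simp only [edgeEnd, hph, val_pw hη, pow_zero, mul_zero, add_zero, mul_one] at h
    · rcases h with ⟨e1, e2⟩ | ⟨e1, e2⟩ | ⟨e1, e2⟩ | ⟨e1, e2⟩
      · exact (contra (w * η) u (by simp only [Circle.coe_mul]; linear_combination e1 - e2)).elim
      · exact (contra (w * η ^ 9) u (by simp only [Circle.coe_mul, Circle.coe_pow]; linear_combination e1 - e2 - p * w * k4)).elim
      · exact fin 3 7 rfl (by linear_combination e2 - e1 - w * h3) (List.mem_cons_of_mem _ List.mem_cons_self) rfl rfl fun h6 => by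
          simp only [hph]; linear_combination -e1 - p * h6 - p * u * η ^ 2 * h5
      · exact fin 7 3 rfl (by linear_combination e2 - e1 + w * k1) (List.mem_cons_self) rfl rfl fun h6 => by
          simp only [hph]; linear_combination -e1 - p * h6 - p * u * η ^ 3 * h5
    · rcases h with ⟨e1, e2⟩ | ⟨e1, e2⟩ | ⟨e1, e2⟩ | ⟨e1, e2⟩
      · exact fin 1 9 rfl (mul_left_cancel₀ hφ (by linear_combination e2 - e1)) (List.mem_cons_of_mem _ List.mem_cons_self) rfl rfl fun h6 => by
          simp only [val_zero]; linear_combination -e1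
      · exact fin 9 1 rfl (mul_left_cancel₀ hφ (by linear_combination e2 - e1 + p * w * k4)) (List.mem_cons_self) rfl rfl fun h6 => by
          simp only [val_zero]; linear_combination -e1
      · exact (contra u (w * η ^ 3) (by simp only [Circle.coe_mul, Circle.coe_pow]; linear_combination e2 - e1 - w * h3)).elim
      · exact (contra u (w * η ^ 7) (by simp only [Circle.coe_mul, Circle.coe_pow]; linear_combination e2 - e1 + w * k1)).elim
  · rw [Tile.edges_dart A w hη] at h
    simp only [Set.mem_insert_iff, Set.mem_singleton_iff, Prod.mk.injEq, pt, val_zero, 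
      hinv, hp] at h
    cases b <;> simp only [edgeEnd, hph, val_pw hη, pow_zero, mul_zero, add_zero, mul_one] at h
    · rcases h with ⟨e1, e2⟩ | ⟨e1, e2⟩ | ⟨e1, e2⟩ | ⟨e1, e2⟩
      · exact (contra (w * η ^ 6) u (by simp only [Circle.coe_mul, Circle.coe_pow]; linear_combination e1 - e2 + p * w * η * h5)).elim
      · exact (contra (w * η ^ 4) u (by simp only [Circle.coe_mul, Circle.coe_pow]; linear_combination e1 - e2 + p * w * k4 + p * w * η ^ 4 * h5)).elim
      · exact fin 7 3 rfl (by linear_combination e2 - e1 + w * h2 - w * η ^ 2 * h5) (List.mem_cons_of_mem _ (List.mem_cons_of_mem _ List.mem_cons_self)) rfl rfl fun h6 => by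
          simp only [val_add, val_pw hη]; linear_combination -e2 - h6 - u * η ^ 3 * h5
      · exact fin 3 7 rfl (by linear_combination e2 - e1 - w * h3 - w * hsq) (List.mem_cons_of_mem _ (List.mem_cons_of_mem _ (List.mem_cons_of_mem _ List.mem_cons_self))) rfl rfl fun h6 => by
          simp only [val_add, val_pw hη]; linear_combination -e2 - h6 - u * η ^ 2 * h5
    · rcases h with ⟨e1, e2⟩ | ⟨e1, e2⟩ | ⟨e1, e2⟩ | ⟨e1, e2⟩
      · exact fin 6 4 rfl (mul_left_cancel₀ hφ (by linear_combination e2 - e1 - p * w * η * h5)) (List.mem_cons_of_mem _ (List.mem_cons_of_mem _ List.mem_cons_self)) rfl rfl fun h6 => by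
          simp only [hph]; linear_combination -e2
      · exact fin 4 6 rfl (mul_left_cancel₀ hφ (by linear_combination e2 - e1 - p * w * k4 - p * w * η ^ 4 * h5)) (List.mem_cons_of_mem _ (List.mem_cons_of_mem _ (List.mem_cons_of_mem _ List.mem_cons_self))) rfl rfl fun h6 => by
          simp only [hph]; linear_combination -e2
      · exact (contra u (w * η ^ 7) (by simp only [Circle.coe_mul, Circle.coe_pow]; linear_combination e2 - e1 + w * h2 - w * η ^ 2 * h5)).elim
      · exact (contra u (w * η ^ 3) (by simp only [Circle.coe_mul, Circle.coe_pow]; linear_combination e2 - e1 - w * h3 - w * hsq)).elim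

/-- The frames in which the edges of a tile are in standard position. -/
def _root_.PenroseP2.edgeBase : ℕ → List (Bool × RCode)
  | 0 => [(true, ⟨0, zero, 1⟩), (false, ⟨0, ph 0, 3⟩), (false, ⟨0, ph 0, 7⟩), (true, ⟨0, zero, 9⟩)]
  | _ => [(true, ⟨0, ph 1, 6⟩), (false, ⟨0, ph 1, 7⟩), (false, ⟨0, ph 9, 3⟩), (true, ⟨0, ph 9, 4⟩)]

/-- Of the four tiles with a given edge, those that are not options share a wedge with the tile in
standard position, so in a tiling they could only be that tile itself. -/
theorem _root_.PenroseP2.edgeBase_spec : ∀ k < 2, ∀ x ∈ ((edgeRel k).zip (optRel k)).zip (edgeBase k),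
    add x.2.2.pos (rotn zero x.2.2.dir) = x.1.1.1 ∧
    add x.2.2.pos (rotn (edgeEnd x.2.1) x.2.2.dir) = x.1.1.2 ∧
    ∀ c ∈ edgeTiles x.2.1, (⟨c.kind, add x.2.2.pos (rotn c.pos x.2.2.dir),
      (c.dir + x.2.2.dir) % 10⟩ : RCode) ∈ x.1.2 ∨
      c.kind < 2 ∧
      ∃ w ∈ RCode.wedges ⟨c.kind, add x.2.2.pos (rotn c.pos x.2.2.dir), (c.dir + x.2.2.dir) % 10⟩,
        w ∈ RCode.wedges ⟨k, zero, 0⟩ := by decide +kernel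

theorem _root_.PenroseP2.exists_edgeBase : ∀ k < 2, ∀ x ∈ (edgeRel k).zip (optRel k),
    ∃ y ∈ edgeBase k, (x, y) ∈ ((edgeRel k).zip (optRel k)).zip (edgeBase k) := by decide +kernel

theorem mem_optRel {𝒯 : Set Tile} (h𝒯 : IsP2Tiling 𝒯) {k : ℕ} (hk : k < 2)
    (hs : F.tile ⟨k, zero, 0⟩ ∈ 𝒯) {t : Tile} (ht : t ∈ 𝒯) (hne : t ≠ F.tile ⟨k, zero, 0⟩)
    {x : (V4 × V4) × List RCode} (hx : x ∈ (edgeRel k).zip (optRel k))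
    (he : (F.pt x.1.1, F.pt x.1.2) ∈ t.edges) : ∃ c ∈ x.2, t = F.tile c := by
  obtain ⟨y, -, hy⟩ := exists_edgeBase k hk x hx
  obtain ⟨h1, h2, h3⟩ := edgeBase_spec k hk _ hy
  simp only at h1 h2 h3
  rw [← h1, ← h2, ← sub_pt, ← sub_pt] at he
  obtain ⟨c, hc, rfl⟩ := mem_edgeTiles _ he
  rw [sub_tile] at ht hne ⊢
  rcases h3 c hc with h | ⟨h, w, hw, hw'⟩
  · exact ⟨_, h, rfl⟩
  · exact (hne (F.eq_of_mem_wedges h𝒯 h hk ht hs hw hw')).elim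

end Frame

/-! ### Local finiteness and the tile across an edge -/

namespace Tile

theorem norm_sub_mid_le (s : Tile) {z : ℂ} (hz : z ∈ s.body) : ‖z - s.mid‖ ≤ 5 := by
  obtain ⟨h1, h2⟩ := (s.mem_body z).1 hz
  have h0 := s.off_nonneg z
  have hφ := goldenRatio_bounds
  have hax : s.ax z ≤ 4 := by
    rw [longGap] at h1
    rcases s with ⟨_ | _, A, w⟩ <;> simp only [shortGap] at h2 <;> nlinarith
  rw [longGap] at h1
  have hoff : s.off z ≤ 3 := by nlinarith
  have hax0 : 0 ≤ s.ax z := by nlinarith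
  obtain ⟨q, rfl⟩ := s.exists_local z
  have hσ := sin_pi_div_five_pos
  rw [ax_local] at hax hax0
  rw [off_local, div_le_iff₀ hσ] at hoff
  have h3 : s.apex + s.dir * q - s.mid = s.dir * (q - (1 / 2 : ℝ)) := by rw [mid]; ring
  rw [h3, norm_mul, Circle.norm_coe, one_mul]
  have h4 := Complex.norm_le_abs_re_add_abs_im (q - (1 / 2 : ℝ))
  rw [Complex.sub_re, Complex.sub_im, Complex.ofReal_re, Complex.ofReal_im, sub_zero] at h4
  have h5 : |q.re - 1 / 2| ≤ 2 := abs_le.2 ⟨by linarith, by linarith⟩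
  have h6 := Real.sin_le_one (π / 5)
  linarith

theorem finite_edges (s : Tile) : s.edges.Finite := by
  rcases s with ⟨_ | _, A, w⟩ <;> simp [edges]

/-- Two darts with a common apex whose axes form an angle less than `2 π / 5` overlap. -/
theorem strict_dart (v : ℂ) (d r : Circle) (h : (φ - 1) / 2 < (r : ℂ).re) :
    (⟨.dart, v, d⟩ : Tile).Strict (v + d * ((1 / 10 : ℝ) * (1 + r))) := by
  have h1 := ax_local ⟨.dart, v, d⟩ ((1 / 10 : ℝ) * (1 + r))
  have h2 := off_local ⟨.dart, v, d⟩ ((1 / 10 : ℝ) * (1 + r))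
  rw [Complex.re_ofReal_mul, Complex.add_re, Complex.one_re] at h1
  rw [Complex.im_ofReal_mul, Complex.add_im, Complex.one_im, zero_add] at h2
  simp only at h1 h2
  rw [Strict, longGap]
  simp only [shortGap]
  rw [h1, h2]
  have hr : (r : ℂ).re ^ 2 + (r : ℂ).im ^ 2 = 1 := by
    have := Complex.normSq_apply (r : ℂ)
    rw [Circle.normSq_coe] at this
    rw [this]; ring
  have hφ := goldenRatio_bounds
  have hsq := Real.goldenRatio_sq
  have hσ := sin_pi_div_five_pos
  have hσ2 := sin_pi_div_five_sq
  generalize (r : ℂ).re = c at *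
  generalize (r : ℂ).im = y at *
  generalize Real.sin (π / 5) = σ at *
  generalize φ = p at *
  have h3 : 0 ≤ |1 / 10 * y| / σ := by positivity
  have h4 : c ≤ 1 := by nlinarith
  refine ⟨?_, by nlinarith⟩
  have h5 : p * |y| < 2 * (1 + c) * σ := by
    apply lt_of_pow_lt_pow_left₀ 2 (mul_nonneg (by linarith) hσ.le)
    rw [mul_pow, mul_pow, sq_abs, hσ2, hsq]
    have h6 : y ^ 2 = (1 - c) * (1 + c) := by linarith
    rw [h6]
    have : 0 < (1 + c) * (4 * c - 2 * (p - 1)) := mul_pos (by linarith) (by linarith)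
    linarith
  rw [abs_mul, abs_of_pos (by norm_num : (0 : ℝ) < 1 / 10)]
  have h7 : p * (1 / 10 * |y| / σ) = p * |y| / σ / 10 := by ring
  have h8 : p * |y| / σ < 2 * (1 + c) := by rwa [div_lt_iff₀ hσ]
  rw [h7]
  linarith

end Tile

namespace IsP2Tiling

variable {𝒯 : Set Tile}

/-- Each tile contains the ball of radius `1 / 10` about its `mid`, so two of these points are never
within `1 / 20` of the same member of a finite net. -/
theorem finite_near (h𝒯 : IsP2Tiling 𝒯) (p : ℂ) (R : ℝ) : {t ∈ 𝒯 | ‖t.mid - p‖ ≤ R}.Finite := by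
  obtain ⟨N, hN, hc⟩ := Metric.totallyBounded_iff.1 (isCompact_closedBall p R).totallyBounded
    (1 / 20) (by norm_num)
  have h1 : ∀ t : Tile, ∃ y, t ∈ 𝒯 ∧ ‖t.mid - p‖ ≤ R → y ∈ N ∧ ‖t.mid - y‖ < 1 / 20 := by
    intro t
    by_cases h : t ∈ 𝒯 ∧ ‖t.mid - p‖ ≤ R
    · have := hc (mem_closedBall_iff_norm.2 h.2)
      simp only [Set.mem_iUnion, mem_ball_iff_norm] at this
      obtain ⟨y, hy, hy'⟩ := this
      exact ⟨y, fun _ => ⟨hy, hy'⟩⟩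
    · exact ⟨0, fun h' => (h h').elim⟩
  choose f hf using h1
  refine Set.Finite.of_injOn (f := f) (fun t ht => (hf t ht).1) ?_ hN
  intro s hs t ht hst
  have h2 := (hf s hs).2
  have h3 := (hf t ht).2
  rw [← hst] at h3
  have h4 : ‖t.mid - s.mid‖ < 1 / 10 := by
    have := norm_sub_le (t.mid - f s) (s.mid - f s)
    rw [sub_sub_sub_cancel_right] at this
    linarith
  exact h𝒯.eq_of_strict hs.1 ht.1 (s.mid_strict h4) (t.mid_strict (by simp))

theorem exists_other_of_mem_edge (h𝒯 : IsP2Tiling 𝒯) {s : Tile} {e : ℂ × ℂ}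
    (he : e ∈ s.edges) {p : ℂ} (hp : p ∈ segment ℝ e.1 e.2) :
    ∃ t ∈ 𝒯, t ≠ s ∧ p ∈ t.body := by
  by_contra! hcon
  -- Radius 6 is the bound 5 for the distance of a point of a tile from its `mid`, plus 1 for the
  -- distance of the displaced point from `p`.
  have hfin := (h𝒯.finite_near p 6).subset
    (fun t ht => ht.1 : {t | (t ∈ 𝒯 ∧ ‖t.mid - p‖ ≤ 6) ∧ t ≠ s} ⊆ _)
  have hcl : IsClosed (⋃ t ∈ {t | (t ∈ 𝒯 ∧ ‖t.mid - p‖ ≤ 6) ∧ t ≠ s}, t.body) :=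
    hfin.isClosed_biUnion fun t _ => t.isClosed_body
  have hp' : p ∈ (⋃ t ∈ {t | (t ∈ 𝒯 ∧ ‖t.mid - p‖ ≤ 6) ∧ t ≠ s}, t.body)ᶜ := by
    simp only [Set.mem_compl_iff, Set.mem_iUnion, not_exists]
    exact fun t ht h => hcon t ht.1.1 ht.2 h
  -- Moving toward the reflection of `s.mid` in `p` leaves `s`. Near `p` the moved point also avoids
  -- the closed union of the other tiles nearby, so it would not be covered.
  have h1 := (Tile.tendsto_toward p (2 * p - s.mid)).eventually (hcl.isOpen_compl.mem_nhds hp')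
  have h2 := (Tile.tendsto_toward p (2 * p - s.mid)).eventually (Metric.ball_mem_nhds p one_pos)
  obtain ⟨r, ⟨h3, h4⟩, h5⟩ := ((h1.and h2).and self_mem_nhdsWithin).exists
  have h6 := s.not_mem_away (s.mem_body_of_mem_edge he hp).2 h5
  have e1 : p + r * (2 * p - s.mid - p) = p - r * (s.mid - p) := by ring
  rw [e1] at h3 h4
  have h7 : p - r * (s.mid - p) ∈ ⋃ t ∈ 𝒯, t.body := h𝒯.cover ▸ Set.mem_univ _
  simp only [Set.mem_iUnion] at h7
  obtain ⟨t, ht, hz⟩ := h7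
  refine h3 (Set.mem_biUnion ⟨⟨ht, ?_⟩, fun h => h6 (h ▸ hz)⟩ hz)
  have h8 := t.norm_sub_mid_le hz
  rw [dist_eq_norm] at h4
  generalize p - r * (s.mid - p) = z at *
  have := norm_sub_le (z - p) (z - t.mid)
  rw [sub_sub_sub_cancel_left] at this
  linarith

/-- Otherwise each edge of another tile meets the edge in at most one point. The finitely many tiles
nearby would then account for only finitely many points of the segment, although each of its points
lies in another tile. -/
theorem exists_neighbor (h𝒯 : IsP2Tiling 𝒯) {s : Tile} (hs : s ∈ 𝒯) {e : ℂ × ℂ}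
    (he : e ∈ s.edges) : ∃ t ∈ 𝒯, t ≠ s ∧ e ∈ t.edges := by
  by_contra! hcon
  refine s.infinite_edge he (Set.Finite.subset (((h𝒯.finite_near e.1 (5 + ‖e.1 - e.2‖)).subset
    (fun t ht => ht.1 : {t | (t ∈ 𝒯 ∧ ‖t.mid - e.1‖ ≤ 5 + ‖e.1 - e.2‖) ∧ t ≠ s} ⊆ _)).biUnion
    fun t ht => t.finite_edges.biUnion fun f hf =>
      (((h𝒯.matching s hs t ht.1.1 ht.2.symm e he f hf).resolve_right
        fun h => hcon t ht.1.1 ht.2 (h ▸ hf)).finite)) ?_)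
  intro p hp
  obtain ⟨t, ht, hne, hpt⟩ := h𝒯.exists_other_of_mem_edge he hp
  obtain ⟨f, hf, hpf⟩ := t.exists_edge_of_mem_body hpt
    (h𝒯.not_strict_of_mem hs ht hne.symm (s.mem_body_of_mem_edge he hp).1)
  refine Set.mem_biUnion (x := t) ⟨⟨ht, ?_⟩, hne⟩ (Set.mem_biUnion (x := f) hf ⟨hp, hpf⟩)
  have h1 := t.norm_sub_mid_le hpt
  have h2 : ‖p - e.1‖ ≤ ‖e.1 - e.2‖ := by
    have := norm_sub_le_of_mem_segment hp
    rwa [norm_sub_rev e.2] at this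
  have := norm_sub_le (p - e.1) (p - t.mid)
  rw [sub_sub_sub_cancel_left] at this
  linarith

/-- The bound is `cos (2π/5)`. If it failed, the point of `strict_dart`, which is symmetric in the
two axes, would be interior to both darts. -/
theorem re_dir_div_le (h𝒯 : IsP2Tiling 𝒯) {v : ℂ} {d d' : Circle} (h : ⟨.dart, v, d⟩ ∈ 𝒯)
    (h' : ⟨.dart, v, d'⟩ ∈ 𝒯) (hne : d ≠ d') : ((d' / d : Circle) : ℂ).re ≤ (φ - 1) / 2 := by
  by_contra! hlt
  have h1 := Tile.strict_dart v d (d' / d) hlt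
  have h2 := Tile.strict_dart v d' (d / d') (by
    rwa [← inv_div d' d, Circle.coe_inv_eq_conj, Complex.conj_re])
  have h3 : v + d * ((1 / 10 : ℝ) * (1 + (d' / d : Circle))) =
      v + d' * ((1 / 10 : ℝ) * (1 + (d / d' : Circle))) := by
    have e1 := d.coe_ne_zero
    have e2 := d'.coe_ne_zero
    push_cast
    field_simp
    ring
  rw [← h3] at h2
  have := h𝒯.eq_of_strict h h' h1 h2
  exact hne (congrArg Tile.dir this)

end IsP2Tiling

/-! ### The five darts of a star -/

theorem cos_two_pi_div_five_eq : Real.cos (2 * π / 5) = (φ - 1) / 2 := by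
  rw [mul_div_assoc, Real.cos_two_mul, cos_pi_div_five_eq, div_pow, Real.goldenRatio_sq]
  ring

theorem le_abs_of_cos_le {α : ℝ} (h0 : |α| ≤ 2 * π) (h : Real.cos α ≤ Real.cos (2 * π / 5)) :
    2 * π / 5 ≤ |α| ∧ |α| ≤ 8 * π / 5 := by
  have hπ := Real.pi_pos
  rw [← Real.cos_abs] at h
  constructor <;> by_contra! hlt
  · exact h.not_gt (Real.cos_lt_cos_of_nonneg_of_le_pi (abs_nonneg _) (by linarith) hlt)
  · have := Real.cos_lt_cos_of_nonneg_of_le_pi (x := 2 * π - |α|) (y := 2 * π / 5) (by linarith)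
      (by linarith) (by linarith)
    rw [Real.cos_two_pi_sub] at this
    exact h.not_gt this

/-- The darts of a star form a regular pattern. -/
theorem IsStarCenter.mem_of_exp {𝒯 : Set Tile} (h𝒯 : IsP2Tiling 𝒯) {v : ℂ}
    (hv : IsStarCenter 𝒯 v) {d : Circle} (hd : ⟨.dart, v, d⟩ ∈ 𝒯) (k : ℕ) (hk : k < 5) :
    ⟨.dart, v, d * Circle.exp (k * (2 * π / 5))⟩ ∈ 𝒯 := by
  have hπ := Real.pi_pos
  -- Directions are measured from `d` in units of `2π/5`, by a number in `[0, 5)`.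
  have hex : ∀ c : Circle, ∃ x : ℝ, 0 ≤ x ∧ x < 5 ∧ c = d * Circle.exp (x * (2 * π / 5)) := by
    intro c
    refine ⟨toIcoMod Real.two_pi_pos 0 (Complex.arg ((c / d : Circle) : ℂ)) / (2 * π / 5),
      div_nonneg (toIcoMod_mem_Ico Real.two_pi_pos 0 _).1 (by positivity), ?_, ?_⟩
    · rw [div_lt_iff₀ (by positivity)]
      have := (toIcoMod_mem_Ico Real.two_pi_pos 0 (Complex.arg ((c / d : Circle) : ℂ))).2
      linarith
    · rw [div_mul_cancel₀ _ (by positivity), toIcoMod, Circle.exp_sub,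
        Circle.exp_arg]
      have : Circle.exp (toIcoDiv Real.two_pi_pos 0 (Complex.arg ((c / d : Circle) : ℂ)) • (2 * π)) = 1 := by
        rw [zsmul_eq_mul, Circle.exp_int_mul_two_pi]
      rw [this]
      simp
  choose x hx0 hx5 hx using hex
  have hxd : x d = 0 := by
    have h1 := hx d
    rw [left_eq_mul, Circle.exp_eq_one] at h1
    obtain ⟨n, hn⟩ := h1
    have h2 : x d = 5 * n := by
      have : x d * (2 * π / 5) = (5 * n) * (2 * π / 5) := by rw [hn]; ring
      exact mul_right_cancel₀ (by positivity) this
    have h3 := hx0 d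
    have h4 := hx5 d
    rw [h2] at h3 h4
    have h5 : (0 : ℤ) ≤ n := by exact_mod_cast (by linarith : (0 : ℝ) ≤ n)
    have h6 : n < 1 := by exact_mod_cast (by linarith : (n : ℝ) < 1)
    have h7 : n = 0 := by omega
    rw [h2, h7]; simp
  have hsep : ∀ c c', ⟨.dart, v, c⟩ ∈ 𝒯 → ⟨.dart, v, c'⟩ ∈ 𝒯 → c ≠ c' →
      1 ≤ |x c' - x c| ∧ |x c' - x c| ≤ 4 := by
    intro c c' h h' hne
    have h1 := h𝒯.re_dir_div_le h h' hne
    have h2 : c' / c = Circle.exp ((x c' - x c) * (2 * π / 5)) := by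
      conv_lhs => rw [hx c, hx c', mul_div_mul_left_eq_div, ← Circle.exp_sub, ← sub_mul]
    rw [h2, Circle.coe_exp, Complex.exp_ofReal_mul_I_re, ← cos_two_pi_div_five_eq] at h1
    have h3 : |(x c' - x c) * (2 * π / 5)| = |x c' - x c| * (2 * π / 5) := by
      rw [abs_mul, abs_of_pos (by positivity : 0 < 2 * π / 5)]
    have h4 : |x c' - x c| ≤ 5 := abs_le.2 ⟨by linarith [hx0 c', hx5 c], by linarith [hx0 c, hx5 c']⟩
    have h5 := le_abs_of_cos_le (by rw [h3]; nlinarith) h1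
    rw [h3] at h5
    constructor
    · have : 1 * (2 * π / 5) ≤ |x c' - x c| * (2 * π / 5) := by linarith [h5.1]
      exact le_of_mul_le_mul_right this (by positivity)
    · have : |x c' - x c| * (2 * π / 5) ≤ 4 * (2 * π / 5) := by linarith [h5.2]
      exact le_of_mul_le_mul_right this (by positivity)
  have hD : {c : Circle | ⟨.dart, v, c⟩ ∈ 𝒯}.encard = 5 := by
    have h1 : (fun t : 𝒯 => t.1.dir) '' dartsAt 𝒯 v = {c : Circle | ⟨.dart, v, c⟩ ∈ 𝒯} := by
      ext c
      constructor
      · rintro ⟨⟨⟨k, A, w⟩, ht⟩, ⟨rfl, rfl⟩, rfl⟩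
        exact ht
      · intro hc
        exact ⟨⟨_, hc⟩, ⟨rfl, rfl⟩, rfl⟩
    rw [← h1, Set.InjOn.encard_image, hv]
    rintro ⟨⟨k, A, w⟩, ht⟩ ⟨rfl, rfl⟩ ⟨⟨k', A', w'⟩, ht'⟩ ⟨h2, h3⟩ h4
    simp only at h2 h3 h4
    subst h2 h3 h4
    rfl
  have hfl : ∀ c, (⌊x c⌋₊ : ℝ) ≤ x c ∧ x c < ⌊x c⌋₊ + 1 := fun c =>
    ⟨Nat.floor_le (hx0 c), Nat.lt_floor_add_one _⟩
  -- Directions of darts differ by at least one unit, so five of them occupy each of the intervals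
  -- `[i, i + 1)` exactly once.
  have hinj : Set.InjOn (fun c => ⌊x c⌋₊) {c : Circle | ⟨.dart, v, c⟩ ∈ 𝒯} := by
    intro c hc c' hc' h
    by_contra hne
    have h1 := (hsep c c' hc hc' hne).1
    have h2 := hfl c
    have h3 := hfl c'
    simp only at h
    rw [← h] at h3
    exact absurd h1 (not_le.2 (abs_lt.2 ⟨by linarith, by linarith⟩))
  have himg : (fun c => ⌊x c⌋₊) '' {c : Circle | ⟨.dart, v, c⟩ ∈ 𝒯} = ↑(Finset.range 5) := by
    apply (Finset.finite_toSet _).eq_of_subset_of_encard_le'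
    · rintro _ ⟨c, -, rfl⟩
      simp only [Finset.coe_range, Set.mem_Iio]
      exact Nat.floor_lt' (by norm_num) |>.2 (hx5 c)
    · rw [hinj.encard_image, hD, Set.encard_coe_eq_coe_finsetCard, Finset.card_range]
      norm_num
  have hsurj : ∀ i : ℕ, ∃ c, i < 5 → ⟨.dart, v, c⟩ ∈ 𝒯 ∧ (i : ℝ) ≤ x c ∧ x c < i + 1 := by
    intro i
    by_cases hi : i < 5
    · have h1 : i ∈ (fun c => ⌊x c⌋₊) '' {c : Circle | ⟨.dart, v, c⟩ ∈ 𝒯} := by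
        rw [himg]; simpa using hi
      obtain ⟨c, hc, rfl⟩ := h1
      exact ⟨c, fun _ => ⟨hc, hfl c⟩⟩
    · exact ⟨1, fun h => (hi h).elim⟩
  choose g hg using hsurj
  have hstep : ∀ i, i + 1 < 5 → x (g i) + 1 ≤ x (g (i + 1)) := by
    intro i hi
    obtain ⟨h1, h2, h3⟩ := hg i (by omega)
    obtain ⟨h4, h5, h6⟩ := hg (i + 1) hi
    push_cast at h5
    have h7 := (hsep _ _ h1 h4 (fun h => by rw [h] at h3; linarith)).1
    rw [abs_of_nonneg (by linarith)] at h7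
    linarith
  -- Since `d` itself has coordinate 0, separation around the circle bounds the last coordinate by
  -- 4. With the steps of at least 1 this forces the coordinates `0, 1, 2, 3, 4`.
  have h4 : x (g 4) ≤ 4 := by
    obtain ⟨h1, h2, h3⟩ := hg 4 (by norm_num)
    push_cast at h2
    have h7 := (hsep _ _ hd h1 (fun h => by rw [← h, hxd] at h2; linarith)).2
    rw [hxd, sub_zero, abs_of_nonneg (by linarith)] at h7
    exact h7
  have h5 : x (g k) = k := by
    have s0 := hstep 0 (by norm_num)
    have s1 := hstep 1 (by norm_num)
    have s2 := hstep 2 (by norm_num)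
    have s3 := hstep 3 (by norm_num)
    have t := (hg k hk).2.1
    norm_num at s0 s1 s2 s3
    interval_cases k <;> push_cast at t ⊢ <;> linarith
  have h6 := hx (g k)
  rw [h5] at h6
  rw [← h6]
  exact (hg k hk).1

theorem IsStarCenter.mem_of_turn {𝒯 : Set Tile} (h𝒯 : IsP2Tiling 𝒯) {v : ℂ}
    (hv : IsStarCenter 𝒯 v) {d η : Circle} (hη : IsTurn η) (hd : ⟨.dart, v, d⟩ ∈ 𝒯) (i : ℕ) :
    ⟨.dart, v, d * η ^ (2 * i)⟩ ∈ 𝒯 := by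
  have h5 : ∀ k : ℕ, ⟨.dart, v, d * Circle.exp (2 * π / 5) ^ k⟩ ∈ 𝒯 := by
    intro k
    have h1 : Circle.exp (2 * π / 5) ^ 5 = 1 := by
      rw [← Circle.exp_natCast_mul, ← Circle.exp_two_pi]
      congr 1
      push_cast; ring
    have h2 := hv.mem_of_exp h𝒯 hd (k % 5) (Nat.mod_lt _ (by norm_num))
    rw [Circle.exp_natCast_mul] at h2
    rwa [← Nat.mod_add_div k 5, pow_add, pow_mul, h1, one_pow, mul_one]
  have h2 : Circle.exp (2 * π / 5) = Circle.exp (π / 5) ^ 2 := by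
    rw [← Circle.exp_natCast_mul]
    congr 1
    push_cast; ring
  rcases hη with rfl | rfl
  · have := h5 i
    rwa [h2, ← pow_mul] at this
  · have := h5 (4 * i)
    rw [h2, ← pow_mul] at this
    have h3 : Circle.exp (-(π / 5)) = Circle.exp (π / 5) ^ 9 := by
      have := isTurn_exp.pow_ten
      rw [Circle.exp_neg, inv_eq_iff_mul_eq_one, ← pow_succ', this]
    rw [h3, ← pow_mul]
    have h4 : 9 * (2 * i) = 2 * (4 * i) + 10 * i := by ring
    rwa [h4, pow_add, pow_mul _ 10, isTurn_exp.pow_ten, one_pow, mul_one]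

/-! ### The case search as a Boolean program -/

open V4

/-- A vertex of a tile: its position relative to the apex, the wedges of the tile at it, as a set of
five-bit slots, and the entries of these slots. -/
structure VRow where
  d : Nat
  m : Nat
  v : Nat
deriving DecidableEq

/-- The vertices of a tile in a given position, and the possible neighbors across its four edges. -/
structure Row where
  vs : List VRow
  os : List (List (Nat × Nat))

/-- The conditional, in a form that the kernel evaluates quickly. -/
noncomputable def sel {α : Sort _} (b : Bool) (x y : α) : α := Bool.rec y x b
notation "BIF" b "THEN" x "ELSE" y => sel b x y
/-- The row of the tile of kind `kd / 10` and direction `kd % 10`. -/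
noncomputable def row (kd : Nat) : Row :=
  BIF Nat.ble 10 kd THEN
    BIF Nat.ble 15 kd THEN
      BIF Nat.ble 17 kd THEN
        BIF Nat.ble 18 kd THEN
          BIF Nat.ble 19 kd THEN
            ⟨[⟨16909320, 1124800395214848, 434307092971520⟩, ⟨14828553, 1040187392, 436207616⟩, ⟨14828425, 34359738336, 21023440320⟩, ⟨14812041, 31744, 20480⟩],
    [[(4, 14828553), (11, 16909320)], [(3, 12731274), (13, 12731273)], [(5, 12731274), (15, 14828426)], [(4, 14812041), (17, 16909320)]]⟩
          ELSE
            ⟨[⟨16909320, 35150012350464, 13572096655360⟩, ⟨14812169, 32505856, 13631488⟩, ⟨14812168, 1073741823, 656982510⟩, ⟨14812040, 992, 640⟩],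
    [[(3, 14812169), (10, 16909320)], [(2, 12714889), (12, 14795784)], [(4, 12714889), (14, 12731273)], [(3, 14812040), (16, 16909320)]]⟩
        ELSE
          ⟨[⟨16909320, 1098437885952, 424128020480⟩, ⟨14812041, 1015808, 425984⟩, ⟨16892936, 1090715568308223, 492581229774351⟩, ⟨16892935, 31, 20⟩],
    [[(2, 14812041), (19, 16909320)], [(1, 14795656), (11, 16892808)], [(3, 14795656), (13, 14795784)], [(2, 16892935), (15, 16909320)]]⟩
      ELSE
        BIF Nat.ble 16 kd THEN
          ⟨[⟨16909320, 34326183936, 13254000640⟩, ⟨14812040, 31744, 13312⟩, ⟨16909192, 1124800396263423, 543158744762928⟩, ⟨18990087, 1090715534753792, 703687441776640⟩],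
    [[(1, 14812040), (18, 16909320)], [(0, 16892807), (10, 16909191)], [(2, 16892807), (12, 16892808)], [(1, 18990087), (14, 16909320)]]⟩
        ELSE
          ⟨[⟨16909320, 1072693248, 414187520⟩, ⟨16892935, 992, 416⟩, ⟨16909319, 1125865547137023, 579923664195153⟩, ⟨19006471, 34084860461056, 21990232555520⟩],
    [[(0, 16892935), (17, 16909320)], [(9, 18990086), (19, 18990214)], [(1, 18990086), (11, 16909191)], [(0, 19006471), (13, 16909320)]]⟩
    ELSE
      BIF Nat.ble 12 kd THEN
        BIF Nat.ble 13 kd THEN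
          BIF Nat.ble 14 kd THEN
            ⟨[⟨16909320, 33521664, 12943360⟩, ⟨18990087, 31, 13⟩, ⟨18990215, 1125898833101823, 616256940016242⟩, ⟨19006599, 1065151889408, 687194767360⟩],
    [[(9, 18990087), (16, 16909320)], [(8, 21087366), (18, 21087367)], [(0, 21087366), (10, 18990214)], [(9, 19006599), (12, 16909320)]]⟩
          ELSE
            ⟨[⟨16909320, 1047552, 404480⟩, ⟨19006471, 1090715534753792, 457396837154816⟩, ⟨19006472, 1125899873288223, 652576726974483⟩, ⟨19006600, 33285996544, 21474836480⟩],
    [[(8, 19006471), (15, 16909320)], [(7, 21103751), (17, 19022856)], [(9, 21103751), (19, 21087367)], [(8, 19006600), (11, 16909320)]]⟩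
        ELSE
          ⟨[⟨16909320, 32736, 12640⟩, ⟨19006599, 34084860461056, 14293651161088⟩, ⟨16925704, 1125899905794048, 688896092405760⟩, ⟨16925705, 1040187392, 671088640⟩],
    [[(7, 19006599), (14, 16909320)], [(6, 19022984), (16, 16925832)], [(8, 19022984), (18, 19022856)], [(7, 16925705), (10, 16909320)]]⟩
      ELSE
        BIF Nat.ble 11 kd THEN
          ⟨[⟨16909320, 1023, 395⟩, ⟨19006600, 1065151889408, 446676598784⟩, ⟨16909448, 35184372056064, 21528002887680⟩, ⟨14828553, 32505856, 20971520⟩],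
    [[(6, 19006600), (13, 16909320)], [(5, 16925833), (15, 16909449)], [(7, 16925833), (17, 16925832)], [(6, 14828553), (19, 16909320)]]⟩
        ELSE
          ⟨[⟨16909320, 1090715534753823, 387028092977164⟩, ⟨16925705, 33285996544, 13958643712⟩, ⟨16909321, 1099511626752, 672750090240⟩, ⟨14812169, 1015808, 655360⟩],
    [[(5, 16925705), (12, 16909320)], [(4, 14828554), (14, 14828426)], [(6, 14828554), (16, 16909449)], [(5, 14812169), (18, 16909320)]]⟩
  ELSE
    BIF Nat.ble 5 kd THEN
      BIF Nat.ble 7 kd THEN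
        BIF Nat.ble 8 kd THEN
          BIF Nat.ble 9 kd THEN
            ⟨[⟨16909320, 1124800395214848, 71468255805440⟩, ⟨14828553, 34326183936, 4395630592⟩, ⟨14812169, 1073740800, 275977216⟩, ⟨14812041, 32736, 10528⟩],
    [[(1, 16909320), (14, 14828553)], [(5, 12731402), (15, 14828554)], [(3, 12714890), (13, 12714889)], [(7, 16909320), (14, 14812041)]]⟩
          ELSE
            ⟨[⟨16909320, 35150012350464, 2233382993920⟩, ⟨14812169, 1072693248, 137363456⟩, ⟨14812041, 33554400, 8624288⟩, ⟨14812040, 1023, 329⟩],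
    [[(0, 16909320), (13, 14812169)], [(4, 12714890), (14, 12731274)], [(2, 12714761), (12, 14795656)], [(6, 16909320), (13, 14812040)]]⟩
        ELSE
          ⟨[⟨16909320, 1098437885952, 69793218560⟩, ⟨14812041, 33521664, 4292608⟩, ⟨14812040, 1048575, 269509⟩, ⟨16892935, 1090715534753823, 316659348799498⟩],
    [[(9, 16909320), (12, 14812041)], [(3, 12714761), (13, 12714889)], [(1, 14795655), (11, 16892807)], [(5, 16909320), (12, 16892935)]]⟩
      ELSE
        BIF Nat.ble 6 kd THEN
          ⟨[⟨16909320, 34326183936, 2181038080⟩, ⟨14812040, 1047552, 134144⟩, ⟨16892935, 1090715534786559, 175921860452582⟩, ⟨18990087, 1124800395214848, 361739325538304⟩],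
    [[(8, 16909320), (11, 14812040)], [(2, 14795655), (12, 14795656)], [(0, 18973702), (10, 18990086)], [(4, 16909320), (11, 18990087)]]⟩
        ELSE
          ⟨[⟨16909320, 1072693248, 68157440⟩, ⟨16892935, 32736, 4192⟩, ⟨18990087, 1124800395215871, 216603790672135⟩, ⟨19006471, 35150012350464, 11304353923072⟩],
    [[(7, 16909320), (10, 16892935)], [(1, 18973702), (11, 16892807)], [(9, 21087238), (19, 21087366)], [(3, 16909320), (10, 19006471)]]⟩
    ELSE
      BIF Nat.ble 2 kd THEN
        BIF Nat.ble 3 kd THEN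
          BIF Nat.ble 4 kd THEN
            ⟨[⟨16909320, 33521664, 2129920⟩, ⟨18990087, 1023, 131⟩, ⟨19006471, 1125865547104287, 253059473080328⟩, ⟨19006599, 1098437885952, 353261060096⟩],
    [[(6, 16909320), (19, 18990087)], [(0, 21087238), (10, 18990086)], [(8, 21103750), (18, 21103751)], [(2, 16909320), (19, 19006599)]]⟩
          ELSE
            ⟨[⟨16909320, 1047552, 66560⟩, ⟨19006471, 1090715534753823, 105553116266500⟩, ⟨19006599, 1125898833100800, 289383085244416⟩, ⟨19006600, 34326183936, 11039408128⟩],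
    [[(5, 16909320), (18, 19006471)], [(9, 21103750), (19, 21087366)], [(7, 21103879), (17, 19022984)], [(1, 16909320), (18, 19006600)]]⟩
        ELSE
          ⟨[⟨16909320, 32736, 2080⟩, ⟨19006599, 1124800395214848, 144036023238656⟩, ⟨19006600, 35184338534400, 9043221413888⟩, ⟨16925705, 1072693248, 344981504⟩],
    [[(4, 16909320), (17, 19006599)], [(8, 21103879), (18, 21103751)], [(6, 19022985), (16, 16925833)], [(0, 16909320), (17, 16925705)]]⟩
      ELSE
        BIF Nat.ble 1 kd THEN
          ⟨[⟨16909320, 1023, 65⟩, ⟨19006600, 35150012350464, 4501125726208⟩, ⟨16925705, 1099510579200, 282600669184⟩, ⟨14828553, 33521664, 10780672⟩],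
    [[(3, 16909320), (16, 19006600)], [(7, 19022985), (17, 19022984)], [(5, 14844938), (15, 14828554)], [(9, 16909320), (16, 14828553)]]⟩
        ELSE
          ⟨[⟨16909320, 1090715534753823, 35184372088834⟩, ⟨16925705, 1098437885952, 140660178944⟩, ⟨14828553, 34359705600, 8831270912⟩, ⟨14812169, 1047552, 336896⟩],
    [[(2, 16909320), (15, 16925705)], [(6, 14844938), (16, 16925833)], [(4, 12731402), (14, 12731274)], [(8, 16909320), (15, 14812169)]]⟩
/-- Search trees with keys and values in `ℕ`. -/
inductive Tr
  | nil
  | node (l : Tr) (k w : Nat) (r : Tr)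

namespace Tr
-- The default 0 means that no wedge at this vertex is occupied.
noncomputable def find (t : Tr) (v : Nat) : Nat :=
  t.rec 0 fun _ k w _ fl fr => BIF Nat.beq v k THEN w ELSE BIF Nat.ble v k THEN fl ELSE fr
end Tr

/-- The application of `f` to the value of `n`. -/
noncomputable def force {α : Sort _} (n : Nat) (f : Nat → α) : α :=
  Nat.rec (f 0) (fun m _ => f (Nat.succ m)) n

/-- The translation of a position by an encoded displacement. -/
def shift (p e : Nat) : Nat := p + e - 16909320

/-- The position is so close to the origin that the positions near it have codes. -/
def inBounds (p : Nat) : Bool :=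
  Nat.ble 16 (p % 128) && Nat.ble (p % 128) 111 && Nat.ble 16 (p / 128 % 128) &&
  Nat.ble (p / 128 % 128) 111 && Nat.ble 16 (p / 16384 % 128) && Nat.ble (p / 16384 % 128) 111 &&
  Nat.ble 16 (p / 2097152) && Nat.ble (p / 2097152) 111

/-- The code of a tile: kind and direction, and the position of the apex. -/
structure Code where
  kd : Nat
  ap : Nat

def Code.beq (x y : Code) : Bool := Nat.beq x.ap y.ap && Nat.beq x.kd y.kd

/-- Whether a tile overlaps the known tiles (`0`), is compatible with them (`1`), or is one of them (`2`). -/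
noncomputable def statusAux (M : Tr) (ap : Nat) (l : List VRow) : Nat :=
  l.rec 1 fun r _ h => force (Nat.land (M.find (shift ap r.d)) r.m) fun x =>
      BIF Nat.beq x 0 THEN h ELSE BIF Nat.beq x r.v THEN 2 ELSE 0

noncomputable def status (M : Tr) (x : Code) : Nat := statusAux M x.ap (row x.kd).vs

/-- Continuation passing with `force` hands over trees whose labels are evaluated, so kernel
reduction does not carry along pending insertions. -/
noncomputable def Tr.ins (t : Tr) (v x : Nat) : (Tr → Bool) → Bool :=
  t.rec (fun k => force x fun x => k (.node .nil v x .nil)) fun l u w r il ir k =>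
    BIF Nat.beq v u THEN force (Nat.lor w x) fun w => k (.node l u w r)
    ELSE BIF Nat.ble v u THEN il fun l => k (.node l u w r) ELSE ir fun r => k (.node l u w r)

noncomputable def putAux (ap : Nat) (l : List VRow) : Tr → (Tr → Bool) → Bool :=
  l.rec (fun M k => k M) fun r _ h M k => force (shift ap r.d) fun v => M.ins v r.v fun M => h M k

/-- Mark the wedges of a tile as occupied. -/
noncomputable def put (M : Tr) (x : Code) (k : Tr → Bool) : Bool := putAux x.ap (row x.kd).vs M k

noncomputable def mkOpt (ap : Nat) (o : Nat × Nat) {α : Sort _} (k : Code → α) : α :=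
  force (shift ap o.2) fun a => k ⟨o.1, a⟩

def getD : List (List (Nat × Nat)) → Nat → List (Nat × Nat)
  | [], _ => []
  | x :: _, 0 => x
  | _ :: l, n + 1 => getD l n

/-- state: the occupied wedges and the list of the known tiles -/
noncomputable def addTile (M : Tr) (L : List Code) (x : Code) (k : Tr → List Code → Bool) : Bool :=
  BIF inBounds x.ap THEN
    let s := status M x
    BIF Nat.beq s 0 THEN true ELSE BIF Nat.beq s 2 THEN k M L ELSE put M x fun M => k M (x :: L)
  ELSE false

/-- A case distinction is a conjunction over all options. A branch refuted by an overlap counts as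
`true`; leaving the range of coordinates counts as `false`. -/
noncomputable def optsAll (ap : Nat) (l : List (Nat × Nat)) (k : Code → Bool) : Bool :=
  l.rec true fun o _ h => mkOpt ap o k && h

noncomputable def addNbrL (M : Tr) (L : List Code) (t : Code) (l : List (Nat × Nat)) (k : Tr → List Code → Code → Bool) : Bool :=
  optsAll t.ap l fun x => addTile M L x fun M L => k M L x

/-- Case distinction according to the neighbor across an edge. -/
noncomputable def addNbr (M : Tr) (L : List Code) (t : Code) (i : Nat) (k : Tr → List Code → Code → Bool) : Bool :=
  addNbrL M L t (getD (row t.kd).os i) k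

noncomputable def addNbrs (M : Tr) (L : List Code) (t : Code) (k : Tr → List Code → List Code → Bool) : Bool :=
  addNbr M L t 0 fun M L x0 => addNbr M L t 1 fun M L x1 => addNbr M L t 2 fun M L x2 =>
    addNbr M L t 3 fun M L x3 => k M L [x0, x1, x2, x3]

/-- unit propagation for the tile across one edge with options `l` -/
noncomputable def unitOpts (M : Tr) (L : List Code) (ap : Nat) (l : List (Nat × Nat)) (k : Tr → List Code → Bool) : Bool :=
  match l with
  | [o1, o2] => mkOpt ap o1 fun x1 => mkOpt ap o2 fun x2 => force (status M x1) fun s1 =>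
      BIF Nat.beq s1 2 THEN k M L ELSE force (status M x2) fun s2 =>
        BIF Nat.beq s2 2 THEN k M L ELSE
        BIF Nat.beq s1 0 THEN
          (BIF Nat.beq s2 0 THEN true ELSE inBounds x2.ap && put M x2 fun M => k M (x2 :: L))
        ELSE BIF Nat.beq s2 0 THEN inBounds x1.ap && put M x1 fun M => k M (x1 :: L) ELSE k M L
  | _ => k M L

noncomputable def unitEdges (M : Tr) (L : List Code) (ap : Nat) (os : List (List (Nat × Nat))) (k : Tr → List Code → Bool) : Bool :=
  os.rec (fun M L => k M L) (fun l _ h M L => unitOpts M L ap l fun M L => h M L) M L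

noncomputable def unitPass (M : Tr) (L : List Code) (ts : List Code) (k : Tr → List Code → Bool) : Bool :=
  ts.rec (fun M L => k M L) (fun t _ h M L => unitEdges M L t.ap (row t.kd).os fun M L => h M L) M L

noncomputable def elem (x : Code) (l : List Code) : Bool :=
  l.rec false fun y _ h => x.beq y || h

/-- `x` shares an edge with a member of `T` other than `p` -/
noncomputable def touches (x p : Code) (T : List Code) : Bool :=
  !((row x.kd).os.all fun l => optsAll x.ap l fun y => y.beq p || !elem y T)

/-- Extend the tree `T` by the neighbors `l` of `p`, unless this closes a cycle. -/
noncomputable def addTs (T N : List Code) (p : Code) (l : List Code) (k : List Code → Bool) : Bool :=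
  l.rec (fun T _ => k T) (fun x _ h T N => elem x T && h T N || !elem x T && (touches x p N || h (x :: T) (x :: N))) T N

/-- split the members of `l` other than `prev` according to whether they close a cycle -/
noncomputable def split (T : List Code) (p : Code) (prev : Code) (l : List Code)
    (k : List Code → List Code → Bool) : Bool :=
  l.rec (fun g b => k g b) (fun x _ h g b => BIF x.beq prev THEN h g b ELSE
    BIF elem x T THEN h (x :: g) b ELSE BIF touches x p T THEN h g (x :: b) ELSE h (x :: g) b) [] []

noncomputable def without (x : Code) (l : List Code) (k : List Code → Bool) : Bool :=
  l.rec (fun r => k r) (fun y _ h r => BIF y.beq x THEN h r ELSE h (y :: r)) []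

/-- Case distinction according to the three neighbors of an inner tile in a tree. -/
noncomputable def pick (T : List Code) (p prev : Code) (nb : List Code) (k : List Code → List Code → Bool) : Bool :=
  split T p prev nb fun g b =>
    -- Exactly one neighbor is missing, and it is not `prev`. Those in `b` would close a cycle, so
    -- any of them is the missing one: if there are none, every member of `g` is tried; one settles
    -- the choice; two are contradictory.
    b.rec (g.all fun x => without x g fun inc => addTs T [] p inc fun T => k T inc)
      fun _ b _ => b.rec (addTs T [] p g fun T => k T g) fun _ _ _ => true

/-- Add the neighbors of an inner tile `p` of a tree. -/
noncomputable def visit (M : Tr) (L T : List Code) (prev : Code) (p : Code)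
    (k : Tr → List Code → List Code → List Code → Bool) : Bool :=
  addNbrs M L p fun M L nb => unitPass M L nb fun M L => pick T p prev nb fun T inc => k M L T inc

/-- `x` is one of the options across the first two edges of `t` -/
noncomputable def acrossLeft (t x : Code) : Bool :=
  !(optsAll t.ap (getD (row t.kd).os 0) fun y => !x.beq y) ||
  !(optsAll t.ap (getD (row t.kd).os 1) fun y => !x.beq y)

/-- Follow a caterpillar from its second tile on. -/
noncomputable def searchRing (p1 : Code) (goal : List Code → List Code → Bool) : Bool :=
  -- The code `⟨0, 0⟩` is a dummy predecessor; it is out of bounds and hence not the code of a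
  -- neighbor. By reflection the second tile may be assumed to lie across one of the first two
  -- edges.
  put .nil p1 fun M => visit M [p1] [p1] ⟨0, 0⟩ p1 fun M L T i1 => i1.all fun p2 => !acrossLeft p1 p2 ||
  visit M L T p1 p2 fun M L T i2 => i2.all fun p3 =>
  visit M L T p2 p3 fun M L T i3 => i3.all fun p4 =>
  visit M L T p3 p4 fun M L T i4 => i4.all fun p5 =>
  visit M L T p4 p5 fun M L T i5 => i5.all fun p6 =>
  -- The branches not settled by six tiles are extended by the end tiles on both sides, whose
  -- neighbors bring contradictions or complete the star.
  goal L [p1, p2, p3, p4, p5, p6] ||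
  visit M L T p5 p6 fun M L T i6 => without p2 i1 fun j1 => j1.all fun p0 =>
  visit M L T p1 p0 fun M L T _ => i6.all fun p7 =>
  visit M L T p6 p7 fun _ L _ _ => goal L [p1, p2, p3, p4, p5, p6]

/-- The effect of `η ↦ η⁻¹` on coordinates, that is, of a reflection; see `val_conj`. -/
noncomputable def V4.conj (x : V4) : V4 := ⟨x.a + x.b, -x.b, x.b - x.d, -x.b - x.c⟩
-- Since `φ + 1 = φ ^ 2`, this is the vector of length `φ ^ 2` in direction `k`; for even `k` it
-- leads from the center of a star to the common apex of two kites of the ring.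
noncomputable def phi2 (k : Nat) : V4 := add (ph k) (pw k)
/-- The tiles of a caterpillar around a star with center at the origin. -/
noncomputable def ringRel (j : Nat) : RCode :=
  BIF Nat.beq (j % 2) 0 THEN ⟨0, phi2 j, j + 4⟩ ELSE ⟨0, phi2 (j + 1), j + 7⟩
/-- The tiles of a star with center at the origin. -/
noncomputable def starRel (i : Nat) : RCode := ⟨1, zero, 2 * i⟩
/-- The code of a tile with respect to a frame that is given by orientation, direction and center. -/
noncomputable def place (s : Bool) (d v : Nat) (c : RCode) : Code :=
  BIF s THEN ⟨c.kind * 10 + (c.dir + d) % 10, shift v (enc (rotn c.pos d))⟩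
  -- A reflection reverses directions; the multiple 30 of ten prevents truncation of the
  -- subtraction.
  ELSE ⟨c.kind * 10 + (d + 30 - c.dir) % 10, shift v (enc (rotn c.pos.conj d))⟩
noncomputable def matchRing (s : Bool) (d v : Nat) : Nat → List Code → Bool
  | _, [] => true
  | j, x :: l => x.beq (place s d v (ringRel j)) && matchRing s d v (j + 1) l
noncomputable def stars (s : Bool) (d v : Nat) : List Code := [0, 1, 2, 3, 4].map fun i => place s d v (starRel i)
/-- The known tiles contain a star that is surrounded by the path. -/
noncomputable def ringGoal (L path : List Code) : Bool :=
  match path with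
  | [] => false
  | p :: _ => Nat.ble p.kd 9 && [true, false].any fun s =>
      -- The first ring tile has apex in direction 2 and axis in direction 8. Its code thus
      -- determines the rotation `d`, and the center is reached from its apex by `φ ^ 2` in the
      -- opposite of the direction of the apex.
      force (shift p.ap (enc (phi2 (BIF s THEN p.kd + 9 ELSE p.kd + 1)))) fun v =>
      force ((BIF s THEN p.kd + 2 ELSE p.kd + 8) % 10) fun d =>
      matchRing s d v 1 path && (stars s d v).all fun x => elem x L
def P0 : Nat := 64 * (1 + 128 + 16384 + 2097152)

noncomputable def addTiles (M : Tr) (L : List Code) (l : List Code) (k : Tr → List Code → Bool) : Bool :=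
  l.rec (fun M L => k M L) (fun x _ h M L => force x.ap fun ap => force x.kd fun kd => addTile M L ⟨kd, ap⟩ fun M L => h M L) M L

/-- add the star with center `v` and its ring -/
noncomputable def addStar (M : Tr) (L : List Code) (s : Bool) (d v : Nat) (k : Tr → List Code → Bool) : Bool :=
  addTiles M L (stars s d v) fun M L => unitPass M L (stars s d v) k

noncomputable def ringC (j : Nat) : Code := place true 0 P0 (ringRel j)
noncomputable def withRing (k : Tr → List Code → Bool) : Bool := addStar .nil [] true 0 P0 k
noncomputable def ringT : List Code := [1, 2, 3, 4, 5, 6].map ringC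

/-- Positions have offset 64 in each digit to base 128, so `P0` is the origin. -/
def dig (p : Nat) : V4 := ⟨(p % 128 : Nat) - 64, (p / 128 % 128 : Nat) - 64, (p / 16384 % 128 : Nat) - 64,
  (p / 2097152 : Nat) - 64⟩
/-- The number `x` is a real multiple of the `k`th power of a rotation by `π / 5`. -/
def onLine (x : V4) (k : Nat) : Bool :=
  -- Rotation by `η ^ (20 - k) = η⁻¹ ^ k` takes the line to the real axis, where both parts of the
  -- imaginary coordinate in `im_val` vanish.
  let y := rotn x (20 - k)
  y.b == 0 && y.c + y.d == 0

/-- Case distinction according to the orientation of a ring with first tile `p`. -/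
noncomputable def frames (p : Code) (k : Bool → Nat → Nat → Bool) : Bool :=
  Nat.ble 10 p.kd || [true, false].all fun s =>
      force (shift p.ap (enc (phi2 (BIF s THEN p.kd + 9 ELSE p.kd + 1)))) fun v =>
      force ((BIF s THEN p.kd + 2 ELSE p.kd + 8) % 10) fun d => k s d v

/-- The center of a star lies on one of the rays that bound the sector of another one, and conversely. -/
noncomputable def onRays (s : Bool) (d v : Nat) : Bool :=
  -- In each star's own frame the lines have directions 2 and 6. For the second star these become `d
  -- + 2` and `d + 6`, or, after a reflection, `d - 2` and `d - 6`.
  (onLine (dig v) 2 || onLine (dig v) 6) && (BIF s THEN onLine (dig v) (d + 2) || onLine (dig v) (d + 6) ELSE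
   onLine (dig v) (d + 8) || onLine (dig v) (d + 4))

/-- Follow a caterpillar into the next one. -/
noncomputable def searchNext : Bool :=
  withRing fun M L => visit M L ringT (ringC 4) (ringC 5) fun M L T _ =>
  visit M L T (ringC 5) (ringC 6) fun M L T i6 => i6.all fun p7 =>
  visit M L T (ringC 6) p7 fun M L T i7 => i7.all fun t =>
  -- The tile `t` is the common leaf; it is not inner in either caterpillar, so only the neighbor
  -- that starts the next chain is added.
  addNbrs M L t fun M L nb => unitPass M L nb fun M L => nb.all fun q0 => q0.beq p7 ||
  addTs T T t [q0] fun T =>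
  visit M L T t q0 fun M L T j0 => j0.all fun q1 =>
  frames q1 fun s d v => !onRays s d v || addStar M L s d v fun M L =>
  -- In every surviving branch the second tile required by the new ring is not available as the next
  -- tile of the chain.
  visit M L T q0 q1 fun _ _ _ j1 => !elem (place s d v (ringRel 2)) j1

/-- No star with another center than the known one is adjacent to `c`. -/
noncomputable def probe (M : Tr) (L : List Code) (c : Code) : Bool :=
  [0, 1, 2, 3].all fun i => addNbr M L c i fun M L x => Nat.ble x.kd 9 || Nat.beq x.ap P0 ||
    -- A full star at another center either produces an overlap or is parallel to the known star, at
    -- one of the displacements excluded by `searchCloseStars`.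
    addStar M L true (x.kd % 10) x.ap fun _ _ => Nat.beq (x.kd % 2) 0 &&
      (elem ⟨0, x.ap⟩ ([0, 2, 4, 6, 8].map fun k => (⟨0, shift P0 (enc (rotn ⟨3, 1, 2, -1⟩ k))⟩ : Code)) ||
      elem ⟨0, x.ap⟩ ([0, 2, 4, 6, 8].map fun k => (⟨0, shift P0 (enc (rotn (V4.conj ⟨3, 1, 2, -1⟩) k))⟩ : Code)))

/-- Probe a tile of the ring and its neighbors. -/
noncomputable def searchStar (i j : Nat) : Bool :=
  withRing fun M L => probe M L (ringC i) && visit M L ringT (ringC j) (ringC i) fun M L _ inc =>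
    inc.all fun x => probe M L x

/-- Probe the leaves at an end of the caterpillar. -/
noncomputable def searchEndStar (i j : Nat) : Bool :=
  withRing fun M L => visit M L ringT (ringC j) (ringC i) fun M L T i6 => i6.all fun p7 =>
  visit M L T (ringC i) p7 fun M L _ i7 => i7.all fun t => probe M L t

/-- Two close stars of the same orientation do not fit together. -/
noncomputable def searchCloseStars : Bool :=
  withRing fun M L => force (shift P0 (enc ⟨3, 1, 2, -1⟩)) fun v => addStar M L true 0 v fun M L =>
  addNbr M L (place true 0 P0 (starRel 0)) 2 fun M L x => addNbr M L x 0 fun M L _ =>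
  unitPass M L L fun M L => unitPass M L L fun M L => unitPass M L L fun M L =>
  unitPass M L L fun _ _ => false

/-! ### The codes of tiles -/

theorem sel_eq {α : Sort*} (b : Bool) (x y : α) : sel b x y = if b = true then x else y := by
  cases b <;> rfl

theorem force_eq {α : Sort*} (n : ℕ) (f : ℕ → α) : force n f = f n := by
  cases n <;> rfl

theorem mkOpt_eq (ap : ℕ) (o : ℕ × ℕ) {α : Sort*} (k : Code → α) :
    mkOpt ap o k = k ⟨o.1, shift ap o.2⟩ := force_eq _ _

theorem Code.beq_iff (x y : Code) : x.beq y = true ↔ x = y := by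
  rcases x with ⟨a, b⟩
  rcases y with ⟨c, d⟩
  simp only [Code.beq, Bool.and_eq_true, Nat.beq_eq, Code.mk.injEq]
  exact and_comm

/-- The digits of `p` admit a displacement. -/
def Roomy (p : ℕ) : Prop :=
  (8 ≤ p % 128 ∧ p % 128 ≤ 119) ∧ (8 ≤ p / 128 % 128 ∧ p / 128 % 128 ≤ 119) ∧
  (8 ≤ p / 16384 % 128 ∧ p / 16384 % 128 ≤ 119) ∧ (8 ≤ p / 2097152 ∧ p / 2097152 ≤ 119)

def smallTest (x : V4) : Bool :=
  decide (-8 ≤ x.a) && decide (x.a < 8) && decide (-8 ≤ x.b) && decide (x.b < 8) &&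
  decide (-8 ≤ x.c) && decide (x.c < 8) && decide (-8 ≤ x.d) && decide (x.d < 8)

theorem inBounds_iff (p : ℕ) : inBounds p = true ↔
    (16 ≤ p % 128 ∧ p % 128 ≤ 111) ∧ (16 ≤ p / 128 % 128 ∧ p / 128 % 128 ≤ 111) ∧
    (16 ≤ p / 16384 % 128 ∧ p / 16384 % 128 ≤ 111) ∧ (16 ≤ p / 2097152 ∧ p / 2097152 ≤ 111) := by
  simp only [inBounds, Bool.and_eq_true, Nat.ble_eq]
  tauto

theorem roomy_of_inBounds {p : ℕ} (h : inBounds p = true) : Roomy p := by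
  rw [inBounds_iff] at h
  unfold Roomy
  omega

theorem enc_digits {x : V4} (hx : smallTest x = true) : ∃ a b c d : ℕ, (a < 16 ∧ b < 16 ∧ c < 16 ∧
    d < 16) ∧ (x.a = a - 8 ∧ x.b = b - 8 ∧ x.c = c - 8 ∧ x.d = d - 8) ∧
    enc x = a + b * 128 + c * 16384 + d * 2097152 := by
  simp only [smallTest, Bool.and_eq_true, decide_eq_true_eq] at hx
  exact ⟨(x.a + 8).toNat, (x.b + 8).toNat, (x.c + 8).toNat, (x.d + 8).toNat, by omega, by omega,
    by simp only [enc]⟩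

theorem eq_sum_digits (p : ℕ) : p = p % 128 + p / 128 % 128 * 128 + p / 16384 % 128 * 16384 +
    p / 2097152 * 2097152 := by omega

theorem digits_sum {a b c d : ℕ} (ha : a < 128) (hb : b < 128) (hc : c < 128) :
    (a + b * 128 + c * 16384 + d * 2097152) % 128 = a ∧
    (a + b * 128 + c * 16384 + d * 2097152) / 128 % 128 = b ∧
    (a + b * 128 + c * 16384 + d * 2097152) / 16384 % 128 = c ∧
    (a + b * 128 + c * 16384 + d * 2097152) / 2097152 = d := by omega

theorem shift_sum {p q r s a b c d : ℕ} (hp : 8 ≤ p) (hq : 8 ≤ q) (hr : 8 ≤ r) (hs : 8 ≤ s) :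
    shift (p + q * 128 + r * 16384 + s * 2097152) (a + b * 128 + c * 16384 + d * 2097152) =
    (p + a - 8) + (q + b - 8) * 128 + (r + c - 8) * 16384 + (s + d - 8) * 2097152 := by
  unfold shift
  omega

theorem shift_digits {p : ℕ} (hp : Roomy p) {x : V4} (hx : smallTest x = true) :
    ((shift p (enc x) % 128 : ℕ) : ℤ) = (p % 128 : ℕ) + x.a ∧
    ((shift p (enc x) / 128 % 128 : ℕ) : ℤ) = (p / 128 % 128 : ℕ) + x.b ∧
    ((shift p (enc x) / 16384 % 128 : ℕ) : ℤ) = (p / 16384 % 128 : ℕ) + x.c ∧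
    ((shift p (enc x) / 2097152 : ℕ) : ℤ) = (p / 2097152 : ℕ) + x.d := by
  obtain ⟨a, b, c, d, hd, ⟨h1, h2, h3, h4⟩, e⟩ := enc_digits hx
  unfold Roomy at hp
  have h := shift_sum (a := a) (b := b) (c := c) (d := d) hp.1.1 hp.2.1.1 hp.2.2.1.1 hp.2.2.2.1
  rw [← eq_sum_digits, ← e] at h
  rw [h1, h2, h3, h4, h]
  obtain ⟨k1, k2, k3, k4⟩ := digits_sum (a := p % 128 + a - 8) (b := p / 128 % 128 + b - 8)
    (c := p / 16384 % 128 + c - 8) (d := p / 2097152 + d - 8) (by omega) (by omega) (by omega)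
  rw [k1, k2, k3, k4]
  refine ⟨?_, ?_, ?_, ?_⟩
  · generalize p % 128 = q at *; omega
  · generalize p / 128 % 128 = q at *; omega
  · generalize p / 16384 % 128 = q at *; omega
  · generalize p / 2097152 = q at *; omega

theorem dig_shift {p : ℕ} (hp : Roomy p) {x : V4} (hx : smallTest x = true) :
    dig (shift p (enc x)) = add (dig p) x := by
  obtain ⟨h1, h2, h3, h4⟩ := shift_digits hp hx
  simp only [dig, add, mk.injEq]
  omega

/-- The margins of `inBounds` exceed those of `Roomy` by 8, the largest size of an entry of a
displacement. -/
theorem roomy_shift {p : ℕ} (hp : inBounds p = true) {x : V4} (hx : smallTest x = true) :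
    Roomy (shift p (enc x)) := by
  obtain ⟨h1, h2, h3, h4⟩ := shift_digits (roomy_of_inBounds hp) hx
  rw [inBounds_iff] at hp
  simp only [smallTest, Bool.and_eq_true, decide_eq_true_eq] at hx
  unfold Roomy
  omega

theorem dig_injective {p q : ℕ} (h : dig p = dig q) : p = q := by
  simp only [dig, mk.injEq] at h
  omega

/-- The code of a tile relative to a tile with code `kd`. -/
def relCode (kd : ℕ) (r : RCode) : ℕ × ℕ :=
  (r.kind * 10 + (r.dir + kd % 10) % 10, enc (rotn r.pos (kd % 10)))

-- The literal table `row` is compared with the geometry once and for all. In particular, masks that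
-- meet at a common vertex come from a common wedge.
set_option synthInstance.maxHeartbeats 1000000 in
set_option synthInstance.maxSize 4096 in
theorem row_vs_spec : ∀ kd < 20, ∀ r ∈ (row kd).vs, ∃ x ∈ vertRel (kd / 10),
    r.d = enc (rotn x (kd % 10)) ∧ smallTest (rotn x (kd % 10)) = true ∧ r.v &&& r.m = r.v ∧
    (∀ r' ∈ (row kd).vs, r.d = r'.d → r = r') ∧
    ∀ kd' < 20, ∀ r' ∈ (row kd').vs, r.v &&& r'.m = 0 ∨ ∃ x' ∈ vertRel (kd' / 10),
      r'.d = enc (rotn x' (kd' % 10)) ∧ smallTest (rotn x' (kd' % 10)) = true ∧ ∃ σ ∈ List.range 10,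
      (rotn x (kd % 10), σ) ∈ RCode.wedges ⟨kd / 10, zero, kd % 10⟩ ∧
      (rotn x' (kd' % 10), σ) ∈ RCode.wedges ⟨kd' / 10, zero, kd' % 10⟩ := by decide +kernel

theorem row_os_spec : ∀ kd < 20, ∀ i < 4, ∃ x ∈ (edgeRel (kd / 10)).zip (optRel (kd / 10)),
    getD (row kd).os i = x.2.map (relCode kd) := by decide +kernel

theorem row_os_spec' : ∀ kd < 20, ∀ x ∈ (edgeRel (kd / 10)).zip (optRel (kd / 10)), ∃ i < 4,
    getD (row kd).os i = x.2.map (relCode kd) := by decide +kernel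

-- The last clause says that the options across one edge overlap, so at most one of them belongs to
-- a tiling.
set_option synthInstance.maxHeartbeats 1000000 in
set_option synthInstance.maxSize 4096 in
theorem optRel_spec : ∀ k < 2, ∀ x ∈ (edgeRel k).zip (optRel k), x.1 ∈ edgeRel k ∧ ∀ r ∈ x.2,
    r.kind < 2 ∧ r.dir < 10 ∧ r ≠ ⟨k, zero, 0⟩ ∧ (∀ d < 10, smallTest (rotn r.pos d) = true) ∧
    (∃ e ∈ edgeRel r.kind, add r.pos (rotn e.1 r.dir) = x.1.1 ∧ add r.pos (rotn e.2 r.dir) = x.1.2) ∧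
    ∀ r' ∈ x.2, r = r' ∨ ∃ w ∈ r.wedges, w ∈ r'.wedges := by decide +kernel

theorem exists_of_mem_edgeRel : ∀ k < 2, ∀ e ∈ edgeRel k,
    ∃ x ∈ (edgeRel k).zip (optRel k), x.1 = e := by decide +kernel

set_option synthInstance.maxHeartbeats 1000000 in
set_option synthInstance.maxSize 4096 in
theorem row_os_disjoint : ∀ kd < 20, ∀ i < 4, ∀ j < 4, i ≠ j → ∀ o ∈ getD (row kd).os i,
    o ∉ getD (row kd).os j := by decide +kernel

/-- Two tiles share an edge. -/
def TileAdj (s t : Tile) : Prop := s ≠ t ∧ ∃ e, e ∈ s.edges ∧ e ∈ t.edges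

theorem TileAdj.symm {s t : Tile} (h : TileAdj s t) : TileAdj t s :=
  ⟨h.1.symm, h.2.imp fun _ h => h.symm⟩

namespace Frame

variable (F : Frame) {𝒯 : Set Tile}

def _root_.PenroseP2.Code.toRel (x : Code) : RCode := ⟨x.kd / 10, dig x.ap, x.kd % 10⟩

theorem mem_wedges_add {k d σ : ℕ} {x p : V4} (h : (x, σ) ∈ RCode.wedges ⟨k, zero, d⟩) :
    (add p x, σ) ∈ RCode.wedges ⟨k, p, d⟩ := by
  obtain ⟨w, hw, e⟩ := List.mem_map.1 h
  refine List.mem_map.2 ⟨w, hw, ?_⟩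
  simp only [Prod.mk.injEq] at e ⊢
  obtain ⟨rfl, rfl⟩ := e
  simp [add, zero]

/-- The tile with a given code. -/
noncomputable def cd (x : Code) : Tile := F.tile x.toRel

/-- The code of a tile of the tiling. -/
structure Wok (𝒯 : Set Tile) (x : Code) : Prop where
  kd : x.kd < 20
  bd : Roomy x.ap
  mem : F.cd x ∈ 𝒯

/-- The code of a tile of the tiling whose neighbors have codes, too. -/
structure Ok (𝒯 : Set Tile) (x : Code) : Prop where
  kd : x.kd < 20
  bd : inBounds x.ap = true
  mem : F.cd x ∈ 𝒯

variable {F} in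
theorem Ok.wok {x : Code} (h : F.Ok 𝒯 x) : F.Wok 𝒯 x := ⟨h.kd, roomy_of_inBounds h.bd, h.mem⟩

theorem cd_injective {x y : Code} (hx : x.kd < 20) (hy : y.kd < 20) (h : F.cd x = F.cd y) :
    x = y := by
  have h1 := F.tile_injective (c := x.toRel) (c' := y.toRel) (Nat.div_lt_of_lt_mul hx)
    (Nat.div_lt_of_lt_mul hy) (Nat.mod_lt _ (by norm_num)) (Nat.mod_lt _ (by norm_num)) h
  rcases x with ⟨a, b⟩
  rcases y with ⟨c, d⟩
  simp only [Code.toRel, RCode.mk.injEq] at h1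
  rw [Code.mk.injEq]
  exact ⟨by simp only at hx hy; omega, dig_injective h1.2.1⟩

theorem cd_relCode {x : Code} (hx : Roomy x.ap) {r : RCode}
    (hs : smallTest (rotn r.pos (x.kd % 10)) = true) :
    F.cd ⟨(relCode x.kd r).1, shift x.ap (relCode x.kd r).2⟩ = (F.sub x.toRel).tile r := by
  rw [sub_tile]
  simp only [cd, Code.toRel, relCode, dig_shift hx hs]
  congr 2 <;> omega

/-- If the masks meet, the tiles share a wedge and therefore coincide; then the two rows belong to
the same vertex of the same tile. -/
theorem overlap (h𝒯 : IsP2Tiling 𝒯) {x y : Code} (hx : F.Wok 𝒯 x) (hy : F.Wok 𝒯 y) {r r' : VRow}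
    (hr : r ∈ (row x.kd).vs) (hr' : r' ∈ (row y.kd).vs) (h : shift x.ap r.d = shift y.ap r'.d) :
    r.v &&& r'.m = 0 ∨ r.v &&& r'.m = r'.v ∧ r.v = r'.v := by
  obtain ⟨p, hp, hd, hs, hv, hinj, hall⟩ := row_vs_spec x.kd hx.kd r hr
  rcases hall y.kd hy.kd r' hr' with h0 | ⟨p', hp', hd', hs', σ, -, hw, hw'⟩
  · exact Or.inl h0
  · have h1 := congrArg dig h
    rw [hd, hd', dig_shift hx.bd hs, dig_shift hy.bd hs'] at h1
    have h2 := mem_wedges_add (p := dig x.ap) hw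
    have h3 := mem_wedges_add (p := dig y.ap) hw'
    rw [h1] at h2
    have h4 := F.eq_of_mem_wedges h𝒯 (c := x.toRel) (c' := y.toRel) (Nat.div_lt_of_lt_mul hx.kd)
      (Nat.div_lt_of_lt_mul hy.kd) hx.mem hy.mem h2 h3
    have h5 := F.cd_injective hx.kd hy.kd h4
    subst h5
    have h6 : r.d = r'.d := by
      have := hx.bd
      obtain ⟨a, b, c, d, -, -, e⟩ := enc_digits hs
      unfold Roomy at this
      unfold shift at h
      omega
    rw [← hinj r' hr' h6]
    exact Or.inr ⟨hv, rfl⟩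

theorem exists_opt (h𝒯 : IsP2Tiling 𝒯) {x : Code} (hx : x.kd < 20) (hp : Roomy x.ap)
    (hm : F.cd x ∈ 𝒯) {i : ℕ} (hi : i < 4) :
    ∃ o ∈ getD (row x.kd).os i, o.1 < 20 ∧ F.cd ⟨o.1, shift x.ap o.2⟩ ∈ 𝒯 := by
  obtain ⟨y, hy, e⟩ := row_os_spec x.kd hx i hi
  have hk : x.kd / 10 < 2 := Nat.div_lt_of_lt_mul hx
  obtain ⟨h1, h2⟩ := optRel_spec _ hk y hy
  have hself : (F.sub x.toRel).tile ⟨x.kd / 10, zero, 0⟩ = F.cd x := F.sub_self_tile x.toRel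
  have hedge := ((F.sub x.toRel).edges_tile hk _).2 ⟨_, h1, rfl⟩
  rw [hself] at hedge
  obtain ⟨t, ht, hne, hte⟩ := h𝒯.exists_neighbor hm hedge
  obtain ⟨r, hr, rfl⟩ := (F.sub x.toRel).mem_optRel h𝒯 hk (by rwa [hself]) ht (by rwa [hself]) hy hte
  obtain ⟨h3, h4, -, h5, -⟩ := h2 r hr
  refine ⟨relCode x.kd r, by rw [e]; exact List.mem_map_of_mem hr, by simp only [relCode]; omega, ?_⟩
  rw [F.cd_relCode hp (h5 _ (Nat.mod_lt _ (by norm_num)))]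
  exact ht

theorem roomy_opt {x : Code} (hx : x.kd < 20) (hp : inBounds x.ap = true) {i : ℕ} (hi : i < 4)
    {o : ℕ × ℕ} (ho : o ∈ getD (row x.kd).os i) : Roomy (shift x.ap o.2) := by
  obtain ⟨y, hy, e⟩ := row_os_spec x.kd hx i hi
  obtain ⟨-, h2⟩ := optRel_spec _ (Nat.div_lt_of_lt_mul hx) y hy
  rw [e] at ho
  obtain ⟨r, hr, rfl⟩ := List.mem_map.1 ho
  exact roomy_shift hp ((h2 r hr).2.2.2.1 _ (Nat.mod_lt _ (by norm_num)))

theorem adj_of_opt {x : Code} (hx : x.kd < 20) (hp : Roomy x.ap) {i : ℕ} (hi : i < 4) {o : ℕ × ℕ}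
    (ho : o ∈ getD (row x.kd).os i) : o.1 < 20 ∧ TileAdj (F.cd x) (F.cd ⟨o.1, shift x.ap o.2⟩) := by
  obtain ⟨y, hy, e⟩ := row_os_spec x.kd hx i hi
  have hk : x.kd / 10 < 2 := Nat.div_lt_of_lt_mul hx
  obtain ⟨h1, h2⟩ := optRel_spec _ hk y hy
  rw [e] at ho
  obtain ⟨r, hr, rfl⟩ := List.mem_map.1 ho
  obtain ⟨h3, h4, h5, h6, ⟨e', he', h7, h8⟩, -⟩ := h2 r hr
  have hself : (F.sub x.toRel).tile ⟨x.kd / 10, zero, 0⟩ = F.cd x := F.sub_self_tile x.toRel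
  rw [F.cd_relCode hp (h6 _ (Nat.mod_lt _ (by norm_num)))]
  refine ⟨by simp only [relCode]; omega, ?_, _, hself ▸ ((F.sub x.toRel).edges_tile hk _).2 ⟨_, h1, rfl⟩, ?_⟩
  · rw [← hself]
    intro h
    exact h5 ((F.sub x.toRel).tile_injective hk h3 (by norm_num) h4 h).symm
  · rw [← (F.sub x.toRel).sub_self_tile r, edges_tile _ h3]
    exact ⟨e', he', by rw [sub_pt _ r, sub_pt _ r, h7, h8]⟩

theorem exists_opt_of_adj (h𝒯 : IsP2Tiling 𝒯) {x : Code} (hx : x.kd < 20) (hp : Roomy x.ap)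
    (hm : F.cd x ∈ 𝒯) {t : Tile} (ht : t ∈ 𝒯) (h : TileAdj (F.cd x) t) :
    ∃ i < 4, ∃ o ∈ getD (row x.kd).os i, o.1 < 20 ∧ t = F.cd ⟨o.1, shift x.ap o.2⟩ := by
  have hk : x.kd / 10 < 2 := Nat.div_lt_of_lt_mul hx
  have hself : (F.sub x.toRel).tile ⟨x.kd / 10, zero, 0⟩ = F.cd x := F.sub_self_tile x.toRel
  obtain ⟨hne, e, he, het⟩ := h
  rw [← hself, edges_tile _ hk] at he
  obtain ⟨p, hp', rfl⟩ := he
  obtain ⟨y, hy, rfl⟩ := exists_of_mem_edgeRel _ hk p hp'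
  obtain ⟨r, hr, rfl⟩ := (F.sub x.toRel).mem_optRel h𝒯 hk (by rwa [hself]) ht
    (by rw [hself]; exact hne.symm) hy het
  obtain ⟨i, hi, hi'⟩ := row_os_spec' x.kd hx y hy
  obtain ⟨h3, h4, -, h5, -⟩ := (optRel_spec _ hk y hy).2 r hr
  refine ⟨i, hi, relCode x.kd r, by rw [hi']; exact List.mem_map_of_mem hr,
    by simp only [relCode]; omega, ?_⟩
  rw [F.cd_relCode hp (h5 _ (Nat.mod_lt _ (by norm_num)))]

theorem opt_unique (h𝒯 : IsP2Tiling 𝒯) {x : Code} (hx : x.kd < 20) (hp : Roomy x.ap) {i : ℕ}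
    (hi : i < 4) {o o' : ℕ × ℕ} (ho : o ∈ getD (row x.kd).os i) (ho' : o' ∈ getD (row x.kd).os i)
    (hm : F.cd ⟨o.1, shift x.ap o.2⟩ ∈ 𝒯) (hm' : F.cd ⟨o'.1, shift x.ap o'.2⟩ ∈ 𝒯) : o = o' := by
  obtain ⟨y, hy, e⟩ := row_os_spec x.kd hx i hi
  have hk : x.kd / 10 < 2 := Nat.div_lt_of_lt_mul hx
  obtain ⟨-, h2⟩ := optRel_spec _ hk y hy
  rw [e] at ho ho'
  obtain ⟨r, hr, rfl⟩ := List.mem_map.1 ho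
  obtain ⟨r', hr', rfl⟩ := List.mem_map.1 ho'
  obtain ⟨h3, h4, -, h6, -, h7⟩ := h2 r hr
  obtain ⟨h3', h4', -, h6', -, -⟩ := h2 r' hr'
  rw [F.cd_relCode hp (h6 _ (Nat.mod_lt _ (by norm_num)))] at hm
  rw [F.cd_relCode hp (h6' _ (Nat.mod_lt _ (by norm_num)))] at hm'
  rcases h7 r' hr' with rfl | ⟨w, hw, hw'⟩
  · rfl
  · rw [(F.sub x.toRel).tile_injective h3 h3' h4 h4'
      ((F.sub x.toRel).eq_of_mem_wedges h𝒯 h3 h3' hm hm' hw hw')]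

end Frame

/-! ### Soundness of the search -/

theorem sel_eq_true {b x y : Bool} :
    sel b x y = true ↔ (b = true ∧ x = true) ∨ (b = false ∧ y = true) := by
  cases b <;> simp [sel_eq]

theorem sel_beq {α : Sort*} (m n : ℕ) (x y : α) : sel (Nat.beq m n) x y = if m = n then x else y := by
  rw [sel_eq]; simp only [Nat.beq_eq]

theorem sel_ble {α : Sort*} (m n : ℕ) (x y : α) : sel (Nat.ble m n) x y = if m ≤ n then x else y := by
  rw [sel_eq]; simp only [Nat.ble_eq]

namespace Tr

theorem find_node (l r : Tr) (k w v : ℕ) : (node l k w r).find v =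
    if v = k then w else if v ≤ k then l.find v else r.find v := by
  rw [← sel_ble, ← sel_beq]
  rfl

theorem ins_node (l r : Tr) (u w v x : ℕ) (k : Tr → Bool) : (node l u w r).ins v x k =
    if v = u then k (.node l u (w ||| x) r) else if v ≤ u then l.ins v x fun l => k (.node l u w r)
    else r.ins v x fun r => k (.node l u w r) := by
  rw [← sel_ble, ← sel_beq, ← force_eq (w ||| x) fun w => k (.node l u w r)]
  rfl

theorem exists_of_ins (t : Tr) (v x : ℕ) (k : Tr → Bool) (h : t.ins v x k = true) :
    ∃ t', k t' = true ∧ ∀ u, t'.find u = if u = v then t.find u ||| x else t.find u := by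
  induction t generalizing k with
  | nil =>
    have h' : force x (fun x => k (.node .nil v x .nil)) = true := h
    rw [force_eq] at h'
    refine ⟨_, h', fun u => ?_⟩
    have h0 : ∀ u, Tr.nil.find u = 0 := fun _ => rfl
    rw [find_node, h0]
    by_cases huv : u = v <;> simp [huv]
  | node l a w r ihl ihr =>
    rw [ins_node] at h
    split_ifs at h with h1 h2
    · refine ⟨_, h, fun u => ?_⟩
      subst h1
      rw [find_node, find_node]
      split_ifs <;> rfl
    · obtain ⟨t', ht', hf⟩ := ihl _ h
      refine ⟨_, ht', fun u => ?_⟩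
      rw [find_node, find_node, hf]
      by_cases h3 : u = v
      · subst h3; simp [h1, h2]
      · simp [h3]
    · obtain ⟨t', ht', hf⟩ := ihr _ h
      refine ⟨_, ht', fun u => ?_⟩
      rw [find_node, find_node, hf]
      by_cases h3 : u = v
      · subst h3; simp [h1, h2]
      · simp [h3]

end Tr

theorem optsAll_eq_true (ap : ℕ) (l : List (ℕ × ℕ)) (k : Code → Bool) :
    optsAll ap l k = true ↔ ∀ o ∈ l, k ⟨o.1, shift ap o.2⟩ = true := by
  induction l with
  | nil => simp [optsAll]
  | cons o l ih =>
    change (mkOpt ap o k && optsAll ap l k) = true ↔ _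
    rw [Bool.and_eq_true, ih, mkOpt_eq]
    simp

theorem elem_eq_true (x : Code) (l : List Code) : elem x l = true ↔ x ∈ l := by
  induction l with
  | nil => simp [elem]
  | cons y l ih =>
    change (x.beq y || elem x l) = true ↔ _
    rw [Bool.or_eq_true, ih, Code.beq_iff, List.mem_cons]

theorem exists_of_without (x : Code) (l : List Code) (k : List Code → Bool)
    (h : without x l k = true) : ∃ l', (∀ y, y ∈ l' ↔ y ∈ l ∧ y ≠ x) ∧ k l' = true := by
  suffices ∀ (l r : List Code), (l.rec (fun r => k r) (fun y _ h r => sel (y.beq x) (h r) (h (y :: r))) r : Bool) = true →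
      ∃ l', (∀ y, y ∈ l' ↔ (y ∈ l ∧ y ≠ x) ∨ y ∈ r) ∧ k l' = true by
    obtain ⟨l', h1, h2⟩ := this l [] h
    exact ⟨l', by simpa using h1, h2⟩
  intro l
  induction l with
  | nil => intro r h; exact ⟨r, by simp, h⟩
  | cons a l ih =>
    intro r h
    rw [sel_eq_true] at h
    rcases h with ⟨h1, h2⟩ | ⟨h1, h2⟩
    · rw [Code.beq_iff] at h1
      obtain ⟨l', h3, h4⟩ := ih _ h2
      refine ⟨l', fun y => ?_, h4⟩
      rw [h3, List.mem_cons]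
      subst h1
      tauto
    · have h1' : a ≠ x := fun h => by rw [(Code.beq_iff a x).2 h] at h1; exact Bool.noConfusion h1
      obtain ⟨l', h3, h4⟩ := ih _ h2
      refine ⟨l', fun y => ?_, h4⟩
      rw [h3, List.mem_cons, List.mem_cons]
      constructor
      · rintro (h | rfl | h)
        · tauto
        · tauto
        · tauto
      · rintro (⟨rfl | h, h'⟩ | h)
        · tauto
        · tauto
        · tauto

theorem mem_os : ∀ kd < 20, (row kd).os = [getD (row kd).os 0, getD (row kd).os 1,
    getD (row kd).os 2, getD (row kd).os 3] := by decide +kernel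

theorem getD_pair : ∀ kd < 20, ∀ i < 4, ∃ a ∈ getD (row kd).os i, ∃ b ∈ getD (row kd).os i,
    getD (row kd).os i = [a, b] := by decide +kernel

namespace Frame

variable (F : Frame) {𝒯 : Set Tile}

/-- The occupied wedges recorded in `M` are those of tiles of the tiling, and so are the codes
in `L`. -/
structure Known (𝒯 : Set Tile) (M : Tr) (L : List Code) : Prop where
  inv : ∀ y, F.Wok 𝒯 y → ∀ r ∈ (row y.kd).vs,
    M.find (shift y.ap r.d) &&& r.m = 0 ∨ M.find (shift y.ap r.d) &&& r.m = r.v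
  ok : ∀ x ∈ L, F.Ok 𝒯 x

variable {F}

theorem known_nil : F.Known 𝒯 .nil [] :=
  ⟨fun _ _ _ _ => Or.inl (Nat.zero_and _), fun _ h => (List.not_mem_nil h).elim⟩

/-- This justifies discarding options with status 0: no tile of the tiling ever has it. -/
theorem Known.status_ne_zero {M : Tr} {L : List Code} (hM : F.Known 𝒯 M L) {x : Code}
    (hx : F.Wok 𝒯 x) : status M x ≠ 0 := by
  have key : ∀ l : List VRow, (∀ r ∈ l, M.find (shift x.ap r.d) &&& r.m = 0 ∨
      M.find (shift x.ap r.d) &&& r.m = r.v) → statusAux M x.ap l ≠ 0 := by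
    intro l
    induction l with
    | nil => intro _ h; exact Nat.one_ne_zero h
    | cons r l ih =>
      intro h
      have e : statusAux M x.ap (r :: l) = force (M.find (shift x.ap r.d) &&& r.m) fun y =>
        sel (Nat.beq y 0) (statusAux M x.ap l) (sel (Nat.beq y r.v) 2 0) := rfl
      rw [e, force_eq, sel_beq, sel_beq]
      split_ifs with h3 h4
      · exact ih fun r' hr' => h r' (List.mem_cons_of_mem _ hr')
      · norm_num
      · exact (h4 ((h r List.mem_cons_self).resolve_left h3)).elim
  exact key _ (hM.inv x hx)

/-- By `overlap`, the new bits either miss the mask of a given tile of the tiling or are exactly the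
entries of that tile. -/
theorem Known.put (h𝒯 : IsP2Tiling 𝒯) {M : Tr} {L : List Code} (hM : F.Known 𝒯 M L) {x : Code}
    (hx : F.Ok 𝒯 x) {k : Tr → Bool} (h : put M x k = true) :
    ∃ M', F.Known 𝒯 M' (x :: L) ∧ k M' = true := by
  have key : ∀ l : List VRow, l ⊆ (row x.kd).vs → ∀ M, F.Known 𝒯 M L → putAux x.ap l M k = true →
      ∃ M', F.Known 𝒯 M' L ∧ k M' = true := by
    intro l
    induction l with
    | nil => intro _ M hM h; exact ⟨M, hM, h⟩
    | cons r l ih =>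
      intro hl M hM h
      have e : putAux x.ap (r :: l) M k = force (shift x.ap r.d) fun v => M.ins v r.v fun M =>
        putAux x.ap l M k := rfl
      rw [e, force_eq] at h
      obtain ⟨M', h1, h2⟩ := Tr.exists_of_ins _ _ _ _ h
      refine ih (fun _ h => hl (List.mem_cons_of_mem _ h)) M' ⟨?_, hM.ok⟩ h1
      intro y hy r' hr'
      rw [h2]
      have h3 := hM.inv y hy r' hr'
      split_ifs with h4
      · rw [Nat.and_or_distrib_right]
        rcases F.overlap h𝒯 hx.wok hy (hl List.mem_cons_self) hr' h4.symm with h5 | ⟨h5, -⟩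
        · rw [h5, Nat.or_zero]; exact h3
        · rw [h5]
          right
          rcases h3 with h3 | h3 <;> rw [h3]
          · exact Nat.zero_or _
          · exact Nat.or_self _
      · exact h3
  obtain ⟨M', h1, h2⟩ := key _ (fun _ h => h) M hM h
  exact ⟨M', ⟨h1.inv, fun y hy => (List.mem_cons.1 hy).elim (fun e => e ▸ hx) (h1.ok y)⟩, h2⟩

theorem Known.addTile (h𝒯 : IsP2Tiling 𝒯) {M : Tr} {L : List Code} (hM : F.Known 𝒯 M L) {x : Code}
    (hx : x.kd < 20) (hm : F.cd x ∈ 𝒯) {k : Tr → List Code → Bool} (h : addTile M L x k = true) :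
    F.Ok 𝒯 x ∧ ∃ M' L', F.Known 𝒯 M' L' ∧ k M' L' = true := by
  rw [PenroseP2.addTile, sel_eq_true] at h
  rcases h with ⟨hb, h⟩ | ⟨_, h⟩
  · have hok : F.Ok 𝒯 x := ⟨hx, hb, hm⟩
    refine ⟨hok, ?_⟩
    have h0 := hM.status_ne_zero hok.wok
    rw [sel_eq_true, sel_eq_true] at h
    rcases h with ⟨h1, -⟩ | ⟨-, ⟨-, h⟩ | ⟨-, h⟩⟩
    · exact (h0 (Nat.eq_of_beq_eq_true h1)).elim
    · exact ⟨M, L, hM, h⟩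
    · obtain ⟨M', h1, h2⟩ := hM.put h𝒯 hok h
      exact ⟨M', _, h1, h2⟩
  · exact Bool.noConfusion h

theorem Known.addNbr (h𝒯 : IsP2Tiling 𝒯) {M : Tr} {L : List Code} (hM : F.Known 𝒯 M L) {t : Code}
    (ht : F.Ok 𝒯 t) {i : ℕ} (hi : i < 4) {k : Tr → List Code → Code → Bool}
    (h : addNbr M L t i k = true) :
    ∃ M' L', ∃ o ∈ getD (row t.kd).os i, F.Known 𝒯 M' L' ∧ F.Ok 𝒯 ⟨o.1, shift t.ap o.2⟩ ∧
      k M' L' ⟨o.1, shift t.ap o.2⟩ = true := by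
  rw [PenroseP2.addNbr, addNbrL, optsAll_eq_true] at h
  obtain ⟨o, ho, h1, h2⟩ := F.exists_opt h𝒯 ht.kd (roomy_of_inBounds ht.bd) ht.mem hi
  obtain ⟨h3, M', L', h4, h5⟩ := hM.addTile h𝒯 h1 h2 (h o ho)
  exact ⟨M', L', o, ho, h4, h3, h5⟩

variable (F) in
/-- The neighbors of a tile of the tiling. -/
structure Nbrs (𝒯 : Set Tile) (t : Code) (nb : List Code) : Prop where
  ok : ∀ x ∈ nb, F.Ok 𝒯 x ∧ TileAdj (F.cd t) (F.cd x)
  mem : ∀ s ∈ 𝒯, TileAdj (F.cd t) s → ∃ x ∈ nb, F.cd x = s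
  nodup : nb.Nodup

theorem shift_injective {p : ℕ} (hp : Roomy p) {e e' : ℕ} (h : shift p e = shift p e') : e = e' := by
  unfold shift at h
  unfold Roomy at hp
  omega

theorem Known.addNbrs (h𝒯 : IsP2Tiling 𝒯) {M : Tr} {L : List Code} (hM : F.Known 𝒯 M L) {t : Code}
    (ht : F.Ok 𝒯 t) {k : Tr → List Code → List Code → Bool} (h : addNbrs M L t k = true) :
    ∃ M' L' nb, F.Known 𝒯 M' L' ∧ F.Nbrs 𝒯 t nb ∧ k M' L' nb = true := by
  have hr := roomy_of_inBounds ht.bd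
  obtain ⟨M, L, o0, i0, hM, k0, h⟩ := hM.addNbr h𝒯 ht (by norm_num) h
  obtain ⟨M, L, o1, i1, hM, k1, h⟩ := hM.addNbr h𝒯 ht (by norm_num) h
  obtain ⟨M, L, o2, i2, hM, k2, h⟩ := hM.addNbr h𝒯 ht (by norm_num) h
  obtain ⟨M, L, o3, i3, hM, k3, h⟩ := hM.addNbr h𝒯 ht (by norm_num) h
  refine ⟨M, L, _, hM, ⟨?_, ?_, ?_⟩, h⟩
  · simp only [List.mem_cons, List.not_mem_nil, or_false, forall_eq_or_imp, forall_eq]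
    exact ⟨⟨k0, (F.adj_of_opt ht.kd hr (by norm_num) i0).2⟩,
      ⟨k1, (F.adj_of_opt ht.kd hr (by norm_num) i1).2⟩,
      ⟨k2, (F.adj_of_opt ht.kd hr (by norm_num) i2).2⟩,
      ⟨k3, (F.adj_of_opt ht.kd hr (by norm_num) i3).2⟩⟩
  · intro s hs hadj
    obtain ⟨i, hi, o, ho, -, rfl⟩ := F.exists_opt_of_adj h𝒯 ht.kd hr ht.mem hs hadj
    simp only [List.mem_cons, List.not_mem_nil, or_false, exists_eq_or_imp, exists_eq_left]
    interval_cases i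
    · left; rw [F.opt_unique h𝒯 ht.kd hr hi i0 ho k0.mem hs]
    · right; left; rw [F.opt_unique h𝒯 ht.kd hr hi i1 ho k1.mem hs]
    · right; right; left; rw [F.opt_unique h𝒯 ht.kd hr hi i2 ho k2.mem hs]
    · right; right; right; rw [F.opt_unique h𝒯 ht.kd hr hi i3 ho k3.mem hs]
  · have key : ∀ i < 4, ∀ j < 4, i ≠ j → ∀ o ∈ getD (row t.kd).os i, ∀ o' ∈ getD (row t.kd).os j,
        (⟨o.1, shift t.ap o.2⟩ : Code) ≠ ⟨o'.1, shift t.ap o'.2⟩ := by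
      intro i hi j hj hij o ho o' ho' e
      rw [Code.mk.injEq] at e
      have e2 := shift_injective hr e.2
      have : o = o' := Prod.ext e.1 e2
      exact row_os_disjoint t.kd ht.kd i hi j hj hij o ho (this ▸ ho')
    simp only [List.nodup_cons, List.mem_cons, List.not_mem_nil, or_false, not_or, not_false_eq_true,
      List.nodup_nil, and_true]
    exact ⟨⟨key 0 (by norm_num) 1 (by norm_num) (by norm_num) _ i0 _ i1,
      key 0 (by norm_num) 2 (by norm_num) (by norm_num) _ i0 _ i2,
      key 0 (by norm_num) 3 (by norm_num) (by norm_num) _ i0 _ i3⟩,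
      ⟨key 1 (by norm_num) 2 (by norm_num) (by norm_num) _ i1 _ i2,
      key 1 (by norm_num) 3 (by norm_num) (by norm_num) _ i1 _ i3⟩,
      key 2 (by norm_num) 3 (by norm_num) (by norm_num) _ i2 _ i3⟩

/-- One of the two options across an edge is in the tiling and does not have status 0. If the other
one has, the first is known without branching. -/
theorem Known.unitPass (h𝒯 : IsP2Tiling 𝒯) {M : Tr} {L : List Code} (hM : F.Known 𝒯 M L)
    {ts : List Code} (hts : ∀ t ∈ ts, F.Ok 𝒯 t) {k : Tr → List Code → Bool}
    (h : unitPass M L ts k = true) : ∃ M' L', F.Known 𝒯 M' L' ∧ k M' L' = true := by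
  have one : ∀ {M L} (_ : F.Known 𝒯 M L) {t : Code} (_ : F.Ok 𝒯 t) {i : ℕ} (_ : i < 4)
      {k : Tr → List Code → Bool}, unitOpts M L t.ap (getD (row t.kd).os i) k = true →
      ∃ M' L', F.Known 𝒯 M' L' ∧ k M' L' = true := by
    intro M L hM t ht i hi k h
    obtain ⟨o, ho, h1, h2⟩ := F.exists_opt h𝒯 ht.kd (roomy_of_inBounds ht.bd) ht.mem hi
    obtain ⟨a, -, b, -, e⟩ := getD_pair t.kd ht.kd i hi
    rw [e] at h ho
    simp only [unitOpts, mkOpt_eq, force_eq, sel_eq_true, Bool.and_eq_true, Nat.beq_eq] at h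
    have hroom := roomy_opt ht.kd ht.bd hi (o := o) (by rw [e]; exact ho)
    have hs := hM.status_ne_zero (x := ⟨o.1, shift t.ap o.2⟩) { kd := h1, bd := hroom, mem := h2 }
    have fin : inBounds (shift t.ap o.2) = true → PenroseP2.put M ⟨o.1, shift t.ap o.2⟩
        (fun M => k M (⟨o.1, shift t.ap o.2⟩ :: L)) = true →
        ∃ M' L', F.Known 𝒯 M' L' ∧ k M' L' = true := by
      intro h3 h4
      obtain ⟨M', h5, h6⟩ := hM.put h𝒯 (x := ⟨o.1, shift t.ap o.2⟩) { kd := h1, bd := h3, mem := h2 } h4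
      exact ⟨M', _, h5, h6⟩
    simp only [List.mem_cons, List.not_mem_nil, or_false] at ho
    rcases h with ⟨-, h⟩ | ⟨-, ⟨-, h⟩ | ⟨-, ⟨h3, ⟨h4, -⟩ | ⟨-, h4, h⟩⟩ | ⟨-, ⟨h3, h4, h⟩ | ⟨-, h⟩⟩⟩⟩
    · exact ⟨M, L, hM, h⟩
    · exact ⟨M, L, hM, h⟩
    · rcases ho with rfl | rfl
      · exact (hs h3).elim
      · exact (hs h4).elim
    · rcases ho with rfl | rfl
      · exact (hs h3).elim
      · exact fin h4 h
    · rcases ho with rfl | rfl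
      · exact fin h4 h
      · exact (hs h3).elim
    · exact ⟨M, L, hM, h⟩
  have edges : ∀ {t : Code} (_ : F.Ok 𝒯 t) (os : List (List (ℕ × ℕ))),
      (∀ l ∈ os, ∃ i < 4, l = getD (row t.kd).os i) → ∀ {M L} (_ : F.Known 𝒯 M L)
      {k : Tr → List Code → Bool}, unitEdges M L t.ap os k = true →
      ∃ M' L', F.Known 𝒯 M' L' ∧ k M' L' = true := by
    intro t ht os
    induction os with
    | nil => intro _ M L hM k h; exact ⟨M, L, hM, h⟩
    | cons l os ih =>
      intro hos M L hM k h
      have e : unitEdges M L t.ap (l :: os) k = unitOpts M L t.ap l fun M L =>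
        unitEdges M L t.ap os k := rfl
      obtain ⟨i, hi, rfl⟩ := hos l List.mem_cons_self
      rw [e] at h
      obtain ⟨M', L', hM', h'⟩ := one hM ht hi h
      exact ih (fun l hl => hos l (List.mem_cons_of_mem _ hl)) hM' h'
  induction ts generalizing M L with
  | nil => exact ⟨M, L, hM, h⟩
  | cons t ts ih =>
    have e : PenroseP2.unitPass M L (t :: ts) k = unitEdges M L t.ap (row t.kd).os fun M L =>
      PenroseP2.unitPass M L ts k := rfl
    rw [e] at h
    have ht := hts t List.mem_cons_self
    obtain ⟨M', L', hM', h'⟩ := edges ht _ (fun l hl => by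
      rw [mem_os t.kd ht.kd] at hl
      simp only [List.mem_cons, List.not_mem_nil, or_false] at hl
      rcases hl with rfl | rfl | rfl | rfl
      · exact ⟨0, by norm_num, rfl⟩
      · exact ⟨1, by norm_num, rfl⟩
      · exact ⟨2, by norm_num, rfl⟩
      · exact ⟨3, by norm_num, rfl⟩) hM h
    exact ih hM' (fun x hx => hts x (List.mem_cons_of_mem _ hx)) h'

theorem Known.addTiles (h𝒯 : IsP2Tiling 𝒯) {M : Tr} {L : List Code} (hM : F.Known 𝒯 M L)
    {l : List Code} (hl : ∀ x ∈ l, x.kd < 20 ∧ F.cd x ∈ 𝒯) {k : Tr → List Code → Bool}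
    (h : addTiles M L l k = true) :
    (∀ x ∈ l, F.Ok 𝒯 x) ∧ ∃ M' L', F.Known 𝒯 M' L' ∧ k M' L' = true := by
  induction l generalizing M L with
  | nil => exact ⟨fun _ h => (List.not_mem_nil h).elim, M, L, hM, h⟩
  | cons x l ih =>
    have e : PenroseP2.addTiles M L (x :: l) k = force x.ap fun ap => force x.kd fun kd =>
      PenroseP2.addTile M L ⟨kd, ap⟩ fun M L => PenroseP2.addTiles M L l k := rfl
    rw [e, force_eq, force_eq] at h
    have hx := hl x List.mem_cons_self
    obtain ⟨h1, M', L', hM', h'⟩ := hM.addTile h𝒯 hx.1 hx.2 h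
    obtain ⟨h2, h3⟩ := ih hM' (fun y hy => hl y (List.mem_cons_of_mem _ hy)) h'
    exact ⟨fun y hy => (List.mem_cons.1 hy).elim (fun e => e ▸ h1) (h2 y), h3⟩

theorem Known.addStar (h𝒯 : IsP2Tiling 𝒯) {M : Tr} {L : List Code} (hM : F.Known 𝒯 M L)
    {s : Bool} {d v : ℕ} (hl : ∀ x ∈ stars s d v, x.kd < 20 ∧ F.cd x ∈ 𝒯)
    {k : Tr → List Code → Bool} (h : addStar M L s d v k = true) :
    (∀ x ∈ stars s d v, F.Ok 𝒯 x) ∧ ∃ M' L', F.Known 𝒯 M' L' ∧ k M' L' = true := by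
  obtain ⟨h1, M', L', hM', h'⟩ := hM.addTiles h𝒯 hl h
  exact ⟨h1, hM'.unitPass h𝒯 h1 h'⟩

end Frame

/-! ### Subtrees and the missing neighbor of an inner tile -/

/-- Any two members of `S` are joined by a path in `S`. -/
def Linked (S : Set Tile) : Prop :=
  ∀ a ∈ S, ∀ b ∈ S, Relation.ReflTransGen (fun s t => t ∈ S ∧ TileAdj s t) a b

/-- No member of `U` outside a connected subset of `U` has two neighbors in it. -/
def NoCycle (U : Set Tile) : Prop :=
  ∀ S ⊆ U, Linked S → ∀ y ∈ U, y ∉ S → ∀ a ∈ S, ∀ b ∈ S, TileAdj y a → TileAdj y b → a = b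

theorem linked_singleton (s : Tile) : Linked {s} := by
  rintro a rfl b rfl
  exact .refl

theorem Linked.insert {S : Set Tile} (hS : Linked S) {p x : Tile} (hp : p ∈ S) (h : TileAdj p x) :
    Linked (Insert.insert x S) := by
  have h1 : ∀ a ∈ S, ∀ b ∈ S,
      Relation.ReflTransGen (fun s t => t ∈ Insert.insert x S ∧ TileAdj s t) a b := fun a ha b hb =>
    (Relation.ReflTransGen.mono fun _ _ h => ⟨Set.mem_insert_of_mem _ h.1, h.2⟩ : _ ≤ _) _ _
      (hS a ha b hb)
  have h2 : Relation.ReflTransGen (fun s t => t ∈ Insert.insert x S ∧ TileAdj s t) p x :=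
    .single ⟨Set.mem_insert _ _, h⟩
  have h3 : Relation.ReflTransGen (fun s t => t ∈ Insert.insert x S ∧ TileAdj s t) x p :=
    .single ⟨Set.mem_insert_of_mem _ hp, h.symm⟩
  rintro a (rfl | ha) b (rfl | hb)
  · exact .refl
  · exact h3.trans (h1 p hp b hb)
  · exact (h1 a ha p hp).trans h2
  · exact h1 a ha b hb

/-- All neighbors of `s` but one are members of `C`. -/
def Internal (𝒯 C : Set Tile) (s : Tile) : Prop :=
  ∃ t ∈ 𝒯, TileAdj s t ∧ t ∉ C ∧ ∀ t' ∈ 𝒯, TileAdj s t' → t' ≠ t → t' ∈ C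

namespace Frame

variable (F : Frame) {𝒯 U : Set Tile}

/-- The list `T` consists of codes of tiles that form a subtree of `U`. -/
structure Tree (𝒯 U : Set Tile) (T : List Code) : Prop where
  ok : ∀ x ∈ T, F.Ok 𝒯 x ∧ F.cd x ∈ U
  linked : Linked (F.cd '' {x | x ∈ T})

variable {F}

theorem touches_eq_true {x p : Code} {T : List Code} (hx : F.Ok 𝒯 x) (h : touches x p T = true) :
    ∃ y ∈ T, y ≠ p ∧ TileAdj (F.cd x) (F.cd y) := by
  rw [touches, Bool.not_eq_true', List.all_eq_false] at h
  obtain ⟨l, hl, h⟩ := h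
  have h0 : ∃ i < 4, l = getD (row x.kd).os i := by
    rw [mem_os x.kd hx.kd] at hl
    simp only [List.mem_cons, List.not_mem_nil, or_false] at hl
    rcases hl with rfl | rfl | rfl | rfl
    · exact ⟨0, by norm_num, rfl⟩
    · exact ⟨1, by norm_num, rfl⟩
    · exact ⟨2, by norm_num, rfl⟩
    · exact ⟨3, by norm_num, rfl⟩
  obtain ⟨i, hi, rfl⟩ := h0
  rw [optsAll_eq_true] at h
  push Not at h
  obtain ⟨o, ho, h⟩ := h
  rw [ne_eq, Bool.not_eq_true, Bool.or_eq_false_iff, Bool.not_eq_false', elem_eq_true] at h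
  refine ⟨_, h.2, fun e => ?_, (F.adj_of_opt hx.kd (roomy_of_inBounds hx.bd) hi ho).2⟩
  rw [(Code.beq_iff _ _).2 e] at h
  exact Bool.noConfusion h.1

theorem Tree.not_mem {T : List Code} (hT : F.Tree 𝒯 U T) {x : Code} (hx : F.Ok 𝒯 x) (h : x ∉ T) :
    F.cd x ∉ F.cd '' {x | x ∈ T} := by
  rintro ⟨y, hy, e⟩
  exact h (F.cd_injective (hT.ok y hy).1.kd hx.kd e ▸ hy)

/-- A tile of `U` outside a subtree does not touch two of its members. -/
theorem Tree.touches_eq_false (hU : NoCycle U) {T N : List Code} (hT : F.Tree 𝒯 U T) (hN : N ⊆ T)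
    {x p : Code} (hx : F.Ok 𝒯 x) (hxU : F.cd x ∈ U) (hxT : x ∉ T) (hp : p ∈ T)
    (h : TileAdj (F.cd p) (F.cd x)) : touches x p N = false := by
  rw [← Bool.not_eq_true]
  intro h1
  obtain ⟨y, hy, hne, hadj⟩ := touches_eq_true hx h1
  have h2 := hU _ (by rintro _ ⟨z, hz, rfl⟩; exact (hT.ok z hz).2) hT.linked _ hxU
    (hT.not_mem hx hxT) _ ⟨y, hN hy, rfl⟩ _ ⟨p, hp, rfl⟩ hadj h.symm
  exact hne (F.cd_injective (hT.ok y (hN hy)).1.kd (hT.ok p hp).1.kd h2)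

theorem Tree.cons {T : List Code} (hT : F.Tree 𝒯 U T) {p x : Code} (hx : F.Ok 𝒯 x)
    (hxU : F.cd x ∈ U) (hp : p ∈ T) (h : TileAdj (F.cd p) (F.cd x)) : F.Tree 𝒯 U (x :: T) := by
  refine ⟨fun y hy => (List.mem_cons.1 hy).elim (fun e => e ▸ ⟨hx, hxU⟩) (hT.ok y), ?_⟩
  have : F.cd '' {y | y ∈ x :: T} = Insert.insert (F.cd x) (F.cd '' {y | y ∈ T}) := by
    rw [← Set.image_insert_eq]
    congr 1
    ext y
    simp
  rw [this]
  exact hT.linked.insert ⟨p, hp, rfl⟩ h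

/-- The list `N` contains the tiles whose contact with a new one is tested. In `pick` it starts
empty, since `split` has dealt with the older tiles; a call with `N = T` tests them as well. -/
theorem Tree.addTs (hU : NoCycle U) {T N : List Code} (hT : F.Tree 𝒯 U T) (hN : N ⊆ T) {p : Code}
    (hp : p ∈ T) {l : List Code}
    (hl : ∀ x ∈ l, F.Ok 𝒯 x ∧ F.cd x ∈ U ∧ TileAdj (F.cd p) (F.cd x)) {k : List Code → Bool}
    (h : addTs T N p l k = true) : ∃ T', F.Tree 𝒯 U T' ∧ T ⊆ T' ∧ l ⊆ T' ∧ k T' = true := by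
  induction l generalizing T N with
  | nil => exact ⟨T, hT, fun _ h => h, List.nil_subset _, h⟩
  | cons x l ih =>
    have e : PenroseP2.addTs T N p (x :: l) k = (elem x T && PenroseP2.addTs T N p l k ||
      !elem x T && (touches x p N || PenroseP2.addTs (x :: T) (x :: N) p l k)) := rfl
    rw [e, Bool.or_eq_true, Bool.and_eq_true, Bool.and_eq_true, elem_eq_true, Bool.not_eq_true',
      ← Bool.not_eq_true, elem_eq_true, Bool.or_eq_true] at h
    have hl' : ∀ y ∈ l, F.Ok 𝒯 y ∧ F.cd y ∈ U ∧ TileAdj (F.cd p) (F.cd y) := fun y hy =>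
      hl y (List.mem_cons_of_mem _ hy)
    obtain ⟨h1, h2, h3⟩ := hl x List.mem_cons_self
    rcases h with ⟨h4, h⟩ | ⟨h4, h5 | h⟩
    · obtain ⟨T', hT', hs, hs', hk⟩ := ih hT hN hp hl' h
      exact ⟨T', hT', hs, List.cons_subset.2 ⟨hs h4, hs'⟩, hk⟩
    · rw [hT.touches_eq_false hU hN h1 h2 h4 hp h3] at h5
      exact Bool.noConfusion h5
    · obtain ⟨T', hT', hs, hs', hk⟩ := ih (hT.cons h1 h2 hp h3) (List.cons_subset_cons _ hN)
        (List.mem_cons_of_mem _ hp) hl' h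
      exact ⟨T', hT', fun y hy => hs (List.mem_cons_of_mem _ hy),
        List.cons_subset.2 ⟨hs List.mem_cons_self, hs'⟩, hk⟩

theorem exists_of_split {T : List Code} {p prev : Code} {l : List Code}
    {k : List Code → List Code → Bool} (hl : l.Nodup) (h : split T p prev l k = true) :
    ∃ g b, (∀ x, x ∈ l ∧ x ≠ prev ↔ x ∈ g ∨ x ∈ b) ∧ (∀ x ∈ b, x ∉ T ∧ touches x p T = true) ∧
      (∀ x ∈ g, ¬(x ∉ T ∧ touches x p T = true)) ∧ b.Nodup ∧ k g b = true := by
  suffices ∀ (l g₀ b₀ : List Code), l.Nodup → b₀.Nodup → (∀ x ∈ b₀, x ∉ l) →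
      (∀ x ∈ b₀, x ∉ T ∧ touches x p T = true) → (∀ x ∈ g₀, ¬(x ∉ T ∧ touches x p T = true)) →
      (l.rec (fun g b => k g b) (fun x _ h g b => sel (x.beq prev) (h g b)
        (sel (elem x T) (h (x :: g) b) (sel (touches x p T) (h g (x :: b)) (h (x :: g) b)))) g₀ b₀
          : Bool) = true →
      ∃ g b, (∀ x, (x ∈ l ∧ x ≠ prev) ∨ x ∈ g₀ ∨ x ∈ b₀ ↔ x ∈ g ∨ x ∈ b) ∧
        (∀ x ∈ b, x ∉ T ∧ touches x p T = true) ∧ (∀ x ∈ g, ¬(x ∉ T ∧ touches x p T = true)) ∧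
        b.Nodup ∧ k g b = true by
    obtain ⟨g, b, h1, h2⟩ := this l [] [] hl List.nodup_nil (by simp) (by simp) (by simp) h
    exact ⟨g, b, by simpa using h1, h2⟩
  intro l
  induction l with
  | nil => intro g b _ hb _ hb' hg' h; exact ⟨g, b, by simp, hb', hg', hb, h⟩
  | cons a l ih =>
    intro g b hl hb hdis hb' hg' h
    rw [List.nodup_cons] at hl
    have hdis' : ∀ x ∈ b, x ∉ l := fun x hx h => hdis x hx (List.mem_cons_of_mem _ h)
    rw [sel_eq_true, sel_eq_true, sel_eq_true, Code.beq_iff, elem_eq_true, ← Bool.not_eq_true,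
      Code.beq_iff, ← Bool.not_eq_true, elem_eq_true, ← Bool.not_eq_true] at h
    have tail : ∀ {g' b' : List Code}, (∀ x, (x ∈ l ∧ x ≠ prev) ∨ x ∈ g' ∨ x ∈ b' ↔
        (x ∈ a :: l ∧ x ≠ prev) ∨ x ∈ g ∨ x ∈ b) →
        (∃ g'' b'', (∀ x, (x ∈ l ∧ x ≠ prev) ∨ x ∈ g' ∨ x ∈ b' ↔ x ∈ g'' ∨ x ∈ b'') ∧
          (∀ x ∈ b'', x ∉ T ∧ touches x p T = true) ∧
          (∀ x ∈ g'', ¬(x ∉ T ∧ touches x p T = true)) ∧ b''.Nodup ∧ k g'' b'' = true) →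
        ∃ g'' b'', (∀ x, (x ∈ a :: l ∧ x ≠ prev) ∨ x ∈ g ∨ x ∈ b ↔ x ∈ g'' ∨ x ∈ b'') ∧
          (∀ x ∈ b'', x ∉ T ∧ touches x p T = true) ∧
          (∀ x ∈ g'', ¬(x ∉ T ∧ touches x p T = true)) ∧ b''.Nodup ∧ k g'' b'' = true := by
      rintro g' b' h1 ⟨g'', b'', h2, h3⟩
      exact ⟨g'', b'', fun x => (h1 x).symm.trans (h2 x), h3⟩
    rcases h with ⟨rfl, h⟩ | ⟨hne, ⟨h1, h⟩ | ⟨h1, ⟨h2, h⟩ | ⟨h2, h⟩⟩⟩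
    · refine tail (fun x => ?_) (ih g b hl.2 hb hdis' hb' hg' h)
      rw [List.mem_cons]; tauto
    · refine tail (fun x => ?_) (ih (a :: g) b hl.2 hb hdis' hb'
        (fun x hx => (List.mem_cons.1 hx).elim (fun e => e ▸ fun h' => h'.1 h1) (hg' x)) h)
      rw [List.mem_cons, List.mem_cons]
      by_cases hx : x = a
      · subst hx; tauto
      · tauto
    · refine tail (fun x => ?_) (ih g (a :: b) hl.2 (List.nodup_cons.2
        ⟨fun h' => hdis a h' List.mem_cons_self, hb⟩) ?_ ?_ hg' h)
      · rw [List.mem_cons, List.mem_cons]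
        by_cases hx : x = a
        · subst hx; tauto
        · tauto
      · exact fun x hx => (List.mem_cons.1 hx).elim (fun e => e ▸ hl.1) (hdis' x)
      · exact fun x hx => (List.mem_cons.1 hx).elim (fun e => e ▸ ⟨h1, h2⟩) (hb' x)
    · refine tail (fun x => ?_) (ih (a :: g) b hl.2 hb hdis' hb'
        (fun x hx => (List.mem_cons.1 hx).elim (fun e => e ▸ fun h' => h2 h'.2) (hg' x)) h)
      rw [List.mem_cons, List.mem_cons]
      by_cases hx : x = a
      · subst hx; tauto
      · tauto

/-- The codes of the neighbors of `p` other than `prev` that belong to `C`. -/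
structure Next (F : Frame) (𝒯 C : Set Tile) (prev p : Code) (inc : List Code) : Prop where
  ok : ∀ x ∈ inc, F.Ok 𝒯 x ∧ F.cd x ∈ C ∧ TileAdj (F.cd p) (F.cd x) ∧ x ≠ prev
  mem : ∀ s ∈ C, TileAdj (F.cd p) s → (∀ x, F.cd x = s → x ≠ prev) → ∃ x ∈ inc, F.cd x = s

theorem Tree.pick {C : Set Tile} (hU : NoCycle U) (hCU : C ⊆ U) (hC : C ⊆ 𝒯) {T : List Code}
    (hT : F.Tree 𝒯 U T) {p prev : Code} (hp : p ∈ T) (hprev : F.Ok 𝒯 prev → F.cd prev ∈ C)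
    (hint : Internal 𝒯 C (F.cd p)) {nb : List Code} (hnb : F.Nbrs 𝒯 p nb)
    {k : List Code → List Code → Bool} (h : pick T p prev nb k = true) :
    ∃ T' inc, F.Tree 𝒯 U T' ∧ T ⊆ T' ∧ inc ⊆ T' ∧ F.Next 𝒯 C prev p inc ∧ k T' inc = true := by
  obtain ⟨s, hs, hps, hsC, hall⟩ := hint
  obtain ⟨ex, hex, rfl⟩ := hnb.mem s hs hps
  have hexprev : ex ≠ prev := by
    rintro rfl
    exact hsC (hprev (hnb.ok _ hex).1)
  have hmemC : ∀ x ∈ nb, F.cd x ∈ C ↔ x ≠ ex := by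
    intro x hx
    constructor
    · rintro h rfl; exact hsC h
    · intro h
      exact hall _ (hnb.ok x hx).1.mem (hnb.ok x hx).2 fun e =>
        h (F.cd_injective (hnb.ok x hx).1.kd (hnb.ok ex hex).1.kd e)
  obtain ⟨g, b, h1, h2, h2', h3, h⟩ := exists_of_split hnb.nodup h
  have hb : ∀ x ∈ b, x = ex := by
    intro x hx
    obtain ⟨hxn, -⟩ := (h1 x).2 (Or.inr hx)
    by_contra hne
    have h4 := hT.touches_eq_false hU (fun _ h => h) (hnb.ok x hxn).1
      (hCU ((hmemC x hxn).2 hne)) (h2 x hx).1 hp (hnb.ok x hxn).2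
    rw [(h2 x hx).2] at h4
    exact Bool.noConfusion h4
  have fin : ∀ inc : List Code, (∀ x, x ∈ inc ↔ (x ∈ nb ∧ x ≠ prev) ∧ x ≠ ex) →
      PenroseP2.addTs T [] p inc (fun T => k T inc) = true →
      ∃ T' inc, F.Tree 𝒯 U T' ∧ T ⊆ T' ∧ inc ⊆ T' ∧ F.Next 𝒯 C prev p inc ∧ k T' inc = true := by
    intro inc hinc hk
    have h5 : ∀ x ∈ inc, F.Ok 𝒯 x ∧ F.cd x ∈ C ∧ TileAdj (F.cd p) (F.cd x) ∧ x ≠ prev := by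
      intro x hx
      obtain ⟨⟨h6, h7⟩, h8⟩ := (hinc x).1 hx
      exact ⟨(hnb.ok x h6).1, (hmemC x h6).2 h8, (hnb.ok x h6).2, h7⟩
    obtain ⟨T', hT', h6, h7, h8⟩ := hT.addTs hU (List.nil_subset _) hp
      (fun x hx => ⟨(h5 x hx).1, hCU (h5 x hx).2.1, (h5 x hx).2.2.1⟩) hk
    refine ⟨T', inc, hT', h6, h7, ⟨h5, ?_⟩, h8⟩
    intro s hs hadj hne
    obtain ⟨x, hx, rfl⟩ := hnb.mem s (hC hs) hadj
    exact ⟨x, (hinc x).2 ⟨⟨hx, hne x rfl⟩, (hmemC x hx).1 hs⟩, rfl⟩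
  rcases b with _ | ⟨x, _ | ⟨y, b⟩⟩
  · have h' : (g.all fun x => without x g fun inc => PenroseP2.addTs T [] p inc fun T => k T inc) = true := h
    have hg : ex ∈ g := ((h1 ex).1 ⟨hex, hexprev⟩).elim id fun h => (List.not_mem_nil h).elim
    obtain ⟨inc, h6, h7⟩ := exists_of_without _ _ _ (List.all_eq_true.1 h' ex hg)
    refine fin inc (fun x => ?_) h7
    rw [h6, h1]
    simp
  · have h' : PenroseP2.addTs T [] p g (fun T => k T g) = true := h
    have hx := hb x List.mem_cons_self
    subst hx
    refine fin g (fun y => ?_) h'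
    rw [h1, List.mem_singleton]
    constructor
    · intro hy
      refine ⟨Or.inl hy, ?_⟩
      rintro rfl
      exact h2' _ hy (h2 _ List.mem_cons_self)
    · rintro ⟨h | h, hne⟩
      · exact h
      · exact (hne h).elim
  · rw [hb x List.mem_cons_self, hb y (List.mem_cons_of_mem _ List.mem_cons_self)] at h3
    simp at h3

theorem Known.visit {C : Set Tile} (h𝒯 : IsP2Tiling 𝒯) (hU : NoCycle U) (hCU : C ⊆ U) (hC : C ⊆ 𝒯)
    {M : Tr} {L T : List Code} (hM : F.Known 𝒯 M L) (hT : F.Tree 𝒯 U T) {p prev : Code}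
    (hp : p ∈ T) (hprev : F.Ok 𝒯 prev → F.cd prev ∈ C) (hint : Internal 𝒯 C (F.cd p))
    {k : Tr → List Code → List Code → List Code → Bool} (h : visit M L T prev p k = true) :
    ∃ M' L' T' inc, F.Known 𝒯 M' L' ∧ F.Tree 𝒯 U T' ∧ T ⊆ T' ∧ inc ⊆ T' ∧
      F.Next 𝒯 C prev p inc ∧ k M' L' T' inc = true := by
  obtain ⟨M, L, nb, hM, hnb, h⟩ := hM.addNbrs h𝒯 (hT.ok p hp).1 h
  obtain ⟨M, L, hM, h⟩ := hM.unitPass h𝒯 (fun t ht => (hnb.ok t ht).1) h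
  obtain ⟨T', inc, h1, h2, h3, h4, h5⟩ := hT.pick hU hCU hC hp hprev hint hnb h
  exact ⟨M, L, T', inc, hM, h1, h2, h3, h4, h5⟩

end Frame

/-! ### The searches -/

theorem searchRing_kite : searchRing ⟨0, P0⟩ ringGoal = true := by decide +kernel

theorem searchRing_dart : searchRing ⟨10, P0⟩ ringGoal = true := by decide +kernel

theorem searchNext_eq : searchNext = true := by decide +kernel

theorem searchCloseStars_eq : searchCloseStars = true := by decide +kernel

theorem searchStar_eq : searchStar 1 2 = true ∧ searchStar 2 3 = true ∧ searchStar 3 4 = true ∧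
    searchStar 4 5 = true ∧ searchStar 5 6 = true ∧ searchStar 6 5 = true :=
  ⟨by decide +kernel, by decide +kernel, by decide +kernel, by decide +kernel, by decide +kernel,
    by decide +kernel⟩

theorem searchEndStar_eq : searchEndStar 6 5 = true ∧ searchEndStar 1 2 = true :=
  ⟨by decide +kernel, by decide +kernel⟩

/-! ### Caterpillars in a tiling -/

/-- The chain `p 0, …, p 7` of the inner tiles of a prime caterpillar `C`. -/
structure Spine (𝒯 C : Set Tile) (p : ℕ → Tile) : Prop where
  subset : C ⊆ 𝒯
  mem : ∀ i < 8, p i ∈ C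
  internal : ∀ i < 8, Internal 𝒯 C (p i)
  adj : ∀ i < 7, TileAdj (p i) (p (i + 1))
  ne : ∀ i < 6, p i ≠ p (i + 2)
  near : ∀ c ∈ C, ∃ i < 8, c = p i ∨ TileAdj (p i) c

namespace V4

theorem val_conj {η : Circle} (h : IsTurn η) (x : V4) : val η⁻¹ x = val η x.conj := by
  have h0 := h.coe_inv
  have h1 := h.inv.sq
  have h2 := h.inv.cube
  simp only [val, V4.conj, h1, h2]
  simp only [h0, h.sq, h.cube]
  have := coe_goldenRatio_sq
  generalize (φ : ℂ) = p at *
  push_cast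
  linear_combination (x.c + x.d : ℂ) * this

theorem val_phi2 {η : Circle} (h : IsTurn η) (k : ℕ) : val η (phi2 k) = (φ + 1) * η ^ k := by
  rw [phi2, val_add, val_ph h, val_pw h]; ring

end V4

/-- The code can be placed in any position. -/
noncomputable def placeable (c : RCode) : Bool :=
  decide (c.kind < 2) && decide (c.dir ≤ 30) &&
    (List.range 10).all fun d => smallTest (rotn c.pos d) && smallTest (rotn c.pos.conj d)

theorem placeable_ringRel : ∀ j < 11, placeable (ringRel j) = true := by decide +kernel

theorem placeable_starRel : ∀ i < 5, placeable (starRel i) = true := by decide +kernel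

namespace Frame

variable (F : Frame) {𝒯 U C : Set Tile}

/-- The frame with respect to which codes are placed by `place`. -/
noncomputable def placed (s : Bool) (d v : ℕ) : Frame where
  o := F.pt (dig v)
  u := F.u * F.η ^ d
  η := if s then F.η else F.η⁻¹
  turn := by
    split_ifs
    · exact F.turn
    · exact F.turn.inv

theorem cd_place (s : Bool) {d v : ℕ} (hv : Roomy v) (hd : d < 10) {c : RCode}
    (hc : placeable c = true) :
    (place s d v c).kd < 20 ∧ F.cd (place s d v c) = (F.placed s d v).tile c := by
  simp only [placeable, Bool.and_eq_true, decide_eq_true_eq, List.all_eq_true, List.mem_range] at hc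
  obtain ⟨⟨h1, h2⟩, h3⟩ := hc
  obtain ⟨h4, h5⟩ := h3 d hd
  cases s
  · have e : place false d v c = ⟨c.kind * 10 + (d + 30 - c.dir) % 10, shift v (enc (rotn c.pos.conj d))⟩ := rfl
    rw [e]
    refine ⟨by simp only; omega, ?_⟩
    have e1 : (c.kind * 10 + (d + 30 - c.dir) % 10) / 10 = c.kind := by omega
    have e2 : (c.kind * 10 + (d + 30 - c.dir) % 10) % 10 = (d + 30 - c.dir) % 10 := by omega
    simp only [cd, Code.toRel, tile, pt, placed, dig_shift hv h5, e1, e2, dir_mod, Bool.false_eq_true,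
      if_false, val_conj F.turn, val_add, val_rotn F.turn]
    rw [Tile.mk.injEq]
    refine ⟨rfl, by push_cast; ring, ?_⟩
    rw [mul_assoc, inv_pow, mul_right_inj, eq_mul_inv_iff_mul_eq, ← pow_add]
    have e3 : d + 30 - c.dir + c.dir = d + 10 * 3 := by omega
    rw [e3, pow_add, pow_mul, F.turn.pow_ten, one_pow, mul_one]
  · have e : place true d v c = ⟨c.kind * 10 + (c.dir + d) % 10, shift v (enc (rotn c.pos d))⟩ := rfl
    rw [e]
    refine ⟨by simp only; omega, ?_⟩
    have e1 : (c.kind * 10 + (c.dir + d) % 10) / 10 = c.kind := by omega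
    have e2 : (c.kind * 10 + (c.dir + d) % 10) % 10 = (c.dir + d) % 10 := by omega
    simp only [cd, Code.toRel, tile, pt, placed, dig_shift hv h4, e1, e2, dir_mod,
      if_true, val_add, val_rotn F.turn]
    rw [Tile.mk.injEq]
    refine ⟨rfl, by push_cast; ring, ?_⟩
    rw [mul_assoc, ← pow_add, add_comm d]

theorem dig_P0 : dig P0 = zero := by decide +kernel

theorem inBounds_P0 : inBounds P0 = true := by decide +kernel

theorem placed_self : F.placed true 0 P0 = F := by
  simp [placed, dig_P0, pt, val_zero]

/-- The star with center at the origin belongs to the tiling. -/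
def Star (𝒯 : Set Tile) : Prop := ∀ i < 5, F.tile (starRel i) ∈ 𝒯

variable {F}

theorem Star.stars {s : Bool} {d v : ℕ} (hd : d < 10) (hv : Roomy v)
    (h : (F.placed s d v).Star 𝒯) : ∀ x ∈ stars s d v, x.kd < 20 ∧ F.cd x ∈ 𝒯 := by
  intro x hx
  have h1 : ∀ i ∈ [0, 1, 2, 3, 4], i < 5 := by decide
  obtain ⟨i, hi, rfl⟩ := List.mem_map.1 hx
  obtain ⟨h2, h3⟩ := F.cd_place s hv hd (placeable_starRel i (h1 i hi))
  exact ⟨h2, h3 ▸ h i (h1 i hi)⟩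

theorem Star.withRing (h𝒯 : IsP2Tiling 𝒯) (h : F.Star 𝒯) {k : Tr → List Code → Bool}
    (hk : withRing k = true) : ∃ M L, F.Known 𝒯 M L ∧ k M L = true :=
  (known_nil.addStar h𝒯 (Star.stars (by norm_num) (roomy_of_inBounds inBounds_P0)
    (F.placed_self.symm ▸ h)) hk).2

theorem star_of_turn (h𝒯 : IsP2Tiling 𝒯) (ho : IsStarCenter 𝒯 F.o) (h : ⟨.dart, F.o, F.u⟩ ∈ 𝒯) :
    F.Star 𝒯 := by
  intro i _
  have := ho.mem_of_turn h𝒯 F.turn h i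
  simpa [tile, starRel, pt, val_zero, kindOf] using this

theorem Next.exists_code {prev p : Code} {inc : List Code} (h : F.Next 𝒯 C prev p inc) {s : Tile}
    (hs : s ∈ C) (hadj : TileAdj (F.cd p) s) (hne : s ≠ F.cd prev) :
    ∃ x ∈ inc, F.Ok 𝒯 x ∧ F.cd x = s := by
  obtain ⟨x, hx, rfl⟩ := h.mem s hs hadj fun x e e' => hne (by rw [← e, e'])
  exact ⟨x, hx, (h.ok x hx).1, rfl⟩

theorem tree_singleton {x : Code} (hx : F.Ok 𝒯 x) (hU : F.cd x ∈ U) : F.Tree 𝒯 U [x] := by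
  refine ⟨fun y hy => by rw [List.mem_singleton.1 hy]; exact ⟨hx, hU⟩, ?_⟩
  have : F.cd '' {y | y ∈ [x]} = {F.cd x} := by
    simp
  rw [this]
  exact linked_singleton _

end Frame

/-- The mirror image of a frame. -/
noncomputable def Frame.mirror (F : Frame) : Frame := ⟨F.o, F.u, F.η⁻¹, F.turn.inv⟩

/-- Reflection in the axis of a tile exchanges the first two edges with the last two, so a frame of
suitable handedness puts a given edge among the first two. -/
theorem edgeRel_conj : ∀ k < 2, ∀ e ∈ edgeRel k,
    e ∈ (edgeRel k).take 2 ∨ (e.1.conj, e.2.conj) ∈ (edgeRel k).take 2 := by decide +kernel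

theorem row_os_left : ∀ k < 2, ∀ e ∈ (edgeRel k).take 2, ∃ x ∈ (edgeRel k).zip (optRel k), x.1 = e ∧
    ∃ i < 2, getD (row (k * 10)).os i = x.2.map (relCode (k * 10)) := by decide +kernel

/-- Two adjacent tiles in a frame adapted to them. -/
theorem exists_frame_left {𝒯 : Set Tile} (h𝒯 : IsP2Tiling 𝒯) {s t : Tile} (hs : s ∈ 𝒯) (ht : t ∈ 𝒯)
    (h : TileAdj s t) : ∃ (F : Frame) (k : ℕ), k < 2 ∧ F.cd ⟨k * 10, P0⟩ = s ∧ ∃ i < 2,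
      ∃ o ∈ getD (row (k * 10)).os i, o.1 < 20 ∧ t = F.cd ⟨o.1, shift P0 o.2⟩ := by
  obtain ⟨hne, e, he, het⟩ := h
  obtain ⟨k, hk, hks⟩ : ∃ k < 2, kindOf k = s.kind := by
    rcases s with ⟨_ | _, A, w⟩
    · exact ⟨0, by norm_num, rfl⟩
    · exact ⟨1, by norm_num, rfl⟩
  have key : ∀ F : Frame, F.o = s.apex → F.u = s.dir → (∃ p ∈ (edgeRel k).take 2, e = (F.pt p.1, F.pt p.2)) →
      ∃ (F : Frame) (k : ℕ), k < 2 ∧ F.cd ⟨k * 10, P0⟩ = s ∧ ∃ i < 2,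
      ∃ o ∈ getD (row (k * 10)).os i, o.1 < 20 ∧ t = F.cd ⟨o.1, shift P0 o.2⟩ := by
    rintro F ho hu ⟨p, hp, rfl⟩
    have h0 : F.tile ⟨k, zero, 0⟩ = s := by
      rcases s with ⟨K, A, w⟩
      simp only at ho hu hks
      simp [Frame.tile, Frame.pt, val_zero, ho, hu, hks]
    have e1 : k * 10 / 10 = k := by omega
    have e2 : k * 10 % 10 = 0 := by omega
    have h1 : F.cd ⟨k * 10, P0⟩ = s := by
      rw [← h0, Frame.cd, Code.toRel]
      simp only [Frame.dig_P0, e1, e2]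
    obtain ⟨x, hx, rfl, i, hi, hi'⟩ := row_os_left k hk p hp
    obtain ⟨r, hr, rfl⟩ := F.mem_optRel h𝒯 hk (h0.symm ▸ hs) ht (h0.symm ▸ hne.symm) hx het
    obtain ⟨h3, h4, -, h5, -⟩ := (optRel_spec _ hk x hx).2 r hr
    refine ⟨F, k, hk, h1, i, hi, _, by rw [hi']; exact List.mem_map_of_mem hr,
      by simp only [relCode]; omega, ?_⟩
    rw [F.cd_relCode (x := ⟨k * 10, P0⟩) (roomy_of_inBounds Frame.inBounds_P0)
      (h5 _ (Nat.mod_lt _ (by norm_num)))]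
    simp only [Code.toRel, Frame.dig_P0, e1, e2, Frame.sub_tile]
    have e3 : rotn r.pos 0 = r.pos := rfl
    have e4 : add zero r.pos = r.pos := by simp [add, zero]
    rw [e3, e4, add_zero, Frame.tile_mod]
  obtain ⟨F, ho, hu⟩ : ∃ F : Frame, F.o = s.apex ∧ F.u = s.dir := ⟨⟨_, _, _, isTurn_exp⟩, rfl, rfl⟩
  have h0 : F.tile ⟨k, zero, 0⟩ = s := by
    rcases s with ⟨K, A, w⟩
    simp only at ho hu hks
    simp [Frame.tile, Frame.pt, val_zero, ho, hu, hks]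
  rw [← h0, F.edges_tile hk] at he
  obtain ⟨p, hp, rfl⟩ := he
  rcases edgeRel_conj k hk p hp with h1 | h1
  · exact key F ho hu ⟨p, h1, rfl⟩
  · refine key F.mirror ho hu ⟨_, h1, ?_⟩
    have : ∀ x, F.mirror.pt x.conj = F.pt x := by
      intro x
      simp only [Frame.pt, Frame.mirror]
      rw [← val_conj F.turn.inv, inv_inv]
    rw [this, this]

theorem matchRing_true : ∀ {s : Bool} {d v j : ℕ} {l : List Code}, matchRing s d v j l = true →
    ∀ i x, l[i]? = some x → x = place s d v (ringRel (j + i)) := by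
  intro s d v j l
  induction l generalizing j with
  | nil => intro _ i x h; simp at h
  | cons y l ih =>
    intro h i x hx
    have e : matchRing s d v j (y :: l) = (y.beq (place s d v (ringRel j)) && matchRing s d v (j + 1) l) := rfl
    rw [e, Bool.and_eq_true, Code.beq_iff] at h
    rcases i with _ | i
    · simp at hx; rw [← hx]; exact h.1
    · have := ih h.2 i x (by simpa using hx)
      rw [this]; congr 2; omega

theorem smallTest_phi2 : ∀ k < 20, smallTest (phi2 k) = true := by decide +kernel

theorem ringGoal_sound {𝒯 : Set Tile} {F : Frame} {L path : List Code} (hL : ∀ x ∈ L, F.Ok 𝒯 x)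
    (hp : ∀ x ∈ path, F.Ok 𝒯 x) (h : ringGoal L path = true) :
    ∃ R : Frame, R.Star 𝒯 ∧ ∀ i < 6, ∀ x, path[i]? = some x → F.cd x = R.tile (ringRel (1 + i)) := by
  rcases path with _ | ⟨p, path⟩
  · exact Bool.noConfusion h
  have e : ringGoal L (p :: path) = (Nat.ble p.kd 9 && [true, false].any fun s =>
      force (shift p.ap (enc (phi2 (sel s (p.kd + 9) (p.kd + 1))))) fun v =>
      force ((sel s (p.kd + 2) (p.kd + 8)) % 10) fun d =>
      matchRing s d v 1 (p :: path) && (stars s d v).all fun x => elem x L) := rfl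
  rw [e, Bool.and_eq_true, Nat.ble_eq, List.any_eq_true] at h
  obtain ⟨h1, s, -, h⟩ := h
  rw [force_eq, force_eq, Bool.and_eq_true, List.all_eq_true] at h
  have hroom : Roomy (shift p.ap (enc (phi2 (sel s (p.kd + 9) (p.kd + 1))))) :=
    roomy_shift (hp p List.mem_cons_self).bd (smallTest_phi2 _ (by
      cases s
      · change p.kd + 1 < 20; omega
      · change p.kd + 9 < 20; omega))
  generalize shift p.ap (enc (phi2 (sel s (p.kd + 9) (p.kd + 1)))) = v at *
  have hd : (sel s (p.kd + 2) (p.kd + 8)) % 10 < 10 := Nat.mod_lt _ (by norm_num)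
  generalize (sel s (p.kd + 2) (p.kd + 8)) % 10 = d at *
  refine ⟨F.placed s d v, ?_, ?_⟩
  · intro i hi
    have h3 : i ∈ [0, 1, 2, 3, 4] := by interval_cases i <;> simp
    have := h.2 _ (List.mem_map_of_mem h3)
    rw [elem_eq_true] at this
    rw [← (F.cd_place s hroom hd (placeable_starRel i hi)).2]
    exact (hL _ this).mem
  · intro i hi x hx
    rw [matchRing_true h.1 i x hx, (F.cd_place s hroom hd (placeable_ringRel _ (by omega))).2]

/-- Six consecutive tiles of the spine surround a star. -/
theorem Spine.exists_ring {𝒯 C : Set Tile} (h𝒯 : IsP2Tiling 𝒯) (hC : NoCycle C) {p : ℕ → Tile}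
    (hp : Spine 𝒯 C p) : ∃ R : Frame, R.Star 𝒯 ∧ ∀ j, 1 ≤ j → j ≤ 6 → p j = R.tile (ringRel j) := by
  have hm : ∀ i < 8, p i ∈ 𝒯 := fun i hi => hp.subset (hp.mem i hi)
  obtain ⟨F, k, hk, e1, i, hi, o, ho, ho20, e2⟩ := exists_frame_left h𝒯 (hm 1 (by norm_num))
    (hm 2 (by norm_num)) (hp.adj 1 (by norm_num))
  have hsearch : searchRing ⟨k * 10, P0⟩ ringGoal = true := by
    interval_cases k
    · exact searchRing_kite
    · exact searchRing_dart
  generalize hx1 : (⟨k * 10, P0⟩ : Code) = x1 at *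
  have hx1ok : F.Ok 𝒯 x1 := ⟨by rw [← hx1]; simp only; omega, by rw [← hx1]; exact Frame.inBounds_P0,
    e1 ▸ hm 1 (by norm_num)⟩
  rw [searchRing] at hsearch
  have hM : F.Known 𝒯 .nil [] := Frame.known_nil
  obtain ⟨M, hM, h⟩ := hM.put h𝒯 hx1ok hsearch
  have hT := Frame.tree_singleton (U := C) hx1ok (e1 ▸ hp.mem 1 (by norm_num))
  have step : ∀ {M L T} (_ : F.Known 𝒯 M L) (_ : F.Tree 𝒯 C T) {b : ℕ} {x y : Code} (_ : y ∈ T)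
      (_ : F.Ok 𝒯 x → F.cd x ∈ C) (_ : b < 8) (_ : F.cd y = p b) {k}, visit M L T x y k = true →
      ∃ M' L' T' inc, F.Known 𝒯 M' L' ∧ F.Tree 𝒯 C T' ∧ T ⊆ T' ∧ inc ⊆ T' ∧
      F.Next 𝒯 C x y inc ∧ k M' L' T' inc = true := by
    intro M L T hM hT b x y hy hx hb e k h
    exact hM.visit h𝒯 hC subset_rfl hp.subset hT hy hx (e ▸ hp.internal b hb) h
  -- The dummy predecessor is no code of a tile, so both chain neighbors of the first tile remain
  -- among its candidates.
  have hdummy : ¬ F.Ok 𝒯 ⟨0, 0⟩ := fun h => by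
    have := h.bd
    revert this
    decide
  obtain ⟨M, L, T, i1, hM, hT, hs1, hi1, hn1, h⟩ := step hM hT List.mem_cons_self
    (fun h => (hdummy h).elim) (by norm_num) e1 h
  have hne0 : ∀ b < 8, TileAdj (p 1) (p b) → ∃ x ∈ i1, F.Ok 𝒯 x ∧ F.cd x = p b := by
    intro b hb hadj
    obtain ⟨x, hx, e⟩ := hn1.mem (p b) (hp.mem b hb) (e1.symm ▸ hadj) (by
      rintro x hx rfl
      obtain ⟨i, hi, o, ho, h20, e⟩ := F.exists_opt_of_adj h𝒯 hx1ok.kd (roomy_of_inBounds hx1ok.bd)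
        hx1ok.mem (hm b hb) (e1.symm ▸ hadj)
      have h3 := F.cd_injective (by norm_num) h20 (hx.trans e)
      have h4 := Frame.roomy_opt hx1ok.kd hx1ok.bd hi ho
      rw [Code.mk.injEq] at h3
      rw [← h3.2, Roomy] at h4
      omega)
    exact ⟨x, hx, (hn1.ok x hx).1, e⟩
  obtain ⟨x2, hx2, k2, c2⟩ := hne0 2 (by norm_num) (hp.adj 1 (by norm_num))
  obtain ⟨x0, hx0, k0, c0⟩ := hne0 0 (by norm_num) (hp.adj 0 (by norm_num)).symm
  have h := List.all_eq_true.1 h x2 hx2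
  have hleft : acrossLeft x1 x2 = true := by
    have h3 : x2 = ⟨o.1, shift x1.ap o.2⟩ := F.cd_injective k2.kd ho20 (by rw [c2, e2, ← hx1])
    have h4 : ∀ j, (!optsAll x1.ap (getD (row x1.kd).os j) fun y => !x2.beq y) = true ↔
        ∃ o ∈ getD (row x1.kd).os j, x2 = ⟨o.1, shift x1.ap o.2⟩ := by
      intro j
      rw [Bool.not_eq_true', ← Bool.not_eq_true, optsAll_eq_true]
      push Not
      simp only [ne_eq, Bool.not_eq_true, Bool.not_eq_false', Code.beq_iff]
    rw [acrossLeft, Bool.or_eq_true, h4, h4]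
    rw [← hx1] at h3 ⊢
    interval_cases i
    · exact Or.inl ⟨o, ho, h3⟩
    · exact Or.inr ⟨o, ho, h3⟩
  rw [hleft, Bool.not_true, Bool.false_or] at h
  obtain ⟨M, L, T, i2, hM, hT, hs2, hi2, hn2, h⟩ := step hM hT (hi1 hx2)
    (fun _ => e1 ▸ hp.mem 1 (by norm_num)) (by norm_num) c2 h
  obtain ⟨x3, hx3, k3, c3⟩ := hn2.exists_code (hp.mem 3 (by norm_num))
    (c2.symm ▸ hp.adj 2 (by norm_num)) (by rw [e1]; exact (hp.ne 1 (by norm_num)).symm)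
  have h := List.all_eq_true.1 h x3 hx3
  obtain ⟨M, L, T, i3, hM, hT, hs3, hi3, hn3, h⟩ := step hM hT (hi2 hx3)
    (fun _ => c2 ▸ hp.mem 2 (by norm_num)) (by norm_num) c3 h
  obtain ⟨x4, hx4, k4, c4⟩ := hn3.exists_code (hp.mem 4 (by norm_num))
    (c3.symm ▸ hp.adj 3 (by norm_num)) (by rw [c2]; exact (hp.ne 2 (by norm_num)).symm)
  have h := List.all_eq_true.1 h x4 hx4
  obtain ⟨M, L, T, i4, hM, hT, hs4, hi4, hn4, h⟩ := step hM hT (hi3 hx4)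
    (fun _ => c3 ▸ hp.mem 3 (by norm_num)) (by norm_num) c4 h
  obtain ⟨x5, hx5, k5, c5⟩ := hn4.exists_code (hp.mem 5 (by norm_num))
    (c4.symm ▸ hp.adj 4 (by norm_num)) (by rw [c3]; exact (hp.ne 3 (by norm_num)).symm)
  have h := List.all_eq_true.1 h x5 hx5
  obtain ⟨M, L, T, i5, hM, hT, hs5, hi5, hn5, h⟩ := step hM hT (hi4 hx5)
    (fun _ => c4 ▸ hp.mem 4 (by norm_num)) (by norm_num) c5 h
  obtain ⟨x6, hx6, k6, c6⟩ := hn5.exists_code (hp.mem 6 (by norm_num))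
    (c5.symm ▸ hp.adj 5 (by norm_num)) (by rw [c4]; exact (hp.ne 4 (by norm_num)).symm)
  have h := List.all_eq_true.1 h x6 hx6
  have fin : ∀ {M L}, F.Known 𝒯 M L → ringGoal L [x1, x2, x3, x4, x5, x6] = true →
      ∃ R : Frame, R.Star 𝒯 ∧ ∀ j, 1 ≤ j → j ≤ 6 → p j = R.tile (ringRel j) := by
    intro M L hM h
    obtain ⟨R, h1, h2⟩ := ringGoal_sound hM.ok (by
      intro x hx
      simp only [List.mem_cons, List.not_mem_nil, or_false] at hx
      rcases hx with rfl | rfl | rfl | rfl | rfl | rfl <;> assumption) h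
    refine ⟨R, h1, fun j hj hj' => ?_⟩
    interval_cases j
    · rw [← e1]; exact h2 0 (by norm_num) _ rfl
    · rw [← c2]; exact h2 1 (by norm_num) _ rfl
    · rw [← c3]; exact h2 2 (by norm_num) _ rfl
    · rw [← c4]; exact h2 3 (by norm_num) _ rfl
    · rw [← c5]; exact h2 4 (by norm_num) _ rfl
    · rw [← c6]; exact h2 5 (by norm_num) _ rfl
  rw [Bool.or_eq_true] at h
  rcases h with h | h
  · exact fin hM h
  obtain ⟨M, L, T, i6, hM, hT, hs6, hi6, hn6, h⟩ := step hM hT (hi5 hx6)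
    (fun _ => c5 ▸ hp.mem 5 (by norm_num)) (by norm_num) c6 h
  obtain ⟨x7, hx7, k7, c7⟩ := hn6.exists_code (hp.mem 7 (by norm_num))
    (c6.symm ▸ hp.adj 6 (by norm_num)) (by rw [c5]; exact (hp.ne 5 (by norm_num)).symm)
  obtain ⟨j1, hj1, h⟩ := exists_of_without _ _ _ h
  have h := List.all_eq_true.1 h x0 ((hj1 x0).2 ⟨hx0, fun e => hp.ne 0 (by norm_num) (by rw [← c0, ← c2, e])⟩)
  obtain ⟨M, L, T, _, hM, hT, hs0, -, -, h⟩ := step hM hT (hs6 (hs5 (hs4 (hs3 (hs2 (hi1 hx0))))))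
    (fun _ => e1 ▸ hp.mem 1 (by norm_num)) (by norm_num) c0 h
  have h := List.all_eq_true.1 h x7 hx7
  obtain ⟨M, L, T, _, hM, hT, -, -, -, h⟩ := step hM hT (hs0 (hi6 hx7))
    (fun _ => c6 ▸ hp.mem 6 (by norm_num)) (by norm_num) c7 h
  exact fin hM h

/-! ### Stars adjacent to a caterpillar -/

/-- The displacement of two stars that are close to each other. -/
def nearDisp : V4 := ⟨3, 1, 2, -1⟩

theorem smallTest_nearDisp : smallTest nearDisp = true ∧ ∀ k < 10, smallTest (rotn nearDisp k) = true ∧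
    smallTest (rotn nearDisp.conj k) = true := by decide +kernel

/-- Two stars of the same orientation are not displaced by `nearDisp`. -/
theorem no_near_star {𝒯 : Set Tile} (h𝒯 : IsP2Tiling 𝒯) {F : Frame} (h : F.Star 𝒯)
    (h' : ∀ i < 5, F.tile ⟨1, nearDisp, 2 * i⟩ ∈ 𝒯) : False := by
  have hsearch := searchCloseStars_eq
  rw [searchCloseStars] at hsearch
  obtain ⟨M, L, hM, hs⟩ := h.withRing h𝒯 hsearch
  have hs : addStar M L true 0 (shift P0 (enc nearDisp)) (fun M L =>
    addNbr M L (place true 0 P0 (starRel 0)) 2 fun M L x => addNbr M L x 0 fun M L _ =>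
    unitPass M L L fun M L => unitPass M L L fun M L => unitPass M L L fun M L =>
    unitPass M L L fun _ _ => false) = true := (force_eq _ _).symm.trans hs
  have hroom : Roomy (shift P0 (enc nearDisp)) := roomy_shift Frame.inBounds_P0 smallTest_nearDisp.1
  obtain ⟨-, M, L, hM, hs⟩ := hM.addStar h𝒯 (Frame.Star.stars (s := true) (d := 0) (by norm_num) hroom (by
    intro i hi
    have := h' i hi
    have e : dig (shift P0 (enc nearDisp)) = nearDisp := by decide +kernel
    simpa [Frame.tile, starRel, Frame.placed, e, Frame.pt, val_zero] using this)) hs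
  have h0 : F.Ok 𝒯 (place true 0 P0 (starRel 0)) := by
    obtain ⟨h1, h2⟩ := F.cd_place true (d := 0) (roomy_of_inBounds Frame.inBounds_P0) (by norm_num)
      (placeable_starRel 0 (by norm_num))
    rw [F.placed_self] at h2
    exact ⟨h1, by decide +kernel, h2 ▸ h 0 (by norm_num)⟩
  obtain ⟨M, L, o, -, hM, hx, hs⟩ := hM.addNbr h𝒯 h0 (by norm_num) hs
  obtain ⟨M, L, o, -, hM, -, hs⟩ := hM.addNbr h𝒯 hx (by norm_num) hs
  obtain ⟨M, L, hM, hs⟩ := hM.unitPass h𝒯 hM.ok hs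
  obtain ⟨M, L, hM, hs⟩ := hM.unitPass h𝒯 hM.ok hs
  obtain ⟨M, L, hM, hs⟩ := hM.unitPass h𝒯 hM.ok hs
  obtain ⟨M, L, hM, hs⟩ := hM.unitPass h𝒯 hM.ok hs
  exact Bool.noConfusion hs

theorem Frame.Star.mem {𝒯 : Set Tile} {R : Frame} (h : R.Star 𝒯) (i : ℕ) :
    ⟨.dart, R.o, R.u * R.η ^ (2 * i)⟩ ∈ 𝒯 := by
  have h1 := h (i % 5) (Nat.mod_lt _ (by norm_num))
  have e : R.η ^ (2 * i) = R.η ^ (2 * (i % 5)) := by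
    rw [← Nat.mod_add_div i 5, mul_add, pow_add, ← mul_assoc, pow_mul R.η (2 * 5) (i / 5)]
    simp [R.turn.pow_ten]
  rw [e]
  simpa [Frame.tile, starRel, Frame.pt, val_zero, kindOf] using h1

/-- The tile `s` is the option of one branch of the probe. If its apex were another star center, the
search would leave only a displacement equivalent to `nearDisp`, contradicting `no_near_star`. -/
theorem Frame.Known.probe {𝒯 : Set Tile} (h𝒯 : IsP2Tiling 𝒯) {F : Frame} (hF : F.Star 𝒯)
    {M : Tr} {L : List Code}
    (hM : F.Known 𝒯 M L) {c : Code} (hc : F.Ok 𝒯 c) (h : probe M L c = true) {s : Tile} (hs : s ∈ 𝒯)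
    (hadj : TileAdj (F.cd c) s) (hk : s.kind = .dart) (hw : IsStarCenter 𝒯 s.apex) :
    s.apex = F.o := by
  obtain ⟨i, hi, o, ho, -, rfl⟩ := F.exists_opt_of_adj h𝒯 hc.kd (roomy_of_inBounds hc.bd) hc.mem hs hadj
  rw [PenroseP2.probe, List.all_eq_true] at h
  have hi' : i ∈ [0, 1, 2, 3] := by interval_cases i <;> simp
  obtain ⟨M, L, o', ho', hM, hx, h⟩ := hM.addNbr h𝒯 hc hi (h i hi')
  have e := F.opt_unique h𝒯 hc.kd (roomy_of_inBounds hc.bd) hi ho ho' hs hx.mem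
  subst e
  generalize (⟨o.1, shift c.ap o.2⟩ : Code) = x at *
  have hkd : 10 ≤ x.kd := by
    by_contra! hlt
    have e : x.kd / 10 = 0 := Nat.div_eq_of_lt hlt
    simp [Frame.cd, Frame.tile, Code.toRel, e, kindOf] at hk
  rw [Bool.or_eq_true, Bool.or_eq_true, Nat.ble_eq, Nat.beq_eq] at h
  have hapex : (F.cd x).apex = F.pt (dig x.ap) := rfl
  have hdart : F.cd x = ⟨.dart, F.pt (dig x.ap), F.u * F.η ^ (x.kd % 10)⟩ := by
    have : x.kd / 10 = 1 := by have := hx.kd; omega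
    simp [Frame.cd, Frame.tile, Code.toRel, this, kindOf]
  rcases h with (h | h) | h
  · omega
  · rw [hapex, h, Frame.dig_P0, Frame.pt, val_zero, mul_zero, add_zero]
  exfalso
  rw [hapex] at hw
  rw [hdart] at hs
  have hd : x.kd % 10 < 10 := Nat.mod_lt _ (by norm_num)
  obtain ⟨-, M, L, hM, h⟩ := hM.addStar h𝒯 (Frame.Star.stars hd (roomy_of_inBounds hx.bd)
    (Frame.star_of_turn h𝒯 hw hs)) h
  rw [Bool.and_eq_true, Nat.beq_eq, Bool.or_eq_true, elem_eq_true, elem_eq_true] at h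
  obtain ⟨h1, h2⟩ := h
  -- a frame with respect to which the other star is displaced by `nearDisp`
  have fin : ∀ (b : Bool) (k : ℕ), k < 10 → k % 2 = 0 →
      F.pt (dig x.ap) = (F.placed b k P0).pt nearDisp → False := by
    intro b k hk hk2 e
    have hd2 : (x.kd % 10) % 2 = 0 := by omega
    have ho : (F.placed b k P0).o = F.o := by
      simp [Frame.placed, Frame.dig_P0, Frame.pt, val_zero]
    refine no_near_star h𝒯 (F := F.placed b k P0) ?_ ?_
    · intro i _
      have e3 : (F.placed b k P0).tile (starRel i) = ⟨.dart, F.o, (F.placed b k P0).u *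
          (F.placed b k P0).η ^ (2 * i)⟩ := by
        rw [← ho]
        simp [Frame.tile, starRel, Frame.pt, val_zero, kindOf]
      rw [e3]
      cases b
      -- In the reflected frame the turn is inverted, and `η⁻¹ ^ (2 * i) = η ^ (2 * (4 * i))`.
      · have h3 := hF.mem (k / 2 + 4 * i)
        rw [mul_add, Nat.mul_div_cancel' (Nat.dvd_of_mod_eq_zero hk2), pow_add, ← mul_assoc] at h3
        convert h3 using 3
        · rfl
        rw [show (F.placed false k P0).η = F.η⁻¹ from rfl, inv_pow, inv_eq_iff_mul_eq_one, ← pow_add, show 2 * i + 2 * (4 * i) = 10 * i by ring, pow_mul,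
          F.turn.pow_ten, one_pow]
      · have h3 := hF.mem (k / 2 + i)
        rw [mul_add, Nat.mul_div_cancel' (Nat.dvd_of_mod_eq_zero hk2), pow_add, ← mul_assoc] at h3
        simpa [Frame.placed] using h3
    · intro j _
      -- Both directions are even, so some rotation of the second star by multiples of `2π/5` takes
      -- its known dart to direction `k`.
      have h3 := hw.mem_of_turn h𝒯 F.turn hs ((k + 10 - x.kd % 10) / 2)
      have e2 : x.kd % 10 + 2 * ((k + 10 - x.kd % 10) / 2) = k + 10 := by omega
      rw [mul_assoc, ← pow_add, e2, pow_add, F.turn.pow_ten, mul_one] at h3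
      have h4 := hw.mem_of_turn h𝒯 (F.placed b k P0).turn h3 j
      rw [e] at h4
      exact h4
  have hpow : ∀ k, F.pt (rotn nearDisp k) = (F.placed true k P0).pt nearDisp ∧
      F.pt (rotn nearDisp.conj k) = (F.placed false k P0).pt nearDisp := by
    intro k
    constructor
    · simp only [Frame.pt, Frame.placed, val_rotn F.turn, Frame.dig_P0, val_zero, if_true]
      push_cast; ring
    · simp only [Frame.pt, Frame.placed, val_rotn F.turn, Frame.dig_P0, val_zero,
        Bool.false_eq_true, if_false, val_conj F.turn]
      push_cast; ring
  have hmem : ∀ k ∈ [0, 2, 4, 6, 8], k < 10 ∧ k % 2 = 0 := by decide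
  have hadd : ∀ y, add zero y = y := fun y => by simp [add, zero]
  rcases h2 with h2 | h2
  · obtain ⟨k, hk, e⟩ := List.mem_map.1 h2
    have e := (Code.mk.injEq _ _ _ _ ▸ e).2
    refine fin true k (hmem k hk).1 (hmem k hk).2 ?_
    rw [← (hpow k).1, ← e, show (⟨3, 1, 2, -1⟩ : V4) = nearDisp from rfl,
      dig_shift (roomy_of_inBounds Frame.inBounds_P0) (smallTest_nearDisp.2 k (hmem k hk).1).1,
      Frame.dig_P0, hadd]
  · obtain ⟨k, hk, e⟩ := List.mem_map.1 h2
    have e := (Code.mk.injEq _ _ _ _ ▸ e).2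
    refine fin false k (hmem k hk).1 (hmem k hk).2 ?_
    rw [← (hpow k).2, ← e, show (⟨3, 1, 2, -1⟩ : V4) = nearDisp from rfl,
      dig_shift (roomy_of_inBounds Frame.inBounds_P0) (smallTest_nearDisp.2 k (hmem k hk).1).2,
      Frame.dig_P0, hadd]

theorem inBounds_ringC : ∀ j < 8, inBounds (ringC j).ap = true := by decide +kernel

/-- The inner tiles of a caterpillar in a frame centered at the adjacent star. -/
structure Ring (𝒯 : Set Tile) (p : ℕ → Tile) (R : Frame) : Prop where
  star : R.Star 𝒯
  eq : ∀ j, 1 ≤ j → j ≤ 6 → p j = R.tile (ringRel j)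

namespace Ring

variable {𝒯 C U : Set Tile} {p : ℕ → Tile} {R : Frame}

theorem cd_ringC (h : Ring 𝒯 p R) {j : ℕ} (h1 : 1 ≤ j) (h6 : j ≤ 6) : R.cd (ringC j) = p j := by
  rw [h.eq j h1 h6, ringC, (R.cd_place true (roomy_of_inBounds Frame.inBounds_P0) (by norm_num)
    (placeable_ringRel j (by omega))).2, R.placed_self]

theorem ok_ringC (h : Ring 𝒯 p R) (hp : Spine 𝒯 C p) {j : ℕ} (h1 : 1 ≤ j) (h6 : j ≤ 6) :
    R.Ok 𝒯 (ringC j) :=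
  ⟨(R.cd_place true (roomy_of_inBounds Frame.inBounds_P0) (by norm_num)
    (placeable_ringRel j (by omega))).1, inBounds_ringC j (by omega),
    h.cd_ringC h1 h6 ▸ hp.subset (hp.mem j (by omega))⟩

theorem tree (h : Ring 𝒯 p R) (hp : Spine 𝒯 C p) (hCU : C ⊆ U) : R.Tree 𝒯 U ringT := by
  have ok := fun {j} => h.ok_ringC hp (j := j)
  have mem : ∀ {j}, 1 ≤ j → j ≤ 6 → R.cd (ringC j) ∈ U := fun {j} h1 h6 =>
    h.cd_ringC h1 h6 ▸ hCU (hp.mem j (by omega))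
  have adj : ∀ {j}, 1 ≤ j → j ≤ 5 → TileAdj (R.cd (ringC (j + 1))) (R.cd (ringC j)) := fun {j} h1 h6 => by
    rw [h.cd_ringC h1 (by omega), h.cd_ringC (by omega) (by omega)]
    exact (hp.adj j (by omega)).symm
  have t := Frame.tree_singleton (U := U) (ok (j := 6) (by norm_num) (by norm_num))
    (mem (by norm_num) (by norm_num))
  have t := t.cons (ok (j := 5) (by norm_num) (by norm_num)) (mem (by norm_num) (by norm_num))
    List.mem_cons_self (adj (by norm_num) (by norm_num))
  have t := t.cons (ok (j := 4) (by norm_num) (by norm_num)) (mem (by norm_num) (by norm_num))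
    List.mem_cons_self (adj (by norm_num) (by norm_num))
  have t := t.cons (ok (j := 3) (by norm_num) (by norm_num)) (mem (by norm_num) (by norm_num))
    List.mem_cons_self (adj (by norm_num) (by norm_num))
  have t := t.cons (ok (j := 2) (by norm_num) (by norm_num)) (mem (by norm_num) (by norm_num))
    List.mem_cons_self (adj (by norm_num) (by norm_num))
  exact t.cons (ok (j := 1) (by norm_num) (by norm_num)) (mem (by norm_num) (by norm_num))
    List.mem_cons_self (adj (by norm_num) (by norm_num))

theorem mem_ringT {j : ℕ} (h1 : 1 ≤ j) (h6 : j ≤ 6) : ringC j ∈ ringT :=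
  List.mem_map_of_mem (by interval_cases j <;> simp)

/-- No star other than the central one is adjacent to the caterpillar. -/
theorem apex_eq (h𝒯 : IsP2Tiling 𝒯) (hC : NoCycle C) (h : Ring 𝒯 p R)
    (hp : Spine 𝒯 C p) {c s : Tile} (hc : c ∈ C) (hs : s ∈ 𝒯) (hadj : TileAdj c s)
    (hk : s.kind = .dart) (hw : IsStarCenter 𝒯 s.apex) : s.apex = R.o := by
  -- This treats a ring tile `p i` and its neighbors; `p j` is an adjacent ring tile that serves as
  -- predecessor.
  have b1 : ∀ i j, 1 ≤ i → i ≤ 6 → 1 ≤ j → j ≤ 6 → searchStar i j = true →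
      (c = p i ∨ c ≠ p j ∧ TileAdj (p i) c) → s.apex = R.o := by
    intro i j hi hi' hj hj' hB hcase
    obtain ⟨M, L, hM, hB⟩ := h.star.withRing h𝒯 hB
    rw [Bool.and_eq_true] at hB
    rcases hcase with rfl | ⟨hne, hadj'⟩
    · exact hM.probe h𝒯 h.star (h.ok_ringC hp hi hi') hB.1 hs (by rwa [h.cd_ringC hi hi']) hk hw
    · obtain ⟨M, L, T, inc, hM, -, -, -, hn, hB⟩ := hM.visit h𝒯 hC subset_rfl hp.subset
        (h.tree hp subset_rfl) (mem_ringT hi hi') (fun _ => h.cd_ringC hj hj' ▸ hp.mem j (by omega))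
        (h.cd_ringC hi hi' ▸ hp.internal i (by omega)) hB.2
      obtain ⟨x, hx, hxok, rfl⟩ := hn.exists_code hc (by rwa [h.cd_ringC hi hi'])
        (by rwa [h.cd_ringC hj hj'])
      exact hM.probe h𝒯 h.star hxok (List.all_eq_true.1 hB x hx) hs hadj hk hw
  -- This treats the neighbors of an end tile `p m` of the chain, reached through the ring tile `p
  -- i`.
  have b2 : ∀ i j m, 1 ≤ i → i ≤ 6 → 1 ≤ j → j ≤ 6 → m < 8 → p m ≠ p j → TileAdj (p i) (p m) →
      searchEndStar i j = true → c ≠ p i → TileAdj (p m) c → s.apex = R.o := by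
    intro i j m hi hi' hj hj' hm hmj him hB hne hadj'
    obtain ⟨M, L, hM, hB⟩ := h.star.withRing h𝒯 hB
    obtain ⟨M, L, T, inc, hM, hT, hsub, hinc, hn, hB⟩ := hM.visit h𝒯 hC subset_rfl hp.subset
        (h.tree hp subset_rfl) (mem_ringT hi hi') (fun _ => h.cd_ringC hj hj' ▸ hp.mem j (by omega))
        (h.cd_ringC hi hi' ▸ hp.internal i (by omega)) hB
    obtain ⟨x, hx, hxok, e⟩ := hn.exists_code (hp.mem m hm) (by rwa [h.cd_ringC hi hi'])
        (by rwa [h.cd_ringC hj hj'])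
    obtain ⟨M, L, T, inc', hM, -, -, -, hn, hB⟩ := hM.visit h𝒯 hC subset_rfl hp.subset
      hT (hinc hx) (fun _ => h.cd_ringC hi hi' ▸ hp.mem i (by omega))
      (e ▸ hp.internal m hm) (List.all_eq_true.1 hB x hx)
    obtain ⟨y, hy, hyok, rfl⟩ := hn.exists_code hc (by rwa [e]) (by rwa [h.cd_ringC hi hi'])
    exact hM.probe h𝒯 h.star hyok (List.all_eq_true.1 hB y hy) hs hadj hk hw
  obtain ⟨s12, s23, s34, s45, s56, s65⟩ := searchStar_eq
  obtain ⟨t65, t12⟩ := searchEndStar_eq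
  -- the tiles of the ring
  have spine : ∀ i, 1 ≤ i → i ≤ 6 → c = p i → s.apex = R.o := by
    intro i h1 h6 e
    interval_cases i
    · exact b1 1 2 (by norm_num) (by norm_num) (by norm_num) (by norm_num) s12 (Or.inl e)
    · exact b1 2 3 (by norm_num) (by norm_num) (by norm_num) (by norm_num) s23 (Or.inl e)
    · exact b1 3 4 (by norm_num) (by norm_num) (by norm_num) (by norm_num) s34 (Or.inl e)
    · exact b1 4 5 (by norm_num) (by norm_num) (by norm_num) (by norm_num) s45 (Or.inl e)
    · exact b1 5 6 (by norm_num) (by norm_num) (by norm_num) (by norm_num) s56 (Or.inl e)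
    · exact b1 6 5 (by norm_num) (by norm_num) (by norm_num) (by norm_num) s65 (Or.inl e)
  have ring : ∀ i, 1 ≤ i → i ≤ 6 → TileAdj (p i) c → s.apex = R.o := by
    intro i h1 h6 e
    by_cases hspine : ∃ j, 1 ≤ j ∧ j ≤ 6 ∧ c = p j
    · obtain ⟨j, h1, h6, e⟩ := hspine
      exact spine j h1 h6 e
    push Not at hspine
    interval_cases i
    · exact b1 1 2 (by norm_num) (by norm_num) (by norm_num) (by norm_num) s12
        (Or.inr ⟨hspine _ (by norm_num) (by norm_num), e⟩)
    · exact b1 2 3 (by norm_num) (by norm_num) (by norm_num) (by norm_num) s23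
        (Or.inr ⟨hspine _ (by norm_num) (by norm_num), e⟩)
    · exact b1 3 4 (by norm_num) (by norm_num) (by norm_num) (by norm_num) s34
        (Or.inr ⟨hspine _ (by norm_num) (by norm_num), e⟩)
    · exact b1 4 5 (by norm_num) (by norm_num) (by norm_num) (by norm_num) s45
        (Or.inr ⟨hspine _ (by norm_num) (by norm_num), e⟩)
    · exact b1 5 6 (by norm_num) (by norm_num) (by norm_num) (by norm_num) s56
        (Or.inr ⟨hspine _ (by norm_num) (by norm_num), e⟩)
    · exact b1 6 5 (by norm_num) (by norm_num) (by norm_num) (by norm_num) s65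
        (Or.inr ⟨hspine _ (by norm_num) (by norm_num), e⟩)
  obtain ⟨i, hi, e⟩ := hp.near c hc
  by_cases h1 : i = 0
  · subst h1
    rcases e with rfl | e
    · exact ring 1 (by norm_num) (by norm_num) (hp.adj 0 (by norm_num)).symm
    · by_cases h2 : c = p 1
      · exact spine 1 (by norm_num) (by norm_num) h2
      · exact b2 1 2 0 (by norm_num) (by norm_num) (by norm_num) (by norm_num) (by norm_num)
          (hp.ne 0 (by norm_num)) (hp.adj 0 (by norm_num)).symm t12 h2 e
  by_cases h7 : i = 7
  · subst h7
    rcases e with rfl | e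
    · exact ring 6 (by norm_num) (by norm_num) (hp.adj 6 (by norm_num))
    · by_cases h2 : c = p 6
      · exact spine 6 (by norm_num) (by norm_num) h2
      · exact b2 6 5 7 (by norm_num) (by norm_num) (by norm_num) (by norm_num) (by norm_num)
          (hp.ne 5 (by norm_num)).symm (hp.adj 6 (by norm_num)) t65 h2 e
  rcases e with e | e
  · exact spine i (by omega) (by omega) e
  · exact ring i (by omega) (by omega) e

end Ring

/-! ### Consecutive caterpillars -/

theorem V4.onLine_of_val {η : Circle} (hη : IsTurn η) {x : V4} {r : ℝ} {k : ℕ} (hk : k ≤ 20)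
    (h : val η x = r * η ^ k) : onLine x k = true := by
  have h1 : val η (rotn x (20 - k)) = r := by
    rw [val_rotn hη, h, mul_left_comm, ← pow_add, Nat.sub_add_cancel hk]
    have : (η : ℂ) ^ 20 = 1 := by
      linear_combination (((η : ℂ) ^ 5 - 1) * ((η : ℂ) ^ 10 + 1)) * hη.pow_five
    rw [this, mul_one]
  have h2 := im_val hη (rotn x (20 - k))
  rw [h1, Complex.ofReal_im, eq_comm, mul_eq_zero, or_iff_left (im_ne_zero hη)] at h2
  have h3 := eq_zero_of_add_mul_goldenRatio (m := (rotn x (20 - k)).b)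
    (n := (rotn x (20 - k)).c + (rotn x (20 - k)).d)
    (by generalize φ = p at *; push_cast; linear_combination h2)
  have e : onLine x k = ((rotn x (20 - k)).b == 0 &&
    (rotn x (20 - k)).c + (rotn x (20 - k)).d == 0) := rfl
  rw [e, h3.1, h3.2]
  rfl

theorem IsTurn.eq_or_eq_inv {η η' : Circle} (h : IsTurn η) (h' : IsTurn η') : η' = η ∨ η' = η⁻¹ := by
  rcases h with rfl | rfl <;> rcases h' with rfl | rfl <;> simp [Circle.exp_neg]

namespace Frame

variable {F F' : Frame} {𝒯 : Set Tile}

/-- The frame centered at the star of a ring is determined by the first tile of the ring. -/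
theorem eq_placed {x : Code} (hx : F.Ok 𝒯 x) (h : F.cd x = F'.tile (ringRel 1)) :
    x.kd ≤ 9 ∧ ∃ s, F' = F.placed s (sel s (x.kd + 2) (x.kd + 8) % 10)
      (shift x.ap (enc (phi2 (sel s (x.kd + 9) (x.kd + 1))))) := by
  have hr : ringRel 1 = ⟨0, phi2 2, 8⟩ := rfl
  rw [hr] at h
  simp only [cd, Code.toRel, tile, Tile.mk.injEq] at h
  obtain ⟨hk, hap, hu⟩ := h
  have hkd : x.kd ≤ 9 := by
    by_contra! hlt
    have e : x.kd / 10 = 1 := by have := hx.kd; omega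
    rw [e] at hk
    exact Kind.noConfusion hk
  refine ⟨hkd, ?_⟩
  have e2 : x.kd % 10 = x.kd := Nat.mod_eq_of_lt (by omega)
  rw [e2] at hu
  have hu' : (F.u : ℂ) * F.η ^ x.kd = F'.u * F'.η ^ 8 := by
    rw [← Circle.coe_pow, ← Circle.coe_mul, hu]; push_cast; ring
  simp only [pt, val_phi2 F'.turn] at hap
  have five := F'.turn.pow_five
  have hroom := roomy_of_inBounds hx.bd
  rcases F.turn.eq_or_eq_inv F'.turn with he | he
  · refine ⟨true, ?_⟩
    have hd := dig_shift hroom (smallTest_phi2 (x.kd + 9) (by omega))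
    rcases F' with ⟨o, u, η, hη⟩
    simp only at hu hu' hap he five
    subst he
    simp only [placed, if_true, Frame.mk.injEq, and_true]
    have e1 : sel true (x.kd + 9) (x.kd + 1) = x.kd + 9 := rfl
    have e3 : sel true (x.kd + 2) (x.kd + 8) = x.kd + 2 := rfl
    rw [e1, e3, pt, hd, val_add, val_phi2 F.turn, F.dir_mod]
    constructor
    · linear_combination (-1 : ℂ) * hap - ((φ : ℂ) + 1) * F.η ^ 9 * hu' -
        u * ((φ : ℂ) + 1) * (F.η ^ 12 - F.η ^ 7 + F.η ^ 2) * five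
    · rw [pow_add, ← mul_assoc, hu, mul_assoc, ← pow_add, F.turn.pow_ten, mul_one]
  · refine ⟨false, ?_⟩
    have hd := dig_shift hroom (smallTest_phi2 (x.kd + 1) (by omega))
    rcases F' with ⟨o, u, η, hη⟩
    simp only at hu hu' hap he five
    subst he
    simp only [placed, Bool.false_eq_true, if_false, Frame.mk.injEq, and_true]
    have e1 : sel false (x.kd + 9) (x.kd + 1) = x.kd + 1 := rfl
    have e3 : sel false (x.kd + 2) (x.kd + 8) = x.kd + 8 := rfl
    rw [e1, e3, pt, hd, val_add, val_phi2 F.turn, F.dir_mod]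
    have hinv : (F.η : ℂ) * ((F.η⁻¹ : Circle) : ℂ) = 1 := by
      rw [← Circle.coe_mul, mul_inv_cancel, Circle.coe_one]
    generalize ((F.η⁻¹ : Circle) : ℂ) = z at *
    constructor
    · linear_combination (-1 : ℂ) * hap - ((φ : ℂ) + 1) * F.η * hu' -
        u * ((φ : ℂ) + 1) * z ^ 7 * hinv - u * ((φ : ℂ) + 1) * z ^ 2 * five
    · rw [pow_add, ← mul_assoc, hu, mul_assoc, inv_pow, inv_mul_cancel, mul_one]

end Frame

/-- Both conditions concern the displacement of the centers, read in the first frame; the second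
gives it with opposite sign. Only lines matter, so the real factors may have any sign. -/
theorem onRays_placed {R R' : Frame} {s : Bool} {d v : ℕ}
    (e : R' = R.placed s d v) (hd : d < 10)
    (h : ∃ (r : ℝ) (k : ℕ), (k = 2 ∨ k = 6) ∧ R'.o = R.o + r * (R.u * R.η ^ k))
    (h' : ∃ (r : ℝ) (k : ℕ), (k = 2 ∨ k = 6) ∧ R.o = R'.o + r * (R'.u * R'.η ^ k)) :
    onRays s d v = true := by
  subst e
  obtain ⟨r, k, hk, h⟩ := h
  obtain ⟨r', k', hk', h'⟩ := h'
  have h0 : (R.placed s d v).o = R.o + R.u * val R.η (dig v) := rfl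
  have hu0 := R.u.coe_ne_zero
  have h1 : val R.η (dig v) = r * R.η ^ k := by
    refine mul_left_cancel₀ hu0 ?_
    linear_combination h - h0
  have l1 : onLine (dig v) 2 || onLine (dig v) 6 := by
    rw [Bool.or_eq_true]
    rcases hk with rfl | rfl
    · exact Or.inl (onLine_of_val R.turn (by norm_num) h1)
    · exact Or.inr (onLine_of_val R.turn (by norm_num) h1)
  have e1 : onRays s d v = ((onLine (dig v) 2 || onLine (dig v) 6) &&
    (sel s (onLine (dig v) (d + 2) || onLine (dig v) (d + 6))
      (onLine (dig v) (d + 8) || onLine (dig v) (d + 4)))) := rfl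
  rw [e1, l1, Bool.true_and]
  cases s
  · change (onLine (dig v) (d + 8) || onLine (dig v) (d + 4)) = true
    have hinv : (R.η : ℂ) * ((R.η⁻¹ : Circle) : ℂ) = 1 := by
      rw [← Circle.coe_mul, mul_inv_cancel, Circle.coe_one]
    have h2 : ∀ m, m + k' = 10 → val R.η (dig v) = (-r' : ℝ) * R.η ^ (d + m) := by
      intro m hm
      refine mul_left_cancel₀ hu0 ?_
      have e2 : ((R.placed false d v).u : ℂ) = R.u * R.η ^ d := by simp [Frame.placed]
      have e3 : ((R.placed false d v).η : ℂ) = ((R.η⁻¹ : Circle) : ℂ) := rfl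
      have e4 : ((R.η⁻¹ : Circle) : ℂ) ^ k' = R.η ^ m := by
        have : (R.η : ℂ) ^ m * R.η ^ k' = 1 := by
          rw [← pow_add, hm, ← Circle.coe_pow, R.turn.pow_ten, Circle.coe_one]
        have h5 : (R.η : ℂ) ^ k' * ((R.η⁻¹ : Circle) : ℂ) ^ k' = 1 := by
          rw [← mul_pow, hinv, one_pow]
        linear_combination (-((R.η⁻¹ : Circle) : ℂ) ^ k') * this + (R.η : ℂ) ^ m * h5
      rw [e2, e3, e4] at h'
      push_cast
      rw [pow_add]
      linear_combination -h' - h0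
    rw [Bool.or_eq_true]
    rcases hk' with rfl | rfl
    · exact Or.inl (onLine_of_val R.turn (by omega) (h2 8 rfl))
    · exact Or.inr (onLine_of_val R.turn (by omega) (h2 4 rfl))
  · change (onLine (dig v) (d + 2) || onLine (dig v) (d + 6)) = true
    have h2 : val R.η (dig v) = (-r' : ℝ) * R.η ^ (d + k') := by
      refine mul_left_cancel₀ hu0 ?_
      have e2 : ((R.placed true d v).u : ℂ) = R.u * R.η ^ d := by simp [Frame.placed]
      have e3 : ((R.placed true d v).η : ℂ) = R.η := rfl
      rw [e2, e3] at h'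
      push_cast
      rw [pow_add]
      linear_combination -h' - h0
    rw [Bool.or_eq_true]
    rcases hk' with rfl | rfl
    · exact Or.inl (onLine_of_val R.turn (by omega) h2)
    · exact Or.inr (onLine_of_val R.turn (by omega) h2)

/-- The centers of the stars of two consecutive caterpillars cannot lie on the rays bounding
each other's sectors. -/
theorem Ring.not_consecutive {𝒯 C C' U : Set Tile} (h𝒯 : IsP2Tiling 𝒯) (hU : NoCycle U) (hCU : C ⊆ U)
    (hCU' : C' ⊆ U) {p q : ℕ → Tile} (hp : Spine 𝒯 C p) (hq : Spine 𝒯 C' q) {R R' : Frame}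
    (hR : Ring 𝒯 p R) (hR' : Ring 𝒯 q R') {t : Tile} (ht : t ∈ C) (ht' : t ∈ C')
    (hpt : TileAdj (p 7) t) (htq : TileAdj t (q 0)) (hpq : q 0 ≠ p 7) (htp : t ≠ p 6) (htq1 : t ≠ q 1)
    (h : ∃ (r : ℝ) (k : ℕ), (k = 2 ∨ k = 6) ∧ R'.o = R.o + r * (R.u * R.η ^ k))
    (h' : ∃ (r : ℝ) (k : ℕ), (k = 2 ∨ k = 6) ∧ R.o = R'.o + r * (R'.u * R'.η ^ k)) : False := by
  have ok := fun {j} => hR.ok_ringC hp (j := j)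
  have cd := fun {j} => hR.cd_ringC (j := j)
  obtain ⟨M, L, hM, hs⟩ := hR.star.withRing h𝒯 searchNext_eq
  have hT := hR.tree hp hCU
  obtain ⟨M, L, T, i5, hM, hT, hs5, -, -, hs⟩ := hM.visit h𝒯 hU hCU hp.subset hT
    (mem_ringT (j := 5) (by norm_num) (by norm_num))
    (fun _ => cd (j := 4) (by norm_num) (by norm_num) ▸ hp.mem 4 (by norm_num))
    (cd (j := 5) (by norm_num) (by norm_num) ▸ hp.internal 5 (by norm_num)) hs
  obtain ⟨M, L, T, i6, hM, hT, hs6, hi6, hn6, hs⟩ := hM.visit h𝒯 hU hCU hp.subset hT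
    (hs5 (mem_ringT (j := 6) (by norm_num) (by norm_num)))
    (fun _ => cd (j := 5) (by norm_num) (by norm_num) ▸ hp.mem 5 (by norm_num))
    (cd (j := 6) (by norm_num) (by norm_num) ▸ hp.internal 6 (by norm_num)) hs
  obtain ⟨x7, hx7, k7, e7⟩ := hn6.exists_code (hp.mem 7 (by norm_num))
    (by rw [cd (by norm_num) (by norm_num)]; exact hp.adj 6 (by norm_num))
    (by rw [cd (by norm_num) (by norm_num)]; exact (hp.ne 5 (by norm_num)).symm)
  have hs := List.all_eq_true.1 hs x7 hx7
  obtain ⟨M, L, T, i7, hM, hT, hs7, hi7, hn7, hs⟩ := hM.visit h𝒯 hU hCU hp.subset hT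
    (hi6 hx7) (fun _ => cd (j := 6) (by norm_num) (by norm_num) ▸ hp.mem 6 (by norm_num))
    (e7 ▸ hp.internal 7 (by norm_num)) hs
  obtain ⟨xt, hxt, kt, et⟩ := hn7.exists_code ht (by rwa [e7])
    (by rwa [cd (by norm_num) (by norm_num)])
  have hs := List.all_eq_true.1 hs xt hxt
  obtain ⟨M, L, nb, hM, hnb, hs⟩ := hM.addNbrs h𝒯 kt hs
  obtain ⟨M, L, hM, hs⟩ := hM.unitPass h𝒯 (fun y hy => (hnb.ok y hy).1) hs
  obtain ⟨y0, hy0, ey0⟩ := hnb.mem (q 0) (hq.subset (hq.mem 0 (by norm_num))) (by rwa [et])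
  have ky0 := (hnb.ok y0 hy0).1
  have hs := List.all_eq_true.1 hs y0 hy0
  have hne : y0.beq x7 = false := by
    rw [← Bool.not_eq_true, Code.beq_iff]
    rintro rfl
    exact hpq (ey0.symm.trans e7)
  rw [hne, Bool.false_or] at hs
  obtain ⟨T, hT, hsT, hsT', hs⟩ := hT.addTs hU (fun _ h => h) (hi7 hxt) (by
    intro y hy
    rw [List.mem_singleton.1 hy]
    exact ⟨ky0, ey0 ▸ hCU' (hq.mem 0 (by norm_num)), (hnb.ok y0 hy0).2⟩) hs
  obtain ⟨M, L, T, j0, hM, hT, hsj, hj0, hn0, hs⟩ := hM.visit h𝒯 hU hCU' hq.subset hT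
    (hsT' List.mem_cons_self) (fun _ => et ▸ ht') (ey0 ▸ hq.internal 0 (by norm_num)) hs
  obtain ⟨y1, hy1, ky1, ey1⟩ := hn0.exists_code (hq.mem 1 (by norm_num))
    (by rw [ey0]; exact hq.adj 0 (by norm_num)) (by rw [et]; exact htq1.symm)
  have hs := List.all_eq_true.1 hs y1 hy1
  obtain ⟨hkd, s, es⟩ := Frame.eq_placed ky1 (ey1.trans (hR'.eq 1 (by norm_num) (by norm_num)))
  have hd : sel s (y1.kd + 2) (y1.kd + 8) % 10 < 10 := Nat.mod_lt _ (by norm_num)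
  have hroom : Roomy (shift y1.ap (enc (phi2 (sel s (y1.kd + 9) (y1.kd + 1))))) :=
    roomy_shift ky1.bd (smallTest_phi2 _ (by
      cases s
      · change y1.kd + 1 < 20; omega
      · change y1.kd + 9 < 20; omega))
  rw [frames, Bool.or_eq_true, Nat.ble_eq, List.all_eq_true] at hs
  rcases hs with hs | hs
  · omega
  have hs := hs s (by cases s <;> simp)
  rw [force_eq, force_eq] at hs
  generalize shift y1.ap (enc (phi2 (sel s (y1.kd + 9) (y1.kd + 1)))) = v at *
  generalize sel s (y1.kd + 2) (y1.kd + 8) % 10 = d at *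
  -- Here the assumption on the two angles enters; without it the branch would be accepted
  -- unexamined.
  rw [onRays_placed es hd h h', Bool.not_true, Bool.false_or] at hs
  obtain ⟨-, M, L, hM, hs⟩ := hM.addStar h𝒯 (Frame.Star.stars hd hroom (es ▸ hR'.star)) hs
  obtain ⟨M, L, T, j1, hM, hT, -, -, hn1, hs⟩ := hM.visit h𝒯 hU hCU' hq.subset hT
    (hj0 hy1) (fun _ => ey0 ▸ hq.mem 0 (by norm_num)) (ey1 ▸ hq.internal 1 (by norm_num)) hs
  obtain ⟨y2, hy2, ky2, ey2⟩ := hn1.exists_code (hq.mem 2 (by norm_num))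
    (by rw [ey1]; exact hq.adj 1 (by norm_num)) (by rw [ey0]; exact (hq.ne 0 (by norm_num)).symm)
  obtain ⟨h1, h2⟩ := R.cd_place s hroom hd (placeable_ringRel 2 (by norm_num))
  have : y2 = place s d v (ringRel 2) := R.cd_injective ky2.kd h1 (by
    rw [ey2, h2, hR'.eq 2 (by norm_num) (by norm_num), es])
  rw [this, ← elem_eq_true] at hy2
  rw [hy2] at hs
  exact Bool.noConfusion hs

/-! ### Sectors -/

theorem coe_pow_four_of_isTurn {η : Circle} (h : IsTurn η) : ∃ σ : ℝ, (σ = 1 ∨ σ = -1) ∧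
    (η : ℂ) ^ 4 = Complex.exp ((σ * (4 * π / 5) : ℝ) * Complex.I) := by
  rcases h with rfl | rfl
  · refine ⟨1, Or.inl rfl, ?_⟩
    rw [Circle.coe_exp, ← Complex.exp_nat_mul]
    congr 1; push_cast; ring
  · refine ⟨-1, Or.inr rfl, ?_⟩
    rw [Circle.coe_exp, ← Complex.exp_nat_mul]
    congr 1; push_cast; ring

/-- Two directions at angle `4π/5` in a closed sector of this angle bound the sector. -/
theorem sector_boundary {η : Circle} (h : IsTurn η) {w z : ℂ} (hz : z ≠ 0) {ρ ρ' θ θ' : ℝ}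
    (hρ : 0 ≤ ρ) (hρ' : 0 ≤ ρ') (hθ : θ ∈ Set.Icc 0 (4 * π / 5)) (hθ' : θ' ∈ Set.Icc 0 (4 * π / 5))
    (h1 : z = ρ * w * Complex.exp (θ * Complex.I))
    (h2 : z * η ^ 4 = ρ' * w * Complex.exp (θ' * Complex.I)) :
    ∃ r : ℝ, (w = r * z ∧ w * Complex.exp ((4 * π / 5 : ℝ) * Complex.I) = r * (z * η ^ 4)) ∨
      (w = r * (z * η ^ 4) ∧ w * Complex.exp ((4 * π / 5 : ℝ) * Complex.I) = r * z) := by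
  have hw : w ≠ 0 := by rintro rfl; simp at h1; exact hz h1
  have hρ0 : ρ ≠ 0 := by rintro rfl; simp at h1; exact hz h1
  have hρc : (ρ : ℂ) ≠ 0 := Complex.ofReal_ne_zero.2 hρ0
  have hnorm : ρ' = ρ := by
    have e1 := congrArg norm h1
    have e2 := congrArg norm h2
    simp only [norm_mul, norm_pow, Circle.norm_coe, one_pow, mul_one, Complex.norm_exp_ofReal_mul_I,
      Complex.norm_real, norm_of_nonneg hρ, norm_of_nonneg hρ'] at e1 e2
    exact mul_right_cancel₀ (norm_ne_zero_iff.2 hw) (e2.symm.trans e1)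
  subst hnorm
  obtain ⟨σ, hσ, e4⟩ := coe_pow_four_of_isTurn h
  have key : Complex.exp (θ' * Complex.I) = Complex.exp ((θ + σ * (4 * π / 5) : ℝ) * Complex.I) := by
    refine mul_left_cancel₀ (mul_ne_zero hρc hw) ?_
    rw [← h2, h1, e4, mul_assoc, ← Complex.exp_add]
    congr 2; push_cast; ring
  obtain ⟨n, hn⟩ := Complex.exp_eq_exp_iff_exists_int.1 key
  have hn' : θ' = θ + σ * (4 * π / 5) + n * (2 * π) := by
    have : ((θ' : ℂ)) = ((θ + σ * (4 * π / 5) + n * (2 * π) : ℝ) : ℂ) := by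
      refine mul_right_cancel₀ Complex.I_ne_zero ?_
      rw [hn]; push_cast; ring
    exact_mod_cast this
  have hpi := Real.pi_pos
  obtain ⟨a1, a2⟩ := hθ
  obtain ⟨b1, b2⟩ := hθ'
  -- Both angles lie in `[0, 4π/5]`, so they cannot differ by `±4π/5` plus a nonzero multiple of
  -- `2π`.
  have n0 : n = 0 := by
    have l1 : (n : ℝ) < 1 := by
      by_contra! hlt
      have : 2 * π ≤ n * (2 * π) := by nlinarith
      rcases hσ with rfl | rfl <;> linarith
    have l2 : -1 < (n : ℝ) := by
      by_contra! hlt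
      have : n * (2 * π) ≤ -(2 * π) := by nlinarith
      rcases hσ with rfl | rfl <;> linarith
    have l1' : n < 1 := by exact_mod_cast l1
    have l2' : -1 < n := by exact_mod_cast l2
    omega
  rw [n0, Int.cast_zero, zero_mul, add_zero] at hn'
  refine ⟨ρ'⁻¹, ?_⟩
  have hinv : ((ρ'⁻¹ : ℝ) : ℂ) * ρ' = 1 := by
    rw [← Complex.ofReal_mul, inv_mul_cancel₀ hρ0, Complex.ofReal_one]
  rcases hσ with rfl | rfl
  · have t1 : θ = 0 := by linarith
    have t2 : θ' = 4 * π / 5 := by linarith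
    subst t1 t2
    rw [Complex.ofReal_zero, zero_mul, Complex.exp_zero, mul_one] at h1
    left
    constructor
    · rw [h1]; linear_combination (-w) * hinv
    · rw [h2]; linear_combination (-w * Complex.exp ((4 * π / 5 : ℝ) * Complex.I)) * hinv
  · have t1 : θ' = 0 := by linarith
    have t2 : θ = 4 * π / 5 := by linarith
    subst t1 t2
    rw [Complex.ofReal_zero, zero_mul, Complex.exp_zero, mul_one] at h2
    right
    constructor
    · rw [h2]; linear_combination (-w) * hinv
    · rw [h1]; linear_combination (-w * Complex.exp ((4 * π / 5 : ℝ) * Complex.I)) * hinv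

/-- The two points subtend the full angle of the sector, so they lie on its two bounding rays, which
are also those through `a` and `b`. -/
theorem SectorContains.rays {v a b : ℂ} {X : Set ℂ} (h : SectorContains v a b (4 * π / 5) X)
    {η : Circle} (hη : IsTurn η) {z : ℂ} (hz : z ≠ 0) (h1 : v + z ∈ X) (h2 : v + z * η ^ 4 ∈ X) :
    (∃ r : ℝ, a = v + r * z ∨ a = v + r * (z * η ^ 4)) ∧
      ∃ r : ℝ, b = v + r * z ∨ b = v + r * (z * η ^ 4) := by
  obtain ⟨-, ⟨s, -, hs⟩, hX⟩ := h
  obtain ⟨ρ, hρ, θ, hθ, e⟩ := hX h1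
  obtain ⟨ρ', hρ', θ', hθ', e'⟩ := hX h2
  obtain ⟨r, ⟨e1, e2⟩ | ⟨e1, e2⟩⟩ := sector_boundary hη hz hρ hρ' hθ hθ' (add_left_cancel e)
    (add_left_cancel e')
  · refine ⟨⟨r, Or.inl (by rw [← e1]; ring)⟩, s * r, Or.inr ?_⟩
    push_cast
    linear_combination hs + s * e2
  · refine ⟨⟨r, Or.inr (by rw [← e1]; ring)⟩, s * r, Or.inl ?_⟩
    push_cast
    linear_combination hs + s * e2

theorem Tile.apex_mem_body (s : Tile) : s.apex ∈ s.body :=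
  Or.inl (subset_convexHull ℝ _ (by simp))

/-- The ends of the inner tiles of the core of a caterpillar of angle `4π/5` lie on the rays through
the centers of the neighboring stars. -/
theorem Ring.rays {𝒯 : Set Tile} {p : ℕ → Tile} {R : Frame} (hR : Ring 𝒯 p R) {X : Set ℂ}
    (h2 : (p 2).body ⊆ X) (h5 : (p 5).body ⊆ X) {a b : ℂ}
    (h : SectorContains R.o a b (4 * π / 5) X ∨ SectorContains R.o b a (4 * π / 5) X) :
    (∃ (r : ℝ) (k : ℕ), (k = 2 ∨ k = 6) ∧ a = R.o + r * (R.u * R.η ^ k)) ∧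
      ∃ (r : ℝ) (k : ℕ), (k = 2 ∨ k = 6) ∧ b = R.o + r * (R.u * R.η ^ k) := by
  have e2 : (p 2).apex = R.o + ((φ : ℂ) + 1) * (R.u * R.η ^ 2) := by
    rw [hR.eq 2 (by norm_num) (by norm_num)]
    have : (R.tile (ringRel 2)).apex = R.pt (phi2 2) := rfl
    rw [this, Frame.pt, val_phi2 R.turn]; ring
  have e5 : (p 5).apex = R.o + ((φ : ℂ) + 1) * (R.u * R.η ^ 2) * R.η ^ 4 := by
    rw [hR.eq 5 (by norm_num) (by norm_num)]
    have : (R.tile (ringRel 5)).apex = R.pt (phi2 6) := rfl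
    rw [this, Frame.pt, val_phi2 R.turn]; ring
  have hz : ((φ : ℂ) + 1) * (R.u * R.η ^ 2) ≠ 0 := by
    refine mul_ne_zero ?_ (mul_ne_zero R.u.coe_ne_zero (pow_ne_zero _ R.η.coe_ne_zero))
    have : (φ + 1 : ℝ) ≠ 0 := by have := Real.goldenRatio_pos; positivity
    exact_mod_cast this
  have m2 := h2 (e2 ▸ (p 2).apex_mem_body)
  have m5 := h5 (e5 ▸ (p 5).apex_mem_body)
  have conv : ∀ {c : ℂ}, (∃ r : ℝ, c = R.o + r * (((φ : ℂ) + 1) * (R.u * R.η ^ 2)) ∨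
      c = R.o + r * (((φ : ℂ) + 1) * (R.u * R.η ^ 2) * R.η ^ 4)) →
      ∃ (r : ℝ) (k : ℕ), (k = 2 ∨ k = 6) ∧ c = R.o + r * (R.u * R.η ^ k) := by
    rintro c ⟨r, rfl | rfl⟩
    · exact ⟨r * (φ + 1), 2, Or.inl rfl, by push_cast; ring⟩
    · exact ⟨r * (φ + 1), 6, Or.inr rfl, by push_cast; ring⟩
  rcases h with h | h
  · exact ⟨conv (h.rays R.turn hz m2 m5).1, conv (h.rays R.turn hz m2 m5).2⟩
  · exact ⟨conv (h.rays R.turn hz m2 m5).2, conv (h.rays R.turn hz m2 m5).1⟩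

/-! ### Derived graphs of induced trees -/

section Graph

variable {V : Type*} {G : SimpleGraph V} {S A : Set V}

theorem not_mem_leaves {v a b : V} (ha : a ∈ S) (hb : b ∈ S) (hva : G.Adj v a) (hvb : G.Adj v b)
    (hab : a ≠ b) : v ∉ leaves G S := by
  rintro ⟨-, h⟩
  obtain ⟨c, hc⟩ := Set.encard_eq_one.1 h
  have h1 : a ∈ ({c} : Set V) := hc ▸ ⟨hva, ha⟩
  have h2 : b ∈ ({c} : Set V) := hc ▸ ⟨hvb, hb⟩
  exact hab (h1.trans h2.symm)

/-- A vertex inside a path has two different neighbors and is not a leaf. -/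
theorem mem_derived_of_isPath {x z y : S} {h : (G.induce S).Adj x z} {p : (G.induce S).Walk z y}
    (hp : (SimpleGraph.Walk.cons h p).IsPath) (hy : y.1 ∈ derived G S) : z.1 ∈ derived G S := by
  cases p with
  | nil => exact hy
  | cons h' p =>
    rename_i w
    refine ⟨z.2, not_mem_leaves x.2 w.2 h.symm h' fun e => ?_⟩
    have h1 := (SimpleGraph.Walk.cons_isPath_iff _ _).1 hp
    refine h1.2 ?_
    rw [Subtype.ext e, SimpleGraph.Walk.support_cons]
    exact List.mem_cons_of_mem _ p.start_mem_support

theorem reflTransGen_derived (hS : IsInducedSubtree G S) {x y : V} (hx : x ∈ derived G S)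
    (hy : y ∈ derived G S) :
    Relation.ReflTransGen (fun a b => b ∈ derived G S ∧ G.Adj a b) x y := by
  suffices ∀ {x y : S} (p : (G.induce S).Walk x y), p.IsPath → x.1 ∈ derived G S →
      y.1 ∈ derived G S → Relation.ReflTransGen (fun a b => b ∈ derived G S ∧ G.Adj a b) x.1 y.1 by
    obtain ⟨p, hp⟩ := (hS.1.preconnected ⟨x, hx.1⟩ ⟨y, hy.1⟩).exists_isPath
    exact this p hp hx hy
  intro x y p
  induction p with
  | nil => exact fun _ _ _ => .refl
  | cons h p ih =>
    intro hp hx hy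
    have hz := mem_derived_of_isPath hp hy
    exact .head ⟨hz, h⟩ (ih hp.of_cons hz hy)

theorem exists_adj_derived (hS : IsInducedSubtree G S) {c : V} (hc : c ∈ S)
    (hd : (derived G S).Nonempty) : c ∈ derived G S ∨ ∃ x ∈ derived G S, G.Adj x c := by
  obtain ⟨y, hy⟩ := hd
  obtain ⟨p, hp⟩ := (hS.1.preconnected ⟨c, hc⟩ ⟨y, hy.1⟩).exists_isPath
  cases p with
  | nil => exact Or.inl hy
  | cons h p => exact Or.inr ⟨_, mem_derived_of_isPath hp hy, h.symm⟩

/-- `P` enumerates the vertices of a bi-infinite chain. -/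
structure IsChainOf (G : SimpleGraph V) (A : Set V) (P : ℤ → V) : Prop where
  inj : Function.Injective P
  range : Set.range P = A
  adj : ∀ m n, G.Adj (P m) (P n) ↔ m + 1 = n ∨ n + 1 = m

theorem IsBiInfiniteChain.exists_isChainOf (h : IsBiInfiniteChain G A) : ∃ P, IsChainOf G A P := by
  obtain ⟨e⟩ := h
  refine ⟨fun n => (e.symm n).1, fun m n h => e.symm.injective (Subtype.ext h), ?_, fun m n => ?_⟩
  · ext x
    exact ⟨fun ⟨n, hn⟩ => hn ▸ (e.symm n).2, fun hx => ⟨e ⟨x, hx⟩, by simp⟩⟩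
  · have h1 : (G.induce A).Adj (e.symm m) (e.symm n) ↔ (SimpleGraph.hasse ℤ).Adj m n :=
      e.symm.map_adj_iff
    rw [SimpleGraph.hasse_adj, Order.covBy_iff_add_one_eq, Order.covBy_iff_add_one_eq] at h1
    exact h1

namespace IsChainOf

variable {P : ℤ → V}

theorem comp (hP : IsChainOf G A P) {ε : ℤ} (hε : ε = 1 ∨ ε = -1) (τ : ℤ) :
    IsChainOf G A fun n => P (τ + ε * n) := by
  refine ⟨fun m n h => ?_, ?_, fun m n => ?_⟩
  · have := hP.inj h
    rcases hε with rfl | rfl <;> omega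
  · rw [← hP.range]
    ext x
    refine ⟨fun ⟨n, hn⟩ => ⟨_, hn⟩, fun ⟨n, hn⟩ => ⟨ε * (n - τ), ?_⟩⟩
    rw [← hn]
    refine congrArg P ?_
    rcases hε with rfl | rfl <;> ring
  · rw [hP.adj]
    rcases hε with rfl | rfl <;> omega

/-- The inner vertices of a subtree form an interval of the chain. -/
theorem ordConnected (hP : IsChainOf G A P) (hS : IsInducedSubtree G S) (hSA : derived G S ⊆ A) :
    (P ⁻¹' derived G S).OrdConnected := by
  refine ⟨fun m hm n hn k hk => ?_⟩
  by_contra hk'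
  -- A walk between inner vertices moves by one position of the chain at a time, so it cannot pass a
  -- missing position `k`.
  have key : ∀ y, Relation.ReflTransGen (fun a b => b ∈ derived G S ∧ G.Adj a b) (P m) y →
      ∃ i < k, P i = y := by
    intro y h
    induction h with
    | refl => exact ⟨m, lt_of_le_of_ne hk.1 fun e => hk' (e ▸ hm), rfl⟩
    | tail _ h ih =>
      obtain ⟨i, hi, rfl⟩ := ih
      obtain ⟨i', rfl⟩ := hP.range.symm ▸ hSA h.1
      refine ⟨i', ?_, rfl⟩
      have h1 := (hP.adj _ _).1 h.2
      have h2 : i' ≠ k := fun e => hk' (e ▸ h.1)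
      omega
  obtain ⟨i, hi, e⟩ := key _ (reflTransGen_derived hS hm hn)
  have := hP.inj e
  have := hk.2
  omega

theorem exists_eq_image_Icc (hP : IsChainOf G A P) (hS : IsInducedSubtree G S)
    (hSA : derived G S ⊆ A) {n : ℕ} (hn : n ≠ 0) (h : (derived G S).encard = n) :
    ∃ a : ℤ, derived G S = P '' Set.Icc a (a + n - 1) := by
  have h1 : P '' (P ⁻¹' derived G S) = derived G S :=
    Set.image_preimage_eq_of_subset (hP.range.symm ▸ hSA)
  have h2 : (P ⁻¹' derived G S).encard = n := by rw [← hP.inj.encard_image, h1, h]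
  have hfin : (P ⁻¹' derived G S).Finite := Set.finite_of_encard_eq_coe h2
  have hne : (P ⁻¹' derived G S).Nonempty := by
    rw [← Set.encard_ne_zero, h2]
    exact_mod_cast hn
  obtain ⟨a, ha, ha'⟩ := hfin.exists_minimal hne
  obtain ⟨b, hb, hb'⟩ := hfin.exists_maximal hne
  have h3 : P ⁻¹' derived G S = Set.Icc a b := by
    refine Set.Subset.antisymm (fun x hx => ⟨?_, ?_⟩) ((hP.ordConnected hS hSA).out ha hb)
    · exact (le_total a x).elim id fun h => ha' hx h
    · exact (le_total x b).elim id fun h => hb' hx h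
  refine ⟨a, ?_⟩
  rw [h3, ← Finset.coe_Icc, Set.encard_coe_eq_coe_finsetCard, Int.card_Icc] at h2
  have h4 : (b + 1 - a).toNat = n := by exact_mod_cast h2
  have h5 : b = a + n - 1 := by omega
  rw [← h1, h3, h5]

/-- The ends of an interval are its leaves. A single vertex has degree zero and is no leaf, whence
`a < b`. -/
theorem derived_image_Icc (hP : IsChainOf G A P) {a b : ℤ} (hab : a < b) :
    derived G (P '' Set.Icc a b) = P '' Set.Icc (a + 1) (b - 1) := by
  have adj := hP.adj
  ext x
  constructor
  · rintro ⟨⟨m, hm, rfl⟩, hx⟩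
    refine ⟨m, ?_, rfl⟩
    have end1 : ∀ n ∈ Set.Icc a b, (∀ i ∈ Set.Icc a b, (m + 1 = i ∨ i + 1 = m) ↔ i = n) → False := by
      intro n hn h
      refine hx ⟨⟨m, hm, rfl⟩, Set.encard_eq_one.2 ⟨P n, ?_⟩⟩
      ext y
      constructor
      · rintro ⟨h1, i, hi, rfl⟩
        rw [(h i hi).1 ((adj _ _).1 h1)]
        rfl
      · rintro rfl
        exact ⟨(adj _ _).2 ((h n hn).2 rfl), n, hn, rfl⟩
    simp only [Set.mem_Icc] at *
    by_contra hlt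
    by_cases h1 : m = a
    · exact end1 (a + 1) (by omega) fun i hi => by omega
    · exact end1 (b - 1) (by omega) fun i hi => by omega
  · rintro ⟨m, hm, rfl⟩
    simp only [Set.mem_Icc] at hm
    have hm1 : m - 1 ∈ Set.Icc a b := by simp only [Set.mem_Icc]; omega
    have hm2 : m + 1 ∈ Set.Icc a b := by simp only [Set.mem_Icc]; omega
    exact ⟨⟨m, by simp only [Set.mem_Icc]; omega, rfl⟩, not_mem_leaves ⟨_, hm1, rfl⟩ ⟨_, hm2, rfl⟩
      ((adj m (m - 1)).2 (by omega)) ((adj m (m + 1)).2 (by omega)) (hP.inj.ne (by omega))⟩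

/-- Two subtrees with a common leaf lie on different sides of it in the chain. -/
theorem exists_of_inter {I J : Set V} {t : V} {n : ℕ} (hn : n ≠ 0) (hP : IsChainOf G (derived G A) P)
    (hI : IsInducedSubtree G I) (hJ : IsInducedSubtree G J) (hIA : I ⊆ A) (hJA : J ⊆ A)
    (hI' : derived G I ⊆ derived G A) (hJ' : derived G J ⊆ derived G A)
    (hIn : (derived G I).encard = n) (hJn : (derived G J).encard = n)
    (htI : t ∈ leaves G I) (htJ : t ∈ leaves G J) (hIJ : I ∩ J = {t}) :
    ∃ Q, IsChainOf G (derived G A) Q ∧ Q 0 = t ∧ derived G I = Q '' Set.Icc (-n) (-1) ∧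
      derived G J = Q '' Set.Icc 1 n := by
  obtain ⟨a, ha⟩ := hP.exists_eq_image_Icc hI hI' hn hIn
  obtain ⟨b, hb⟩ := hP.exists_eq_image_Icc hJ hJ' hn hJn
  have ne : ∀ {S : Set V}, (derived G S).encard = n → (derived G S).Nonempty := by
    intro S h
    rw [← Set.encard_ne_zero, h]
    exact_mod_cast hn
  -- The leaf `t` has an inner neighbor in `I` and another in `J`. They differ because only `t` is
  -- common, so `t` has two neighbors in the union and belongs to the chain.
  obtain ⟨x, hx, hxt⟩ := (exists_adj_derived hI htI.1 (ne hIn)).resolve_left fun h => h.2 htI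
  obtain ⟨y, hy, hyt⟩ := (exists_adj_derived hJ htJ.1 (ne hJn)).resolve_left fun h => h.2 htJ
  have hxy : x ≠ y := by
    rintro rfl
    have : x ∈ ({t} : Set V) := hIJ ▸ ⟨hx.1, hy.1⟩
    rw [Set.mem_singleton_iff.1 this] at hxt
    exact G.irrefl hxt
  obtain ⟨τ, rfl⟩ : t ∈ Set.range P := by
    rw [hP.range]
    exact ⟨hIA htI.1, not_mem_leaves (hIA hx.1) (hJA hy.1) hxt.symm hyt.symm hxy⟩
  have hτI : τ ∉ Set.Icc a (a + n - 1) := fun h => (ha ▸ ⟨τ, h, rfl⟩ : P τ ∈ derived G I).2 htI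
  have hτJ : τ ∉ Set.Icc b (b + n - 1) := fun h => (hb ▸ ⟨τ, h, rfl⟩ : P τ ∈ derived G J).2 htJ
  rw [ha] at hx
  rw [hb] at hy
  obtain ⟨k, hk, rfl⟩ := hx
  obtain ⟨l, hl, rfl⟩ := hy
  rw [hP.adj] at hxt hyt
  have hkl : k ≠ l := fun e => hxy (e ▸ rfl)
  simp only [Set.mem_Icc] at *
  have key : ∀ ε : ℤ, (ε = 1 ∨ ε = -1) → k = τ - ε → l = τ + ε →
      ∃ Q, IsChainOf G (derived G A) Q ∧ Q 0 = P τ ∧ derived G I = Q '' Set.Icc (-n) (-1) ∧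
        derived G J = Q '' Set.Icc 1 n := by
    intro ε hε e1 e2
    have im : ∀ c d c' d' : ℤ, (∀ i, c ≤ i ∧ i ≤ d ↔ c' ≤ ε * (i - τ) ∧ ε * (i - τ) ≤ d') →
        P '' Set.Icc c d = (fun n => P (τ + ε * n)) '' Set.Icc c' d' := by
      intro c d c' d' h
      ext z
      constructor
      · rintro ⟨i, hi, rfl⟩
        refine ⟨ε * (i - τ), (h i).1 hi, ?_⟩
        refine congrArg P ?_
        rcases hε with rfl | rfl <;> ring
      · rintro ⟨i, hi, rfl⟩
        refine ⟨_, (h _).2 ?_, rfl⟩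
        have : ε * (τ + ε * i - τ) = i := by rcases hε with rfl | rfl <;> ring
        rw [this]
        exact hi
    refine ⟨_, hP.comp hε τ, by simp, ?_, ?_⟩
    · rw [ha]
      refine im _ _ _ _ fun i => ?_
      rcases hε with rfl | rfl <;> omega
    · rw [hb]
      refine im _ _ _ _ fun i => ?_
      rcases hε with rfl | rfl <;> omega
  -- The two neighbors lie on different sides of `t`; the chain is reversed if that of `I` comes
  -- after `t`.
  by_cases hk1 : k = τ - 1
  · exact key 1 (Or.inl rfl) hk1 (by omega)
  · exact key (-1) (Or.inr rfl) (by omega) (by omega)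

end IsChainOf

end Graph

/-! ### Caterpillars in the P2-graph -/

theorem adj_iff_tileAdj {𝒯 : Set Tile} {s t : 𝒯} : (P2Graph 𝒯).Adj s t ↔ TileAdj s.1 t.1 :=
  and_congr_left fun _ => not_congr Subtype.ext_iff

theorem exists_cd_eq (s : Tile) : ∃ (F : Frame) (k : ℕ), k < 2 ∧ F.cd ⟨k * 10, P0⟩ = s := by
  obtain ⟨k, hk, hks⟩ : ∃ k < 2, kindOf k = s.kind := by
    rcases s with ⟨_ | _, A, w⟩
    · exact ⟨0, by norm_num, rfl⟩
    · exact ⟨1, by norm_num, rfl⟩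
  refine ⟨⟨s.apex, s.dir, _, isTurn_exp⟩, k, hk, ?_⟩
  have e1 : k * 10 / 10 = k := by omega
  have e2 : k * 10 % 10 = 0 := by omega
  rcases s with ⟨K, A, w⟩
  simp only at hks
  simp [Frame.cd, Code.toRel, Frame.dig_P0, e1, e2, Frame.tile, Frame.pt, val_zero, hks]

theorem addNbrs_length : ∀ k < 2, addNbrs .nil [] ⟨k * 10, P0⟩ (fun _ _ nb => nb.length == 4) = true := by
  decide +kernel

/-- There is one neighbor across each edge, and options of different edges are different tiles. With
degree three this leaves exactly one missing neighbor. -/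
theorem encard_neighborSet {𝒯 : Set Tile} (h𝒯 : IsP2Tiling 𝒯) (s : 𝒯) :
    ((P2Graph 𝒯).neighborSet s).encard = 4 := by
  classical
  obtain ⟨F, k, hk, e⟩ := exists_cd_eq s.1
  have hok : F.Ok 𝒯 ⟨k * 10, P0⟩ :=
    ⟨by simp only; omega, Frame.inBounds_P0, e ▸ s.2⟩
  obtain ⟨M, L, nb, -, hnb, hl⟩ := (Frame.known_nil (F := F)).addNbrs h𝒯 hok (addNbrs_length k hk)
  rw [beq_iff_eq] at hl
  have h1 : Subtype.val '' (P2Graph 𝒯).neighborSet s = F.cd '' {x | x ∈ nb} := by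
    ext t
    constructor
    · rintro ⟨t, ht, rfl⟩
      exact hnb.mem t.1 t.2 (e ▸ adj_iff_tileAdj.1 ht)
    · rintro ⟨x, hx, rfl⟩
      obtain ⟨h2, h3⟩ := hnb.ok x hx
      exact ⟨⟨_, h2.mem⟩, adj_iff_tileAdj.2 (e ▸ h3), rfl⟩
  have h2 : Set.InjOn F.cd {x | x ∈ nb} := fun x hx y hy h =>
    F.cd_injective (hnb.ok x hx).1.kd (hnb.ok y hy).1.kd h
  rw [← Subtype.val_injective.encard_image, h1, h2.encard_image, ← List.coe_toFinset,
    Set.encard_coe_eq_coe_finsetCard, List.toFinset_card_of_nodup hnb.nodup, hl]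
  rfl

/-- Every edge of a tree is a bridge, but from `y` one could still reach `a` through `b` and `S`
after deleting the edge from `y` to `a`. -/
theorem noCycle_of_isInducedSubtree {𝒯 : Set Tile} {A : Set 𝒯}
    (hA : IsInducedSubtree (P2Graph 𝒯) A) : NoCycle (Subtype.val '' A) := by
  rintro S hS hL _ ⟨y, hy, rfl⟩ hyS a ha b hb hya hyb
  by_contra hab
  obtain ⟨a, haA, rfl⟩ := hS ha
  obtain ⟨b, hbA, rfl⟩ := hS hb
  have hadj : ((P2Graph 𝒯).induce A).Adj ⟨y, hy⟩ ⟨a, haA⟩ := adj_iff_tileAdj.2 hya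
  have hbr := SimpleGraph.isAcyclic_iff_forall_adj_isBridge.1 hA.2 hadj
  rw [SimpleGraph.isBridge_iff] at hbr
  have key : ∀ c, Relation.ReflTransGen (fun s t => t ∈ S ∧ TileAdj s t) b.1 c →
      c ∈ S ∧ ∀ c' : A, c'.1.1 = c → (((P2Graph 𝒯).induce A).deleteEdges
        {s(⟨y, hy⟩, ⟨a, haA⟩)}).Reachable ⟨b, hbA⟩ c' := by
    intro c h
    induction h with
    | refl =>
      refine ⟨hb, fun c' e => ?_⟩
      have : c' = ⟨b, hbA⟩ := Subtype.ext (Subtype.ext e)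
      rw [this]
    | tail _ h ih =>
      obtain ⟨hc, ih⟩ := ih
      refine ⟨h.1, fun c' e => ?_⟩
      obtain ⟨d, hd, rfl⟩ := hS hc
      refine (ih ⟨d, hd⟩ rfl).trans (SimpleGraph.Adj.reachable ?_)
      rw [SimpleGraph.deleteEdges_adj]
      refine ⟨adj_iff_tileAdj.2 (e ▸ h.2), fun h1 => hyS ?_⟩
      rw [Set.mem_singleton_iff, Sym2.eq_iff] at h1
      rcases h1 with ⟨h1, -⟩ | ⟨-, h1⟩
      · rw [← (congrArg (fun z : A => z.1.1) h1 : d.1 = y.1)]; exact hc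
      · rw [← (congrArg (fun z : A => z.1.1) h1 : c'.1.1 = y.1), e]; exact h.1
  refine hbr (SimpleGraph.Reachable.trans (SimpleGraph.Adj.reachable ?_)
    ((key a (hL b hb a ha)).2 ⟨a, haA⟩ rfl))
  rw [SimpleGraph.deleteEdges_adj]
  refine ⟨adj_iff_tileAdj.2 hyb, fun h1 => hab ?_⟩
  rw [Set.mem_singleton_iff, Sym2.congr_right] at h1
  exact (congrArg (fun z : A => z.1.1) h1).symm

theorem IsPrimeCaterpillar.spine {𝒯 : Set Tile} (h𝒯 : IsP2Tiling 𝒯) {C : Set 𝒯}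
    (hC : IsPrimeCaterpillar (P2Graph 𝒯) C) {p : ℕ → 𝒯}
    (hp : ∀ v, v ∈ derived (P2Graph 𝒯) C ↔ ∃ i < 8, p i = v)
    (hadj : ∀ i < 7, (P2Graph 𝒯).Adj (p i) (p (i + 1))) (hne : ∀ i < 6, p i ≠ p (i + 2)) :
    Spine 𝒯 (Subtype.val '' C) fun i => (p i).1 := by
  have hm : ∀ i < 8, p i ∈ derived (P2Graph 𝒯) C := fun i hi => (hp _).2 ⟨i, hi, rfl⟩
  refine ⟨?_, fun i hi => ⟨_, (hm i hi).1, rfl⟩, fun i hi => ?_,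
    fun i hi => adj_iff_tileAdj.1 (hadj i hi), fun i hi e => hne i hi (Subtype.ext e), ?_⟩
  · rintro _ ⟨c, -, rfl⟩
    exact c.2
  · have h3 := hC.2.2 _ (hm i hi)
    have h4 := Set.encard_sdiff_add_encard_inter ((P2Graph 𝒯).neighborSet (p i)) C
    rw [degIn] at h3
    rw [encard_neighborSet h𝒯, h3] at h4
    have h5 : ((P2Graph 𝒯).neighborSet (p i) \ C).encard = 1 := by
      generalize ((P2Graph 𝒯).neighborSet (p i) \ C).encard = n at h4
      have h6 : n + 3 = 1 + 3 := by rw [h4]; norm_num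
      exact WithTop.add_right_cancel (by decide) h6
    obtain ⟨t, ht⟩ := Set.encard_eq_one.1 h5
    have htm : t ∈ (P2Graph 𝒯).neighborSet (p i) \ C := ht ▸ rfl
    refine ⟨t.1, t.2, adj_iff_tileAdj.1 htm.1, ?_, fun t' ht' hadj' hne' => ?_⟩
    · rintro ⟨c, hc, e⟩
      exact htm.2 (Subtype.ext e ▸ hc)
    · by_contra hmem
      have : (⟨t', ht'⟩ : 𝒯) ∈ ({t} : Set 𝒯) :=
        ht ▸ ⟨adj_iff_tileAdj.2 hadj', fun h => hmem ⟨_, h, rfl⟩⟩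
      exact hne' (congrArg Subtype.val (Set.mem_singleton_iff.1 this))
  · rintro _ ⟨c, hc, rfl⟩
    rcases exists_adj_derived hC.1.2.1 hc ⟨_, hm 0 (by norm_num)⟩ with h | ⟨x, hx, h⟩
    · obtain ⟨i, hi, rfl⟩ := (hp c).1 h
      exact ⟨i, hi, Or.inl rfl⟩
    · obtain ⟨i, hi, rfl⟩ := (hp x).1 hx
      exact ⟨i, hi, Or.inr (adj_iff_tileAdj.1 h)⟩

/-- A vertex of degree three in `C` has degree at least three in `A`, so it is not a leaf there. -/
theorem IsPrimeCaterpillar.derived_subset {V : Type*} {G : SimpleGraph V} {C A : Set V}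
    (hC : IsPrimeCaterpillar G C) (hCA : C ⊆ A) : derived G C ⊆ derived G A := by
  intro v hv
  refine ⟨hCA hv.1, fun h => ?_⟩
  have h1 : degIn G C v ≤ degIn G A v := Set.encard_le_encard (Set.inter_subset_inter_right _ hCA)
  rw [hC.2.2 v hv, h.2] at h1
  exact absurd h1 (by decide)

/-- The star adjacent to a caterpillar is the one surrounded by it. -/
theorem Ring.eq_of_isAdjacentStar {𝒯 : Set Tile} (h𝒯 : IsP2Tiling 𝒯) {C : Set 𝒯} {p : ℕ → Tile}
    {R : Frame} (h : Ring 𝒯 p R) (hC : NoCycle (Subtype.val '' C)) (hp : Spine 𝒯 (Subtype.val '' C) p)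
    {v : ℂ} (hv : IsAdjacentStar 𝒯 C v) : v = R.o := by
  obtain ⟨hv, s, ⟨hk, rfl⟩, c, hc, hadj⟩ := hv
  exact h.apex_eq h𝒯 hC hp ⟨c, hc, rfl⟩ s.2 (adj_iff_tileAdj.1 hadj).symm hk hv

/-- The first derived graph is the chain of eight tiles; two further derivations remove two tiles at
each end. -/
theorem body_subset_core {𝒯 : Set Tile} {C A : Set 𝒯} {P : ℤ → 𝒯} (hP : IsChainOf (P2Graph 𝒯) A P)
    {a : ℤ} (hC : derived (P2Graph 𝒯) C = P '' Set.Icc a (a + 7)) {i : ℤ}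
    (hi : a + 2 ≤ i) (hi' : i ≤ a + 5) : (P i).1.body ⊆ core 𝒯 C := by
  refine Set.subset_biUnion_of_mem (u := fun s : 𝒯 => s.1.body) ?_
  rw [hC, hP.derived_image_Icc (by omega), hP.derived_image_Icc (by omega)]
  exact ⟨i, by simp only [Set.mem_Icc]; omega, rfl⟩

end PenroseP2

theorem lemma2 (𝒯 : Set PenroseP2.Tile) (h𝒯 : PenroseP2.IsP2Tiling 𝒯) :
    ¬ ∃ C : ℤ → Set 𝒯,
      PenroseP2.IsBiInfiniteFullyLeafedCaterpillar (PenroseP2.P2Graph 𝒯) C ∧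
      ∃ j : ℤ,
        PenroseP2.HasAngle 𝒯 (C (j - 1)) (C j) (C (j + 1)) (4 * Real.pi / 5) ∧
        PenroseP2.HasAngle 𝒯 (C j) (C (j + 1)) (C (j + 2)) (4 * Real.pi / 5) := by
  open PenroseP2 in
  rintro ⟨C, hC, j, ⟨-, -, a, v, b, -, hv, hb, hs⟩, ⟨-, -, a', v', b', ha', hv', -, hs'⟩⟩
  obtain ⟨t, -, -, htI, htJ, -, hIJ⟩ := hC.graft j j le_rfl
  rw [Set.Icc_self, Set.biUnion_singleton] at htI hIJ
  obtain ⟨P, hP⟩ := hC.chain.exists_isChainOf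
  have hsub : ∀ i, C i ⊆ ⋃ j, C j := Set.subset_iUnion C
  -- The chain is numbered so that the common leaf is `Q 0`; the inner tiles of the two caterpillars
  -- are `Q (-8), …, Q (-1)` and `Q 1, …, Q 8`.
  obtain ⟨Q, hQ, rfl, hI, hJ⟩ := hP.exists_of_inter (n := 8) (by norm_num) (hC.prime j).1.2.1
    (hC.prime (j + 1)).1.2.1 (hsub _) (hsub _) ((hC.prime j).derived_subset (hsub _))
    ((hC.prime (j + 1)).derived_subset (hsub _)) (hC.prime j).2.1 (hC.prime (j + 1)).2.1 htI htJ hIJ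
  have hU := noCycle_of_isInducedSubtree hC.tree
  have hCU : ∀ i, Subtype.val '' C i ⊆ Subtype.val '' ⋃ j, C j := fun i => Set.image_mono (hsub i)
  have hN : ∀ i, NoCycle (Subtype.val '' C i) := fun i =>
    noCycle_of_isInducedSubtree (hC.prime i).1.2.1
  have hp : Spine 𝒯 (Subtype.val '' C j) fun i => (Q ((i : ℤ) - 8)).1 := by
    refine (hC.prime j).spine h𝒯 (p := fun i => Q ((i : ℤ) - 8)) (fun v => ?_) (fun i _ => ?_) (fun i _ => ?_)
    · rw [hI]
      constructor
      · rintro ⟨i, hi, rfl⟩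
        simp only [Set.mem_Icc] at hi
        exact ⟨(i + 8).toNat, by omega, congrArg Q (by omega)⟩
      · rintro ⟨i, hi, rfl⟩
        exact ⟨_, by simp only [Set.mem_Icc]; omega, rfl⟩
    · rw [hQ.adj]; omega
    · exact hQ.inj.ne (by omega)
  have hq : Spine 𝒯 (Subtype.val '' C (j + 1)) fun i => (Q ((i : ℤ) + 1)).1 := by
    refine (hC.prime (j + 1)).spine h𝒯 (p := fun i => Q ((i : ℤ) + 1)) (fun v => ?_) (fun i _ => ?_) (fun i _ => ?_)
    · rw [hJ]
      constructor
      · rintro ⟨i, hi, rfl⟩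
        simp only [Set.mem_Icc] at hi
        exact ⟨(i - 1).toNat, by omega, congrArg Q (by omega)⟩
      · rintro ⟨i, hi, rfl⟩
        exact ⟨_, by simp only [Set.mem_Icc]; omega, rfl⟩
    · rw [hQ.adj]; omega
    · exact hQ.inj.ne (by omega)
  obtain ⟨R, hR1, hR2⟩ := hp.exists_ring h𝒯 (hN j)
  obtain ⟨R', hR1', hR2'⟩ := hq.exists_ring h𝒯 (hN (j + 1))
  have hR : Ring 𝒯 _ R := ⟨hR1, hR2⟩
  have hR' : Ring 𝒯 _ R' := ⟨hR1', hR2'⟩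
  -- The centers chosen in the two angle conditions are those of the two rings, so both conditions
  -- concern the same pair of points.
  have ev := hR.eq_of_isAdjacentStar h𝒯 (hN j) hp hv
  have eb := hR'.eq_of_isAdjacentStar h𝒯 (hN (j + 1)) hq hb
  have ea' := hR.eq_of_isAdjacentStar h𝒯 (hN j) hp ha'
  have ev' := hR'.eq_of_isAdjacentStar h𝒯 (hN (j + 1)) hq hv'
  subst ev eb ea' ev'
  refine hR.not_consecutive h𝒯 hU (hCU j) (hCU (j + 1)) hp hq hR' ⟨Q 0, htI.1, rfl⟩ ⟨Q 0, htJ.1, rfl⟩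
    (adj_iff_tileAdj.1 ((hQ.adj _ _).2 ?_)) (adj_iff_tileAdj.1 ((hQ.adj _ _).2 ?_))
    (fun e => absurd (hQ.inj (Subtype.ext e)) ?_) (fun e => absurd (hQ.inj (Subtype.ext e)) ?_)
    (fun e => absurd (hQ.inj (Subtype.ext e)) ?_)
    -- From the first angle only the position of the following center is needed, from the second
    -- only that of the preceding one.
    (hR.rays ?_ ?_ hs).2 (hR'.rays ?_ ?_ hs').1
  · norm_num
  · norm_num
  · norm_num
  · norm_num
  · norm_num
  · exact body_subset_core hQ (a := -8) hI (by norm_num) (by norm_num)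
  · exact body_subset_core hQ (a := -8) hI (by norm_num) (by norm_num)
  · exact body_subset_core hQ (a := 1) hJ (by norm_num) (by norm_num)
  · exact body_subset_core hQ (a := 1) hJ (by norm_num) (by norm_num)
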